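/- Let $\mathcal Z=(\mathcal L_n,\mathcal R_n)_{n\in\mathbb Z}$, $\mathcal Z_0=(0,0)$, be the bi-infinite random walk whose steps $\mathcal Z_{n+1}-\mathcal Z_n$ are independent and uniformly distributed on $\{(1,0),(0,-1),(-1,1)\}$, and let $(G,\mathcal O,\mathbb e)$ be the uniform infinite bipolar-oriented triangulation, that is, the rooted oriented map obtained by sewing triangles along $\mathcal Z$: there is always a current edge on an infinite upward-directed frontier; a step $(1,0)$ sews to the right of the frontier a triangle whose left side is the current edge and whose right side consists of two new edges, the lower of which becomes the current edge; a step $(0,-1)$ sews to the right of the frontier a triangle whose left side consists of the current edge and the frontier edge just below it and whose right side is one new edge, which becomes the current edge; a step $(-1,1)$ makes the frontier edge just above the current edge the current edge. The root $\mathbb e$ is the current edge at time $0$. All edges point upward. The compass is rotated by 45 degrees: up is northwest, down is southeast, left is southwest and right is northeast. The north-going tree of $G$ joins each edge $e$ to the rightmost outgoing edge of the upper endpoint of $e$, and the south-going tree joins $e$ to the leftmost incoming edge of the lower endpoint of $e$. The west-going Peano curve $\dot\lambda'$ of $G$ starts with $\dot\lambda'(0)=\mathbb e$ and snakes between these two trees: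 from an edge $e$ that is the leftmost incoming edge of its upper endpoint it continues to the rightmost outgoing edge of that vertex; from any other edge it crosses the face on the left of $e$ and continues to the lowest edge on the left side of that face. Let $\dot{\mathcal Z}_n=(\dot{\mathcal L}_n,\dot{\mathcal R}_n)$, where $\dot{\mathcal L}_n$ (resp. $\dot{\mathcal R}_n$) is the height of $\dot\lambda'(n)$ in the south-going (resp. north-going) tree of $G$ relative to the height of $\dot\lambda'(0)$. (The height difference of two edges is the difference of the lengths of their branches up to the point where these merge.) Let $(\widetilde G,\widetilde{\mathcal O},\widetilde{\mathbb e})$ be the dual map, where the dual edge of $e$ is oriented from the face on the right of $e$ to the face on the left of $e$. Its south-going tree joins $e$ to the lowest edge on the left side of the face on the left of $e$; its north-going tree joins $e$ to the highest edge on the right side of the face on the right of $e$. The west-going Peano curve $\widetilde\lambda'$ of $\widetilde G$ starts with $\widetilde\lambda'(0)=\widetilde{\mathbb e}$ and snakes between these two trees: from an edge that is the highest edge on the right side of the face on its left it continues to the lowest edge on the left side of that face, and from any other edge it crosses the dual face corresponding to the upper endpoint of the edge and continues to the rightmost outgoing edge of that vertex. Let $\widetilde{\mathcal Z}_n=(\widetilde{\mathcal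 L}_n,\widetilde{\mathcal R}_n)$ be the heights of $\widetilde\lambda'(n)$, relative to $\widetilde\lambda'(0)$, in the south-going tree and in the north-going tree of $\widetilde G$. Fix $\alpha>0$. Extend $\mathcal Z,\widetilde{\mathcal Z},\dot{\mathcal Z}$ to $\mathbb R$ by linear interpolation, and for $m\in\mathbb N$ and $t\in\mathbb R$ put $$Z^m_t=(3\alpha/2)^{1/2}m^{-1/2}\mathcal Z_{tm},\qquad \widetilde Z^m_t=(3\alpha/2)^{1/2}m^{-1/2}\widetilde{\mathcal Z}_{tm},\qquad \dot Z^m_t=(3\alpha/2)^{1/2}m^{-1/2}\dot{\mathcal Z}_{tm}.$$ Let $Z=(L,R)$ be a continuous two-sided two-dimensional Brownian motion with $Z_0=0$, $\operatorname{Var}L_t=\operatorname{Var}R_t=\alpha|t|$ and $\operatorname{Cov}(L_t,R_t)=-\tfrac{\alpha}{2}|t|$. **Proposition.** As $m\to\infty$, $(\widetilde Z^m,\dot Z^m)$ converges in law to $(3Z,Z)$ with respect to the topology of uniform convergence on compact sets. Consequently, if $(Y,Y')$ is any pair of random continuous functions $\mathbb R\to\mathbb R^2$ such that $(Z^m,\widetilde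 Z^m)$ converges in law to $(Y,3Y')$, then $(Z^m,\dot Z^m)$ converges in law to $(Y,Y')$. -/

import Mathlib

open MeasureTheory ProbabilityTheory Filter

/-! ## Oriented combinatorial maps, their duals, trees and Peano curves

Embeddings are drawn with every edge pointing upward. The compass is rotated by 45 degrees:
up = northwest, down = southeast, left = southwest, right = northeast. -/

/-- The half-edges (darts) of a map with edge set `E`: `(e, false)` is the half of `e` at its
starting (lower) vertex, `(e, true)` is the half of `e` at its final (upper) vertex. -/
abbrev Dart (E : Type*) := E × Bool

/-- An oriented combinatorial map (rotation system) with edge set `E`: `rot` sends each dart to the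
next dart in counterclockwise order around its vertex. Vertices are the cycles of `rot`. -/
structure OrientedMap (E : Type*) where
  rot : Equiv.Perm (Dart E)

/-- Exchange the two halves of every edge. -/
def flipDart (E : Type*) : Equiv.Perm (Dart E) :=
  Equiv.prodCongr (Equiv.refl E) Equiv.boolNot

/-- The edge carrying the first dart among `σ d, σ (σ d), ...` that sits at the starting vertex
(`b = false`), respectively at the final vertex (`b = true`), of its edge. -/
noncomputable def firstEdge {E : Type*} (σ : Equiv.Perm (Dart E)) (b : Bool) (d : Dart E) : E :=
  ((σ ^ sInf {k : ℕ | 0 < k ∧ ((σ ^ k) d).2 = b}) d).1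

/-- Let each edge have a successor `p e` on the way to the root of a tree of edges. `relHeight p a b`
is the height of `a` minus the height of `b`: the number of edges on the branch from `a` that are
not on the branch from `b`, minus the number of edges on the branch from `b` that are not on the
branch from `a`. -/
noncomputable def relHeight {E : Type*} (p : E → E) (a b : E) : ℤ :=
  (sInf {k : ℕ | ∃ j : ℕ, p^[k] a = p^[j] b} : ℕ) - (sInf {k : ℕ | ∃ j : ℕ, p^[k] b = p^[j] a} : ℕ)

namespace OrientedMap

variable {E : Type*}

/-- The dual oriented map, with the edge set of the primal map: the dual edge of `e` goes from the
face to the right of `e` to the face to the left of `e`. Its starting half lies in the right face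
and its final half in the left face. The counterclockwise order around a dual vertex is the
counterclockwise order of the boundary edges of the face: an edge with the face on its left is
traversed upward, up to its final vertex, an edge with the face on its right is traversed downward,
down to its starting vertex, and there one takes the next edge clockwise. -/
def dual (M : OrientedMap E) : OrientedMap E := ⟨M.rot.symm.trans (flipDart E)⟩

/-- The reflection that exchanges left and right and keeps the direction of all edges. -/
def mirror (M : OrientedMap E) : OrientedMap E := ⟨M.rot.symm⟩

/-- West-going tree (up and left): the leftmost outgoing edge of the upper vertex of `e`. -/
noncomputable def westParent (M : OrientedMap E) (e : E) : E := firstEdge M.rot.symm false (e, true)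

/-- East-going tree (down and right): the rightmost incoming edge of the lower vertex of `e`. -/
noncomputable def eastParent (M : OrientedMap E) (e : E) : E := firstEdge M.rot.symm true (e, false)

/-- Primal north-going tree (up and right): the rightmost outgoing edge of the upper vertex
of `e`. -/
noncomputable def northParent (M : OrientedMap E) (e : E) : E := firstEdge M.rot false (e, true)

/-- Primal south-going tree (down and left): the leftmost incoming edge of the lower vertex
of `e`. -/
noncomputable def southParent (M : OrientedMap E) (e : E) : E := firstEdge M.rot true (e, false)

/-- One step of the Peano curve between the west-going and the east-going tree. If `e` is the
rightmost incoming edge of its upper vertex, the next edge is the leftmost outgoing edge of that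
vertex. Otherwise the curve crosses the face to the right of `e`, and the next edge is the lowest
edge on the right side of that face, that is, the first edge having the face on its left when one
goes counterclockwise around the face from `e`. -/
noncomputable def peanoNext (M : OrientedMap E) (e : E) : E :=
  if (M.rot (e, true)).2 = false then M.westParent e else firstEdge M.dual.rot true (e, false)

/-- One step backward along the Peano curve. If `e` is the leftmost outgoing edge of its lower
vertex, the previous edge is the rightmost incoming edge of that vertex. Otherwise it is the highest
edge on the left side of the face to the left of `e`. -/
noncomputable def peanoPrev (M : OrientedMap E) (e : E) : E :=
  if (M.rot (e, false)).2 = true then M.eastParent e else firstEdge M.dual.rot false (e, true)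

/-- The bi-infinite Peano curve between the west-going and the east-going tree, at `root` at
time `0`. -/
noncomputable def peano (M : OrientedMap E) (root : E) : ℤ → E
  | Int.ofNat n => M.peanoNext^[n] root
  | Int.negSucc n => M.peanoPrev^[n + 1] root

/-- The lattice walk encoding the rooted map: heights, relative to time `0`, in the west-going
tree (first coordinate) and in the east-going tree (second coordinate) along the Peano curve. -/
noncomputable def encodingWalk (M : OrientedMap E) (root : E) (n : ℤ) : ℤ × ℤ :=
  (relHeight M.westParent (M.peano root n) root, relHeight M.eastParent (M.peano root n) root)

/-- The walk of the dual map, encoding it in the same way as the primal map is encoded. In compass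
directions, the two trees of the dual map are its south-going tree (first coordinate) and its
north-going tree (second coordinate), and the Peano curve is west-going. -/
noncomputable def dualWalk (M : OrientedMap E) (root : E) : ℤ → ℤ × ℤ := M.dual.encodingWalk root

/-- The west-going Peano curve between the primal north-going and south-going trees. By left-right
reflection (which exchanges `westParent` with `northParent` and `eastParent` with `southParent`)
it is defined like `peano`. -/
noncomputable def primalWestPeano (M : OrientedMap E) (root : E) : ℤ → E := M.mirror.peano root

/-- The walk of the primal north-going and south-going trees: heights, relative to time `0`, in the
primal south-going tree (first coordinate) and in the primal north-going tree (second coordinate)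
along the west-going Peano curve `primalWestPeano`. -/
noncomputable def primalWestWalk (M : OrientedMap E) (root : E) (n : ℤ) : ℤ × ℤ :=
  (relHeight M.southParent (M.primalWestPeano root n) root,
    relHeight M.northParent (M.primalWestPeano root n) root)

end OrientedMap

/-! ## The sewing procedure and the uniform infinite bipolar-oriented triangulation -/

/-- In the sewing procedure edges are labelled by the time at which they are the current edge. When
`k` is the current edge, the edge above `k` on the frontier is the edge `j` that becomes current at
the first later time at which the first coordinate is one less than at time `k`. -/
def FrontierAbove (w : ℤ → ℤ × ℤ) (k j : ℤ) : Prop :=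
  IsLeast {i : ℤ | k < i ∧ (w i).1 = (w k).1 - 1} j

/-- When `k` is the current edge, the edge below `k` on the frontier is the edge `j` that was current
at the last earlier time at which the second coordinate is one less than at time `k`. -/
def FrontierBelow (w : ℤ → ℤ × ℤ) (k j : ℤ) : Prop :=
  IsGreatest {i : ℤ | i < k ∧ (w i).2 = (w k).2 - 1} j

/-- `SewnCorner w d d'`: the darts `d`, `d'` bound (in this counterclockwise order around
their vertex) a corner of one of the triangles sewn along the walk `w`.
* A step `(1, 0)` from `k` to `k + 1` sews to the right of the current edge `k` a triangle with left
  side `k` and right side consisting of the new current edge `k + 1` and, above it, an edge `j`.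
* A step `(0, -1)` from `k` to `k + 1` sews to the right of the frontier a triangle with left side
  consisting of `k` and the edge `j` below it, and with right side the new current edge `k + 1`.
* A step `(-1, 1)` moves the current edge one up on the frontier, and adds no triangle. -/
inductive SewnCorner (w : ℤ → ℤ × ℤ) : Dart ℤ → Dart ℤ → Prop
  | right_top (k j : ℤ) : w (k + 1) - w k = (1, 0) → FrontierAbove w (k + 1) j →
      SewnCorner w (k, true) (j, true)
  | right_bottom (k j : ℤ) : w (k + 1) - w k = (1, 0) → FrontierAbove w (k + 1) j →
      SewnCorner w (k + 1, false) (k, false)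
  | right_middle (k j : ℤ) : w (k + 1) - w k = (1, 0) → FrontierAbove w (k + 1) j →
      SewnCorner w (j, false) (k + 1, true)
  | left_top (k j : ℤ) : w (k + 1) - w k = (0, -1) → FrontierBelow w k j →
      SewnCorner w (k, true) (k + 1, true)
  | left_bottom (k j : ℤ) : w (k + 1) - w k = (0, -1) → FrontierBelow w k j →
      SewnCorner w (k + 1, false) (j, false)
  | left_middle (k j : ℤ) : w (k + 1) - w k = (0, -1) → FrontierBelow w k j →
      SewnCorner w (j, true) (k, false)

open Classical in
/-- The infinite oriented triangulation obtained by sewing triangles along the walk `w`, rooted at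
the edge `0`. For almost every simple walk each dart starts exactly one corner and ends exactly one
corner of the sewn triangles, so the rotation system below exists and is unique. -/
noncomputable def sewnMap (w : ℤ → ℤ × ℤ) : OrientedMap ℤ :=
  ⟨if h : ∃ σ : Equiv.Perm (Dart ℤ), ∀ d d', SewnCorner w d d' ↔ σ d = d' then h.choose else 1⟩

/-- `W` is the bi-infinite walk, started at `0` at time `0`, with iid steps uniformly distributed on
`{(1, 0), (0, -1), (-1, 1)}`. Then `sewnMap (W ω)`, rooted at the edge `0`, is the uniform infinite
bipolar-oriented triangulation. -/
structure IsUniformBipolarWalk {Ω : Type*} [MeasurableSpace Ω] (W : Ω → ℤ → ℤ × ℤ)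
    (P : Measure Ω) : Prop where
  zero : ∀ᵐ ω ∂P, W ω 0 = 0
  indep : iIndepFun (fun (n : ℤ) ω => W ω (n + 1) - W ω n) P
  law : ∀ n : ℤ, HasLaw (fun ω => W ω (n + 1) - W ω n)
    (uniformOn ({(1, 0), (0, -1), (-1, 1)} : Set (ℤ × ℤ))) P

/-! ## Path space, rescaling and the limit -/

/-- The Borel sigma-algebra of the topology of locally uniform convergence. -/
instance pathMeasurableSpace : MeasurableSpace C(ℝ, ℝ × ℝ) := borel _

instance pathBorelSpace : BorelSpace C(ℝ, ℝ × ℝ) := ⟨rfl⟩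

/-- A lattice walk as a sequence in the plane. -/
def planePoint (x : ℤ → ℤ × ℤ) (n : ℤ) : ℝ × ℝ := ((x n).1, (x n).2)

/-- Linear interpolation of a lattice walk. -/
noncomputable def interp (x : ℤ → ℤ × ℤ) (t : ℝ) : ℝ × ℝ :=
  planePoint x ⌊t⌋ + Int.fract t • (planePoint x (⌊t⌋ + 1) - planePoint x ⌊t⌋)

theorem interp_eq_of_mem (x : ℤ → ℤ × ℤ) (n : ℤ) (t : ℝ) (ht : t ∈ Set.Icc (n : ℝ) (n + 1)) :
    interp x t = planePoint x n + (t - n) • (planePoint x (n + 1) - planePoint x n) := by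
  rcases eq_or_lt_of_le ht.2 with h | h
  · subst h
    have h1 : ⌊(n : ℝ) + 1⌋ = n + 1 := by simp
    simp [interp, h1]
  · have h1 : ⌊t⌋ = n := Int.floor_eq_iff.2 ⟨ht.1, h⟩
    simp [interp, h1, Int.fract]

theorem continuous_interp (x : ℤ → ℤ × ℤ) : Continuous (interp x) := by
  have hlf : LocallyFinite fun n : ℤ => Set.Icc (n : ℝ) (n + 1) := by
    intro t
    refine ⟨Set.Ioo (t - 1) (t + 1), Ioo_mem_nhds (by linarith) (by linarith), ?_⟩
    refine (Set.finite_Icc (⌊t⌋ - 2) (⌊t⌋ + 2)).subset ?_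
    rintro n ⟨s, hs, hs'⟩
    have h1 := Int.floor_le t
    have h2 := Int.lt_floor_add_one t
    constructor
    · have : ((⌊t⌋ - 2 : ℤ) : ℝ) ≤ n := by push_cast; linarith [hs.2, hs'.1]
      exact_mod_cast this
    · have : (n : ℝ) ≤ ((⌊t⌋ + 2 : ℤ) : ℝ) := by push_cast; linarith [hs.1, hs'.2]
      exact_mod_cast this
  refine hlf.continuous ?_ (fun n => isClosed_Icc) fun n => ?_
  · ext t
    simp only [Set.mem_iUnion, Set.mem_univ, iff_true]
    exact ⟨⌊t⌋, Int.floor_le t, (Int.lt_floor_add_one t).le⟩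
  · have hc : Continuous fun t : ℝ =>
        planePoint x n + (t - n) • (planePoint x (n + 1) - planePoint x n) := by fun_prop
    exact hc.continuousOn.congr fun t ht => interp_eq_of_mem x n t ht

/-- The rescaled path `t ↦ (3 α / 2) ^ (1/2) * m ^ (-1/2) * x (t m)` of a lattice walk `x`. -/
noncomputable def rescaled (α : ℝ) (m : ℕ) (x : ℤ → ℤ × ℤ) : C(ℝ, ℝ × ℝ) where
  toFun t := (Real.sqrt (3 * α / 2) * (Real.sqrt m)⁻¹) • interp x (t * m)
  continuous_toFun := by
    have h := continuous_interp x
    fun_prop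

/-- Two-sided two-dimensional Brownian motion `Z = (L, R)` with `Z 0 = 0` almost surely,
`Var L t = Var R t = α |t|` and correlation `-1/2`, as a continuous centred Gaussian process. -/
structure IsCorrelatedBrownian {Ω : Type*} [MeasurableSpace Ω] (α : ℝ) (Z : Ω → C(ℝ, ℝ × ℝ))
    (P : Measure Ω) : Prop where
  gaussian : IsGaussianProcess (fun (t : ℝ) ω => Z ω t) P
  mean_fst : ∀ t : ℝ, ∫ ω, (Z ω t).1 ∂P = 0
  mean_snd : ∀ t : ℝ, ∫ ω, (Z ω t).2 ∂P = 0
  cov_fst : ∀ s t : ℝ,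
    covariance (fun ω => (Z ω s).1) (fun ω => (Z ω t).1) P = α * ((|s| + |t| - |s - t|) / 2)
  cov_snd : ∀ s t : ℝ,
    covariance (fun ω => (Z ω s).2) (fun ω => (Z ω t).2) P = α * ((|s| + |t| - |s - t|) / 2)
  cov_fst_snd : ∀ s t : ℝ,
    covariance (fun ω => (Z ω s).1) (fun ω => (Z ω t).2) P
      = -(α / 2) * ((|s| + |t| - |s - t|) / 2)

/-! Edges are times of the walk. Almost surely all passage times are finite, and then the rotation
system, the trees and the west-going Peano curve are explicit functions of the sequence of letters,
that is, of steps. They are governed by bracket matching: in the first coordinate a letter 0 is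
closed by a later letter 2, in the second coordinate a letter 2 is closed by a later letter 1. The
primal and the dual description yield the same curve `westPath`.

Primal walk. Local identities between `westNext` and the two trees show that the pair of heights
changes by `westStep` of the letter at the current edge. These letters are again independent and
uniform (`map_westLetter`). To see this, cut the past of an edge, along its south-going branch, into
passage words of the second coordinate, separated by passages of the first coordinate; do the same
with the future along the north-going branch. The separating passages have total weight one, because
the walk is recurrent, so the words are independent. One step of the curve reads the first letter of
the first past word and redistributes the rest between past and future (`words_zero`, `words_one`,
`words_two`). A word of length `l` has weight `3 ^ (-l)`, so the step costs exactly a factor 1/3 and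
leaves words with the same law. Stationarity of the letters seen from the curve
(`letterLaw_westPath`) extends this to negative times. Thus the primal walk has iid centred steps
with variances 2/3 and covariance -1/3, and Donsker's theorem gives the limit `Z`.

Dual walk. The letters along a dual south-going branch are iid and uniform too (`map_dualLetter`):
after each letter the branch either moves to the preceding letter or jumps over a passage word,
again of total weight one, to a fresh letter. Exactly the letters 2, a third of all, advance the
primal branch (`southNext_dual_iterate`). Therefore two primal branches that merge after `a` and `b`
steps come with dual branches that merge after about `3a` and `3b` steps. Hoeffding's inequality
makes the error at most a small multiple of `m ^ (1/2)`, simultaneously for the order `m` edges that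
matter. Time reversal, which is a half turn of the map, gives the same for the north-going trees.

So the rescaled dual walk is uniformly close in probability to three times the rescaled primal walk.
This closeness, with Donsker's theorem, gives the joint limit; by itself it gives the consequence.
-/

open scoped ENNReal

/-! ## Walks encoded by letters -/

/-- The three steps of the walk, indexed by letters. -/
def stepOf : Fin 3 → ℤ × ℤ := ![(1, 0), (0, -1), (-1, 1)]

/-- The first time at which the partial sums of `f` along the sequence `y` reach `-1`. -/
noncomputable def passTime (f : Fin 3 → ℤ) (y : ℕ → Fin 3) : ℕ :=
  sInf {n : ℕ | ∑ i ∈ Finset.range n, f (y i) = -1}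

/-- The value functions of the two coordinates, read forward and backward. -/
def fstFwd (a : Fin 3) : ℤ := (stepOf a).1
def sndFwd (a : Fin 3) : ℤ := (stepOf a).2
def fstBwd (a : Fin 3) : ℤ := -(stepOf a).1
def sndBwd (a : Fin 3) : ℤ := -(stepOf a).2

/-- The letters after time `k`, read forward. -/
def fwd (x : ℤ → Fin 3) (k : ℤ) (i : ℕ) : Fin 3 := x (k + 1 + i)

/-- The letters up to time `k`, read backward. -/
def bwd (x : ℤ → Fin 3) (k : ℤ) (i : ℕ) : Fin 3 := x (k - i)

/-- First later time at which the first coordinate is one less. -/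
noncomputable def fstAfter (x : ℤ → Fin 3) (k : ℤ) : ℤ := k + passTime fstFwd (fwd x k)
/-- First later time at which the second coordinate is one less. -/
noncomputable def sndAfter (x : ℤ → Fin 3) (k : ℤ) : ℤ := k + passTime sndFwd (fwd x k)
/-- Last earlier time at which the first coordinate is one less. -/
noncomputable def fstBefore (x : ℤ → Fin 3) (k : ℤ) : ℤ := k - passTime fstBwd (bwd x k)
/-- Last earlier time at which the second coordinate is one less. -/
noncomputable def sndBefore (x : ℤ → Fin 3) (k : ℤ) : ℤ := k - passTime sndBwd (bwd x k)

/-- All passage times are finite. -/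
structure Recurrent (x : ℤ → Fin 3) : Prop where
  fst_fwd : ∀ k, ∃ n : ℕ, ∑ i ∈ Finset.range n, fstFwd (fwd x k i) = -1
  snd_fwd : ∀ k, ∃ n : ℕ, ∑ i ∈ Finset.range n, sndFwd (fwd x k i) = -1
  fst_bwd : ∀ k, ∃ n : ℕ, ∑ i ∈ Finset.range n, fstBwd (bwd x k i) = -1
  snd_bwd : ∀ k, ∃ n : ℕ, ∑ i ∈ Finset.range n, sndBwd (bwd x k i) = -1

/-- `L` and `R` are the coordinates of a walk with steps given by the letters `x`. -/
structure Follows (x : ℤ → Fin 3) (L R : ℤ → ℤ) : Prop where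
  fst : ∀ n, L n = L (n - 1) + (stepOf (x n)).1
  snd : ∀ n, R n = R (n - 1) + (stepOf (x n)).2

/-- The bi-infinite partial sums of `f`, vanishing at `0`. -/
def intSum {M : Type*} [AddCommGroup M] (f : ℤ → M) : ℤ → M
  | Int.ofNat n => ∑ i ∈ Finset.range n, f (i + 1)
  | Int.negSucc n => -∑ i ∈ Finset.range (n + 1), f (-i)

theorem intSum_zero {M : Type*} [AddCommGroup M] (f : ℤ → M) : intSum f 0 = 0 := by
  simp [intSum]

theorem intSum_step {M : Type*} [AddCommGroup M] (f : ℤ → M) (n : ℤ) :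
    intSum f n = intSum f (n - 1) + f n := by
  rcases n with n | n
  · rcases n with _ | n
    · have : (Int.ofNat 0 - 1 : ℤ) = Int.negSucc 0 := rfl
      rw [this]; simp [intSum]
    · have : (Int.ofNat (n + 1) - 1 : ℤ) = Int.ofNat n := by simp
      rw [this]
      simp [intSum, Finset.sum_range_succ]
  · have : (Int.negSucc n - 1 : ℤ) = Int.negSucc (n + 1) := rfl
    rw [this]
    simp only [intSum]
    rw [Finset.sum_range_succ _ (n + 1)]
    have h : (-((n + 1 : ℕ) : ℤ)) = Int.negSucc n := rfl
    rw [h]; abel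

theorem follows_intSum (x : ℤ → Fin 3) :
    Follows x (intSum fun n => (stepOf (x n)).1) (intSum fun n => (stepOf (x n)).2) :=
  ⟨fun n => intSum_step _ n, fun n => intSum_step _ n⟩

/-- `j` is the first time after `k` at which `h` is one less than at `k`. -/
def IsAfter (h : ℤ → ℤ) (k j : ℤ) : Prop :=
  k < j ∧ h j = h k - 1 ∧ ∀ i, k ≤ i → i < j → h k ≤ h i

/-- `j` is the last time before `k` at which `h` is one less than at `k`. -/
def IsBefore (h : ℤ → ℤ) (k j : ℤ) : Prop :=
  j < k ∧ h j = h k - 1 ∧ ∀ i, j < i → i ≤ k → h k ≤ h i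

/-! ### Uniqueness, composition and reversal of first and last passages -/

theorem IsAfter.unique {h : ℤ → ℤ} {k i j : ℤ} (hi : IsAfter h k i) (hj : IsAfter h k j) :
    i = j := by
  rcases lt_trichotomy i j with hlt | rfl | hlt
  · have := hj.2.2 i hi.1.le hlt; have := hi.2.1; omega
  · rfl
  · have := hi.2.2 j hj.1.le hlt; have := hj.2.1; omega

theorem IsBefore.unique {h : ℤ → ℤ} {k i j : ℤ} (hi : IsBefore h k i) (hj : IsBefore h k j) :
    i = j := by
  rcases lt_trichotomy i j with hlt | rfl | hlt
  · have := hi.2.2 j hlt hj.1.le; have := hj.2.1; omega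
  · rfl
  · have := hj.2.2 i hlt hi.1.le; have := hi.2.1; omega

theorem IsAfter.of_eq {h : ℤ → ℤ} {k j : ℤ} (hj : IsAfter h (k + 1) j) (e : h k = h (k + 1)) :
    IsAfter h k j := by
  refine ⟨by have := hj.1; omega, by rw [e]; exact hj.2.1, fun i h1 h2 => ?_⟩
  rcases eq_or_lt_of_le h1 with rfl | h1
  · exact le_rfl
  · rw [e]; exact hj.2.2 i (by omega) h2

theorem IsAfter.of_desc {h : ℤ → ℤ} {k : ℤ} (e : h (k + 1) = h k - 1) : IsAfter h k (k + 1) :=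
  ⟨by omega, e, fun i h1 h2 => by rw [show i = k by omega]⟩

/-- After an ascent two successive unit descents are needed to get below the starting level. -/
theorem IsAfter.of_asc {h : ℤ → ℤ} {k i j : ℤ} (hi : IsAfter h (k + 1) i) (hj : IsAfter h i j)
    (e : h (k + 1) = h k + 1) : IsAfter h k j := by
  have h1 := hi.1; have h2 := hi.2.1; have h3 := hj.1; have h4 := hj.2.1
  refine ⟨by omega, by omega, fun m hm hm' => ?_⟩
  rcases lt_or_ge m i with h5 | h5
  · rcases eq_or_lt_of_le hm with rfl | hm
    · exact le_rfl
    · have := hi.2.2 m (by omega) h5; omega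
  · have := hj.2.2 m h5 hm'; omega

theorem IsBefore.of_eq {h : ℤ → ℤ} {k j : ℤ} (hj : IsBefore h (k - 1) j) (e : h k = h (k - 1)) :
    IsBefore h k j := by
  refine ⟨by have := hj.1; omega, by rw [e]; exact hj.2.1, fun i h1 h2 => ?_⟩
  rcases eq_or_lt_of_le h2 with rfl | h2
  · exact le_rfl
  · rw [e]; exact hj.2.2 i h1 (by omega)

theorem IsBefore.of_desc {h : ℤ → ℤ} {k : ℤ} (e : h (k - 1) = h k - 1) : IsBefore h k (k - 1) :=
  ⟨by omega, e, fun i h1 h2 => by rw [show i = k by omega]⟩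

theorem IsBefore.of_asc {h : ℤ → ℤ} {k i j : ℤ} (hi : IsBefore h (k - 1) i) (hj : IsBefore h i j)
    (e : h (k - 1) = h k + 1) : IsBefore h k j := by
  have h1 := hi.1; have h2 := hi.2.1; have h3 := hj.1; have h4 := hj.2.1
  refine ⟨by omega, by omega, fun m hm hm' => ?_⟩
  rcases lt_or_ge i m with h5 | h5
  · rcases eq_or_lt_of_le hm' with rfl | hm'
    · exact le_rfl
    · have := hi.2.2 m h5 (by omega); omega
  · have := hj.2.2 m hm h5; omega

/-- The ascent into `k` and the descent into `j` enclose an excursion at levels at least `h k`.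
Descents by at most one force `h (j - 1) = h k`, so read backward from `j - 1` the excursion ends at
`k - 1`. -/
theorem IsAfter.isBefore {h : ℤ → ℤ} {k j : ℤ} (hj : IsAfter h k j) (e : h (k - 1) = h k - 1)
    (hs : h (j - 1) - 1 ≤ h j) : IsBefore h (j - 1) (k - 1) := by
  have h1 := hj.1; have h2 := hj.2.1
  have h3 := hj.2.2 (j - 1) (by omega) (by omega)
  refine ⟨by omega, by omega, fun i h4 h5 => ?_⟩
  have := hj.2.2 i (by omega) (by omega)
  omega

theorem IsBefore.isAfter {h : ℤ → ℤ} {k j : ℤ} (hj : IsBefore h k j) (e : h (k + 1) = h k - 1)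
    (hs : h (j + 1) - 1 ≤ h j) : IsAfter h (j + 1) (k + 1) := by
  have h1 := hj.1; have h2 := hj.2.1
  have h3 := hj.2.2 (j + 1) (by omega) (by omega)
  refine ⟨by omega, by omega, fun i h4 h5 => ?_⟩
  have := hj.2.2 i (by omega) (by omega)
  omega

/-! ### Passage times of letter sequences as first and last passages of the walk -/

theorem passTime_spec {f : Fin 3 → ℤ} (hf : ∀ a, -1 ≤ f a) {y : ℕ → Fin 3}
    (h : ∃ n : ℕ, ∑ i ∈ Finset.range n, f (y i) = -1) :
    0 < passTime f y ∧ ∑ i ∈ Finset.range (passTime f y), f (y i) = -1 ∧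
      ∀ n < passTime f y, 0 ≤ ∑ i ∈ Finset.range n, f (y i) := by
  have h1 : ∑ i ∈ Finset.range (passTime f y), f (y i) = -1 := Nat.sInf_mem h
  refine ⟨?_, h1, fun n => ?_⟩
  · rcases Nat.eq_zero_or_pos (passTime f y) with h0 | h0
    · rw [h0] at h1; simp at h1
    · exact h0
  -- A step is at least `-1`, so a nonnegative partial sum is followed by a sum that is at least
  -- `-1`; before the infimum the value `-1` itself is excluded.
  · induction n with
    | zero => simp
    | succ n ih =>
      intro hn
      have h2 := ih (by omega)
      have h3 : ∑ i ∈ Finset.range (n + 1), f (y i) ≠ -1 := fun h4 =>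
        Nat.notMem_of_lt_sInf hn h4
      rw [Finset.sum_range_succ] at h3 ⊢
      have := hf (y n)
      omega

theorem neg_one_le_fstFwd (a : Fin 3) : -1 ≤ fstFwd a := by fin_cases a <;> decide
theorem neg_one_le_sndFwd (a : Fin 3) : -1 ≤ sndFwd a := by fin_cases a <;> decide
theorem neg_one_le_fstBwd (a : Fin 3) : -1 ≤ fstBwd a := by fin_cases a <;> decide
theorem neg_one_le_sndBwd (a : Fin 3) : -1 ≤ sndBwd a := by fin_cases a <;> decide

theorem sum_fwd {x : ℤ → Fin 3} {h : ℤ → ℤ} {g : Fin 3 → ℤ} (hh : ∀ n, h n = h (n - 1) + g (x n))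
    (k : ℤ) (n : ℕ) : ∑ i ∈ Finset.range n, g (fwd x k i) = h (k + n) - h k := by
  induction n with
  | zero => simp
  | succ n ih =>
    rw [Finset.sum_range_succ, ih, fwd]
    have := hh (k + 1 + n)
    rw [show k + 1 + (n : ℤ) - 1 = k + n by ring] at this
    rw [show (k + ((n + 1 : ℕ) : ℤ)) = k + 1 + n by push_cast; ring]
    omega

theorem sum_bwd {x : ℤ → Fin 3} {h : ℤ → ℤ} {g : Fin 3 → ℤ} (hh : ∀ n, h n = h (n - 1) + g (x n))
    (k : ℤ) (n : ℕ) : ∑ i ∈ Finset.range n, -g (bwd x k i) = h (k - n) - h k := by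
  induction n with
  | zero => simp
  | succ n ih =>
    rw [Finset.sum_range_succ, ih, bwd]
    have := hh (k - n)
    rw [show (k - ((n + 1 : ℕ) : ℤ)) = k - n - 1 by push_cast; ring]
    omega

theorem isAfter_passTime {x : ℤ → Fin 3} {h : ℤ → ℤ} {g : Fin 3 → ℤ} (hg : ∀ a, -1 ≤ g a)
    (hh : ∀ n, h n = h (n - 1) + g (x n)) (k : ℤ)
    (hx : ∃ n : ℕ, ∑ i ∈ Finset.range n, g (fwd x k i) = -1) :
    IsAfter h k (k + passTime g (fwd x k)) := by
  obtain ⟨h1, h2, h3⟩ := passTime_spec hg hx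
  rw [sum_fwd hh] at h2
  refine ⟨by omega, by omega, fun i hi hi' => ?_⟩
  have := h3 (i - k).toNat (by omega)
  rw [sum_fwd hh, show k + ((i - k).toNat : ℤ) = i by omega] at this
  omega

theorem isBefore_passTime {x : ℤ → Fin 3} {h : ℤ → ℤ} {g : Fin 3 → ℤ} (hg : ∀ a, -1 ≤ -g a)
    (hh : ∀ n, h n = h (n - 1) + g (x n)) (k : ℤ)
    (hx : ∃ n : ℕ, ∑ i ∈ Finset.range n, -g (bwd x k i) = -1) :
    IsBefore h k (k - passTime (fun a => -g a) (bwd x k)) := by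
  obtain ⟨h1, h2, h3⟩ := passTime_spec hg hx
  rw [sum_bwd hh] at h2
  refine ⟨by omega, by omega, fun i hi hi' => ?_⟩
  have := h3 (k - i).toNat (by omega)
  rw [sum_bwd hh, show k - ((k - i).toNat : ℤ) = i by omega] at this
  omega

section

variable {x : ℤ → Fin 3} {L R : ℤ → ℤ}

theorem Follows.fstAfter (hw : Follows x L R) (hx : Recurrent x) (k : ℤ) :
    IsAfter L k (fstAfter x k) := isAfter_passTime neg_one_le_fstFwd hw.fst k (hx.fst_fwd k)

theorem Follows.sndAfter (hw : Follows x L R) (hx : Recurrent x) (k : ℤ) :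
    IsAfter R k (sndAfter x k) := isAfter_passTime neg_one_le_sndFwd hw.snd k (hx.snd_fwd k)

theorem Follows.fstBefore (hw : Follows x L R) (hx : Recurrent x) (k : ℤ) :
    IsBefore L k (fstBefore x k) := isBefore_passTime neg_one_le_fstBwd hw.fst k (hx.fst_bwd k)

theorem Follows.sndBefore (hw : Follows x L R) (hx : Recurrent x) (k : ℤ) :
    IsBefore R k (sndBefore x k) := isBefore_passTime neg_one_le_sndBwd hw.snd k (hx.snd_bwd k)

/-- The three possible steps of a walk. -/
theorem Follows.cases (hw : Follows x L R) (k : ℤ) :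
    (x k = 0 ∧ L k = L (k - 1) + 1 ∧ R k = R (k - 1)) ∨
    (x k = 1 ∧ L k = L (k - 1) ∧ R k = R (k - 1) - 1) ∨
    (x k = 2 ∧ L k = L (k - 1) - 1 ∧ R k = R (k - 1) + 1) := by
  have h1 := hw.fst k
  have h2 := hw.snd k
  generalize x k = a at *
  fin_cases a <;> simp [stepOf] at h1 h2 ⊢ <;> omega

theorem letter_cases (a : Fin 3) : a = 0 ∨ a = 1 ∨ a = 2 := by fin_cases a <;> decide

theorem Follows.eq_zero (hw : Follows x L R) {k : ℤ} (h : x k = 0) :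
    L k = L (k - 1) + 1 ∧ R k = R (k - 1) := by
  have := hw.cases k; rw [h] at this; simpa using this

theorem Follows.eq_one (hw : Follows x L R) {k : ℤ} (h : x k = 1) :
    L k = L (k - 1) ∧ R k = R (k - 1) - 1 := by
  have := hw.cases k; rw [h] at this; simpa using this

theorem Follows.eq_two (hw : Follows x L R) {k : ℤ} (h : x k = 2) :
    L k = L (k - 1) - 1 ∧ R k = R (k - 1) + 1 := by
  have := hw.cases k; rw [h] at this; simpa using this

end

/-! ### The trees and the Peano curve in terms of letters -/

/-- Successor in the south-going tree. -/
noncomputable def southNext (x : ℤ → Fin 3) (e : ℤ) : ℤ := fstBefore x (sndBefore x e) + 1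
/-- Successor in the north-going tree. -/
noncomputable def northNext (x : ℤ → Fin 3) (e : ℤ) : ℤ := sndAfter x (fstAfter x e) - 1
/-- Successor in the south-going tree of the dual map. -/
noncomputable def dualSouthNext (x : ℤ → Fin 3) (e : ℤ) : ℤ :=
  if x e = 0 then e - 1 else if x e = 1 then sndBefore x (e - 1) else fstBefore x (e - 1)
/-- Successor in the north-going tree of the dual map. -/
noncomputable def dualNorthNext (x : ℤ → Fin 3) (e : ℤ) : ℤ :=
  if x (e + 1) = 1 then e + 1 else if x (e + 1) = 0 then fstAfter x (e + 1) else sndAfter x (e + 1)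
/-- One step of the west-going Peano curve. -/
noncomputable def westNext (x : ℤ → Fin 3) (e : ℤ) : ℤ :=
  if x e = 0 then northNext x e else if x e = 1 then sndBefore x (e - 1) else fstBefore x (e - 1)
/-- One step backward of the west-going Peano curve. -/
noncomputable def westPrev (x : ℤ → Fin 3) (e : ℤ) : ℤ :=
  if x (e + 1) = 1 then southNext x e
  else if x (e + 1) = 0 then fstAfter x (e + 1) else sndAfter x (e + 1)

theorem westNext_zero {x : ℤ → Fin 3} {e : ℤ} (h : x e = 0) : westNext x e = northNext x e := by simp [westNext, h]
theorem westNext_one {x : ℤ → Fin 3} {e : ℤ} (h : x e = 1) : westNext x e = sndBefore x (e - 1) := by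
  simp [westNext, h]
theorem westNext_two {x : ℤ → Fin 3} {e : ℤ} (h : x e = 2) : westNext x e = fstBefore x (e - 1) := by
  simp [westNext, h]
theorem westPrev_one {x : ℤ → Fin 3} {e : ℤ} (h : x (e + 1) = 1) : westPrev x e = southNext x e := by
  simp [westPrev, h]
theorem westPrev_zero {x : ℤ → Fin 3} {e : ℤ} (h : x (e + 1) = 0) : westPrev x e = fstAfter x (e + 1) := by
  simp [westPrev, h]
theorem westPrev_two {x : ℤ → Fin 3} {e : ℤ} (h : x (e + 1) = 2) : westPrev x e = sndAfter x (e + 1) := by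
  simp [westPrev, h]

namespace Recurrent

variable {x : ℤ → Fin 3} (hx : Recurrent x)
include hx

/-! Passage times starting from each kind of step. -/

theorem fstAfter_one {k : ℤ} (h : x (k + 1) = 1) : fstAfter x k = fstAfter x (k + 1) := by
  have hw := follows_intSum x
  have := hw.eq_one h; rw [add_sub_cancel_right] at this
  exact (hw.fstAfter hx k).unique ((hw.fstAfter hx (k + 1)).of_eq this.1.symm)

theorem fstAfter_two {k : ℤ} (h : x (k + 1) = 2) : fstAfter x k = k + 1 := by
  have hw := follows_intSum x
  have := hw.eq_two h; rw [add_sub_cancel_right] at this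
  exact (hw.fstAfter hx k).unique (IsAfter.of_desc this.1)

theorem fstAfter_zero {k : ℤ} (h : x (k + 1) = 0) :
    fstAfter x k = fstAfter x (fstAfter x (k + 1)) := by
  have hw := follows_intSum x
  have := hw.eq_zero h; rw [add_sub_cancel_right] at this
  exact (hw.fstAfter hx k).unique ((hw.fstAfter hx (k + 1)).of_asc (hw.fstAfter hx _) this.1)

theorem sndBefore_zero {k : ℤ} (h : x k = 0) : sndBefore x k = sndBefore x (k - 1) := by
  have hw := follows_intSum x
  exact (hw.sndBefore hx k).unique ((hw.sndBefore hx (k - 1)).of_eq (hw.eq_zero h).2)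

theorem sndBefore_two {k : ℤ} (h : x k = 2) : sndBefore x k = k - 1 := by
  have hw := follows_intSum x
  have := hw.eq_two h
  exact (hw.sndBefore hx k).unique (IsBefore.of_desc (by omega))

theorem sndBefore_one {k : ℤ} (h : x k = 1) :
    sndBefore x k = sndBefore x (sndBefore x (k - 1)) := by
  have hw := follows_intSum x
  have := hw.eq_one h
  exact (hw.sndBefore hx k).unique
    ((hw.sndBefore hx (k - 1)).of_asc (hw.sndBefore hx _) (by omega))

/-! Letters at passage times. -/

theorem lt_fstAfter (k : ℤ) : k < fstAfter x k := ((follows_intSum x).fstAfter hx k).1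
theorem lt_sndAfter (k : ℤ) : k < sndAfter x k := ((follows_intSum x).sndAfter hx k).1
theorem fstBefore_lt (k : ℤ) : fstBefore x k < k := ((follows_intSum x).fstBefore hx k).1
theorem sndBefore_lt (k : ℤ) : sndBefore x k < k := ((follows_intSum x).sndBefore hx k).1

/-- A first passage ends with a descent, and only the letter 2 lowers the first coordinate. The
three lemmas after it are of the same kind; looking backward, it is the step just after the passage
time that is identified, whence the `+ 1`. -/
theorem letter_fstAfter (k : ℤ) : x (fstAfter x k) = 2 := by
  have hw := follows_intSum x
  obtain ⟨h1, h2, h3⟩ := hw.fstAfter hx k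
  have := h3 (fstAfter x k - 1) (by omega) (by omega)
  rcases hw.cases (fstAfter x k) with h | h | h
  · omega
  · omega
  · exact h.1

theorem letter_sndAfter (k : ℤ) : x (sndAfter x k) = 1 := by
  have hw := follows_intSum x
  obtain ⟨h1, h2, h3⟩ := hw.sndAfter hx k
  have := h3 (sndAfter x k - 1) (by omega) (by omega)
  rcases hw.cases (sndAfter x k) with h | h | h
  · omega
  · exact h.1
  · omega

theorem letter_fstBefore (k : ℤ) : x (fstBefore x k + 1) = 0 := by
  have hw := follows_intSum x
  obtain ⟨h1, h2, h3⟩ := hw.fstBefore hx k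
  have := h3 (fstBefore x k + 1) (by omega) (by omega)
  rcases hw.cases (fstBefore x k + 1) with h | h | h <;> rw [add_sub_cancel_right] at h
  · exact h.1
  · omega
  · omega

theorem letter_sndBefore (k : ℤ) : x (sndBefore x k + 1) = 2 := by
  have hw := follows_intSum x
  obtain ⟨h1, h2, h3⟩ := hw.sndBefore hx k
  have := h3 (sndBefore x k + 1) (by omega) (by omega)
  rcases hw.cases (sndBefore x k + 1) with h | h | h <;> rw [add_sub_cancel_right] at h
  · omega
  · omega
  · exact h.1

/-! Inverse passages. -/

/-- In the first coordinate a letter 0 opens a bracket and a letter 2 closes it; in the second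
coordinate a letter 2 opens and a letter 1 closes. Matching forward and matching backward are
inverse to each other. -/
theorem fstBefore_fstAfter {k : ℤ} (h : x k = 0) : fstBefore x (fstAfter x k - 1) = k - 1 := by
  have hw := follows_intSum x
  have h1 := hw.eq_zero h
  have h2 := hw.eq_two (hx.letter_fstAfter k)
  exact (hw.fstBefore hx _).unique ((hw.fstAfter hx k).isBefore (by omega) (by omega))

theorem sndBefore_sndAfter {k : ℤ} (h : x k = 2) : sndBefore x (sndAfter x k - 1) = k - 1 := by
  have hw := follows_intSum x
  have h1 := hw.eq_two h
  have h2 := hw.eq_one (hx.letter_sndAfter k)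
  exact (hw.sndBefore hx _).unique ((hw.sndAfter hx k).isBefore (by omega) (by omega))

theorem fstAfter_fstBefore {k : ℤ} (h : x (k + 1) = 2) :
    fstAfter x (fstBefore x k + 1) = k + 1 := by
  have hw := follows_intSum x
  have h1 := hw.eq_two h
  have h2 := hw.eq_zero (hx.letter_fstBefore k)
  rw [add_sub_cancel_right] at h1 h2
  exact (hw.fstAfter hx _).unique ((hw.fstBefore hx k).isAfter (by omega) (by omega))

theorem sndAfter_sndBefore {k : ℤ} (h : x (k + 1) = 1) :
    sndAfter x (sndBefore x k + 1) = k + 1 := by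
  have hw := follows_intSum x
  have h1 := hw.eq_one h
  have h2 := hw.eq_two (hx.letter_sndBefore k)
  rw [add_sub_cancel_right] at h1 h2
  exact (hw.sndAfter hx _).unique ((hw.sndBefore hx k).isAfter (by omega) (by omega))

/-! Recursions for the trees. -/

/-- Incoming edges met when turning around the upper endpoint of `e` have the same north-going
successor as `e`; the turn ends, with a letter 2, at the rightmost outgoing edge. -/
theorem northNext_zero {e : ℤ} (h : x (e + 1) = 0) :
    northNext x e = northNext x (fstAfter x (e + 1)) := by
  rw [northNext, hx.fstAfter_zero h, northNext]

theorem northNext_one {e : ℤ} (h : x (e + 1) = 1) : northNext x e = northNext x (e + 1) := by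
  rw [northNext, hx.fstAfter_one h, northNext]

theorem northNext_two {e : ℤ} (h : x (e + 1) = 2) : northNext x e = sndAfter x (e + 1) - 1 := by
  rw [northNext, hx.fstAfter_two h]

theorem southNext_zero {e : ℤ} (h : x e = 0) : southNext x e = southNext x (e - 1) := by
  rw [southNext, hx.sndBefore_zero h, southNext]

theorem southNext_one {e : ℤ} (h : x e = 1) :
    southNext x e = southNext x (sndBefore x (e - 1)) := by
  rw [southNext, hx.sndBefore_one h, southNext]

theorem southNext_two {e : ℤ} (h : x e = 2) : southNext x e = fstBefore x (e - 1) + 1 := by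
  rw [southNext, hx.sndBefore_two h]

theorem southNext_lt (e : ℤ) : southNext x e < e := by
  have := hx.sndBefore_lt e; have := hx.fstBefore_lt (sndBefore x e); rw [southNext]; omega

theorem lt_northNext (e : ℤ) : e < northNext x e := by
  have := hx.lt_fstAfter e; have := hx.lt_sndAfter (fstAfter x e); rw [northNext]; omega

theorem letter_southNext (e : ℤ) : x (southNext x e) = 0 := hx.letter_fstBefore _

theorem letter_northNext (e : ℤ) : x (northNext x e + 1) = 1 := by
  rw [northNext, sub_add_cancel]; exact hx.letter_sndAfter _

theorem sndBefore_northNext (e : ℤ) : sndBefore x (northNext x e) = fstAfter x e - 1 :=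
  hx.sndBefore_sndAfter (hx.letter_fstAfter e)

theorem fstAfter_southNext (e : ℤ) : fstAfter x (southNext x e) = sndBefore x e + 1 :=
  hx.fstAfter_fstBefore (hx.letter_sndBefore e)

theorem southNext_northNext {e : ℤ} (h : x e = 0) : southNext x (northNext x e) = e := by
  rw [southNext, hx.sndBefore_northNext, hx.fstBefore_fstAfter h, sub_add_cancel]

theorem northNext_southNext {e : ℤ} (h : x (e + 1) = 1) : northNext x (southNext x e) = e := by
  rw [northNext, hx.fstAfter_southNext, hx.sndAfter_sndBefore h, add_sub_cancel_right]

/-! The Peano curve. -/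

theorem westPrev_westNext (e : ℤ) : westPrev x (westNext x e) = e := by
  rcases letter_cases (x e) with h | h | h
  · rw [westNext_zero h, westPrev_one (hx.letter_northNext e), hx.southNext_northNext h]
  · rw [westNext_one h, westPrev_two (hx.letter_sndBefore _),
      hx.sndAfter_sndBefore (by rwa [sub_add_cancel]), sub_add_cancel]
  · rw [westNext_two h, westPrev_zero (hx.letter_fstBefore _),
      hx.fstAfter_fstBefore (by rwa [sub_add_cancel]), sub_add_cancel]

theorem westNext_westPrev (e : ℤ) : westNext x (westPrev x e) = e := by
  rcases letter_cases (x (e + 1)) with h | h | h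
  · rw [westPrev_zero h, westNext_two (hx.letter_fstAfter _), hx.fstBefore_fstAfter h,
      add_sub_cancel_right]
  · rw [westPrev_one h, westNext_zero (hx.letter_southNext _), hx.northNext_southNext h]
  · rw [westPrev_two h, westNext_one (hx.letter_sndAfter _), hx.sndBefore_sndAfter h,
      add_sub_cancel_right]

/-! Local relations between the trees along the Peano curve. -/

/-- Together with `westNext_zero`, the identities of this group show that the letters 0, 1, 2 change
the height in the south-going tree by 1, 0, -1 and the height in the north-going tree by -1, 1, 0.
This is where `westStep` comes from. -/
theorem southNext_westNext_zero {e : ℤ} (h : x e = 0) : southNext x (westNext x e) = e := by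
  rw [westNext_zero h, hx.southNext_northNext h]

theorem southNext_westNext_one {e : ℤ} (h : x e = 1) :
    southNext x (westNext x e) = southNext x e := by
  rw [westNext_one h, hx.southNext_one h]

theorem southNext_westNext_two {e : ℤ} (h : x e = 2) :
    southNext x (westNext x e) = southNext x (southNext x e) := by
  have h1 := hx.letter_southNext e
  have h2 := hx.southNext_two h
  rw [hx.southNext_zero h1, h2, add_sub_cancel_right, westNext_two h]

theorem northNext_westNext_one {e : ℤ} (h : x e = 1) :
    northNext x (northNext x (westNext x e)) = northNext x e := by
  rw [westNext_one h, hx.northNext_two (hx.letter_sndBefore _),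
    hx.sndAfter_sndBefore (by rwa [sub_add_cancel]), sub_add_cancel,
    hx.northNext_one (e := e - 1) (by rwa [sub_add_cancel]), sub_add_cancel]

theorem northNext_westNext_two {e : ℤ} (h : x e = 2) :
    northNext x (westNext x e) = northNext x e := by
  rw [westNext_two h, hx.northNext_zero (hx.letter_fstBefore _),
    hx.fstAfter_fstBefore (by rwa [sub_add_cancel]), sub_add_cancel]

end Recurrent

/-! ### Time shift and time reversal -/

/-- Time shift. -/
def shiftSeq (j : ℤ) (x : ℤ → Fin 3) : ℤ → Fin 3 := fun n => x (n + j)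

/-- Time reversal, which corresponds to rotating the map by a half turn. -/
def revSeq (x : ℤ → Fin 3) : ℤ → Fin 3 := fun n => Equiv.swap 0 1 (x (1 - n))

theorem shiftSeq_apply (j : ℤ) (x : ℤ → Fin 3) (k : ℤ) : shiftSeq j x k = x (k + j) := rfl

theorem bwd_shiftSeq (j : ℤ) (x : ℤ → Fin 3) (k : ℤ) : bwd (shiftSeq j x) k = bwd x (k + j) := by
  funext i; simp only [bwd, shiftSeq]; congr 1; ring

theorem fwd_shiftSeq (j : ℤ) (x : ℤ → Fin 3) (k : ℤ) : fwd (shiftSeq j x) k = fwd x (k + j) := by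
  funext i; simp only [fwd, shiftSeq]; congr 1; ring

theorem fstAfter_shiftSeq (j : ℤ) (x : ℤ → Fin 3) (k : ℤ) :
    fstAfter (shiftSeq j x) k = fstAfter x (k + j) - j := by
  rw [fstAfter, fstAfter, fwd_shiftSeq]; ring

theorem sndAfter_shiftSeq (j : ℤ) (x : ℤ → Fin 3) (k : ℤ) :
    sndAfter (shiftSeq j x) k = sndAfter x (k + j) - j := by
  rw [sndAfter, sndAfter, fwd_shiftSeq]; ring

theorem fstBefore_shiftSeq (j : ℤ) (x : ℤ → Fin 3) (k : ℤ) :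
    fstBefore (shiftSeq j x) k = fstBefore x (k + j) - j := by
  rw [fstBefore, fstBefore, bwd_shiftSeq]; ring

theorem sndBefore_shiftSeq (j : ℤ) (x : ℤ → Fin 3) (k : ℤ) :
    sndBefore (shiftSeq j x) k = sndBefore x (k + j) - j := by
  rw [sndBefore, sndBefore, bwd_shiftSeq]; ring

theorem northNext_shiftSeq (j : ℤ) (x : ℤ → Fin 3) (k : ℤ) :
    northNext (shiftSeq j x) k = northNext x (k + j) - j := by
  simp only [northNext, fstAfter_shiftSeq, sndAfter_shiftSeq]
  rw [sub_add_cancel]; ring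

theorem westNext_shiftSeq (j : ℤ) (x : ℤ → Fin 3) (k : ℤ) :
    westNext (shiftSeq j x) k = westNext x (k + j) - j := by
  simp only [westNext, shiftSeq_apply, northNext_shiftSeq, sndBefore_shiftSeq, fstBefore_shiftSeq]
  rw [show k - 1 + j = k + j - 1 by ring]
  split_ifs <;> rfl

theorem dualSouthNext_shiftSeq (j : ℤ) (x : ℤ → Fin 3) (k : ℤ) :
    dualSouthNext (shiftSeq j x) k = dualSouthNext x (k + j) - j := by
  simp only [dualSouthNext, shiftSeq_apply, sndBefore_shiftSeq, fstBefore_shiftSeq]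
  rw [show k - 1 + j = k + j - 1 by ring]
  split_ifs
  · ring
  · rfl
  · rfl

theorem Recurrent.shift {x : ℤ → Fin 3} (hx : Recurrent x) (j : ℤ) :
    Recurrent (shiftSeq j x) := by
  constructor <;> intro k
  · rw [fwd_shiftSeq]; exact hx.fst_fwd _
  · rw [fwd_shiftSeq]; exact hx.snd_fwd _
  · rw [bwd_shiftSeq]; exact hx.fst_bwd _
  · rw [bwd_shiftSeq]; exact hx.snd_bwd _

/-- The negatives of the three steps, with their coordinates exchanged, are again the three steps,
with the letters 0 and 1 exchanged. Time reversal therefore interchanges past and future, and at the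
same time the two coordinates. -/
theorem sndBwd_swap (a : Fin 3) : sndBwd (Equiv.swap 0 1 a) = fstFwd a := by
  fin_cases a <;> decide
theorem fstBwd_swap (a : Fin 3) : fstBwd (Equiv.swap 0 1 a) = sndFwd a := by
  fin_cases a <;> decide
theorem sndFwd_swap (a : Fin 3) : sndFwd (Equiv.swap 0 1 a) = fstBwd a := by
  fin_cases a <;> decide
theorem fstFwd_swap (a : Fin 3) : fstFwd (Equiv.swap 0 1 a) = sndBwd a := by
  fin_cases a <;> decide

/-- The letter at `n` belongs to the step from `n - 1` to `n`, so letters are reflected by `1 - n`,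
whereas edges, being times, are reflected by `-k`. -/
theorem bwd_revSeq (x : ℤ → Fin 3) (k : ℤ) (i : ℕ) :
    bwd (revSeq x) k i = Equiv.swap 0 1 (fwd x (-k) i) := by
  simp only [bwd, revSeq, fwd]; congr 2; ring

theorem fwd_revSeq (x : ℤ → Fin 3) (k : ℤ) (i : ℕ) :
    fwd (revSeq x) k i = Equiv.swap 0 1 (bwd x (-k) i) := by
  simp only [fwd, revSeq, bwd]; congr 2; ring

theorem sndBefore_revSeq (x : ℤ → Fin 3) (k : ℤ) :
    sndBefore (revSeq x) k = -fstAfter x (-k) := by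
  simp only [sndBefore, fstAfter, passTime, bwd_revSeq, sndBwd_swap]; ring
theorem fstBefore_revSeq (x : ℤ → Fin 3) (k : ℤ) :
    fstBefore (revSeq x) k = -sndAfter x (-k) := by
  simp only [fstBefore, sndAfter, passTime, bwd_revSeq, fstBwd_swap]; ring
theorem sndAfter_revSeq (x : ℤ → Fin 3) (k : ℤ) :
    sndAfter (revSeq x) k = -fstBefore x (-k) := by
  simp only [sndAfter, fstBefore, passTime, fwd_revSeq, sndFwd_swap]; ring
theorem fstAfter_revSeq (x : ℤ → Fin 3) (k : ℤ) :
    fstAfter (revSeq x) k = -sndBefore x (-k) := by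
  simp only [fstAfter, sndBefore, passTime, fwd_revSeq, fstFwd_swap]; ring

theorem Recurrent.rev {x : ℤ → Fin 3} (hx : Recurrent x) : Recurrent (revSeq x) := by
  constructor <;> intro k
  · simp only [fwd_revSeq, fstFwd_swap]; exact hx.snd_bwd _
  · simp only [fwd_revSeq, sndFwd_swap]; exact hx.fst_bwd _
  · simp only [bwd_revSeq, fstBwd_swap]; exact hx.snd_fwd _
  · simp only [bwd_revSeq, sndBwd_swap]; exact hx.fst_fwd _

theorem southNext_revSeq (x : ℤ → Fin 3) (k : ℤ) :
    southNext (revSeq x) k = -northNext x (-k) := by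
  simp only [southNext, northNext, sndBefore_revSeq, fstBefore_revSeq, neg_neg]; ring

theorem northNext_revSeq (x : ℤ → Fin 3) (k : ℤ) :
    northNext (revSeq x) k = -southNext x (-k) := by
  simp only [southNext, northNext, sndAfter_revSeq, fstAfter_revSeq, neg_neg]; ring

theorem swap_eq_zero (a : Fin 3) : Equiv.swap 0 1 a = 0 ↔ a = 1 := by fin_cases a <;> decide
theorem swap_eq_one (a : Fin 3) : Equiv.swap 0 1 a = 1 ↔ a = 0 := by fin_cases a <;> decide
theorem dualSouthNext_revSeq (x : ℤ → Fin 3) (k : ℤ) :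
    dualSouthNext (revSeq x) k = -dualNorthNext x (-k) := by
  simp only [dualSouthNext, dualNorthNext, revSeq, swap_eq_zero, swap_eq_one]
  rw [show (1 - k) = -k + 1 by ring]
  have h1 := sndBefore_revSeq x (k - 1)
  have h2 := fstBefore_revSeq x (k - 1)
  rw [show -(k - 1) = -k + 1 by ring] at h1 h2
  split_ifs
  · ring
  · exact h1
  · exact h2

theorem westNext_revSeq (x : ℤ → Fin 3) (k : ℤ) :
    westNext (revSeq x) k = -westPrev x (-k) := by
  have h1 := sndBefore_revSeq x (k - 1)
  have h2 := fstBefore_revSeq x (k - 1)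
  rw [show -(k - 1) = -k + 1 by ring] at h1 h2
  simp only [westNext, westPrev, h1, h2, northNext_revSeq]
  simp only [revSeq, swap_eq_zero, swap_eq_one]
  rw [show (1 - k) = -k + 1 by ring]
  split_ifs <;> rfl

/-! ## The rotation system of the sewn map -/

/-- The rotation system in terms of letters. -/
noncomputable def sewRot (x : ℤ → Fin 3) : Dart ℤ → Dart ℤ
  | (k, true) => if x (k + 1) = 0 then (fstAfter x (k + 1), true)
      else if x (k + 1) = 1 then (k + 1, true) else (sndAfter x (k + 1) - 1, false)
  | (k, false) => if x k = 0 then (k - 1, false)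
      else if x k = 1 then (sndBefore x (k - 1), false) else (fstBefore x (k - 1) + 1, true)

/-- The inverse of the rotation system in terms of letters. -/
noncomputable def sewRotInv (x : ℤ → Fin 3) : Dart ℤ → Dart ℤ
  | (k, true) => if x k = 0 then (fstAfter x k, false)
      else if x k = 1 then (k - 1, true) else (fstBefore x (k - 1), true)
  | (k, false) => if x (k + 1) = 0 then (k + 1, false)
      else if x (k + 1) = 1 then (sndBefore x k, true) else (sndAfter x (k + 1), false)

namespace Recurrent

variable {x : ℤ → Fin 3} (hx : Recurrent x)
include hx

theorem sewRotInv_sewRot (d : Dart ℤ) : sewRotInv x (sewRot x d) = d := by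
  obtain ⟨k, b⟩ := d
  cases b
  · rcases letter_cases (x k) with h | h | h
    · simp [sewRot, sewRotInv, h]
    · have h1 := hx.letter_sndBefore (k - 1)
      have h2 := hx.sndAfter_sndBefore (k := k - 1) (by rwa [sub_add_cancel])
      simp [sewRot, sewRotInv, h, h1, h2]
    · have h1 := hx.letter_fstBefore (k - 1)
      have h2 := hx.fstAfter_fstBefore (k := k - 1) (by rwa [sub_add_cancel])
      simp [sewRot, sewRotInv, h, h1, h2]
  · rcases letter_cases (x (k + 1)) with h | h | h
    · have h1 := hx.letter_fstAfter (k + 1)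
      have h2 := hx.fstBefore_fstAfter h
      simp [sewRot, sewRotInv, h, h1, h2]
    · simp [sewRot, sewRotInv, h]
    · have h1 := hx.letter_sndAfter (k + 1)
      have h2 := hx.sndBefore_sndAfter h
      simp [sewRot, sewRotInv, h, h1, h2]

theorem sewRot_sewRotInv (d : Dart ℤ) : sewRot x (sewRotInv x d) = d := by
  obtain ⟨k, b⟩ := d
  cases b
  · rcases letter_cases (x (k + 1)) with h | h | h
    · simp [sewRot, sewRotInv, h]
    · have h1 := hx.letter_sndBefore k
      have h2 := hx.sndAfter_sndBefore h
      simp [sewRot, sewRotInv, h, h1, h2]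
    · have h1 := hx.letter_sndAfter (k + 1)
      have h2 := hx.sndBefore_sndAfter h
      simp [sewRot, sewRotInv, h, h1, h2]
  · rcases letter_cases (x k) with h | h | h
    · have h1 := hx.letter_fstAfter k
      have h2 := hx.fstBefore_fstAfter h
      simp [sewRot, sewRotInv, h, h1, h2]
    · simp [sewRot, sewRotInv, h]
    · have h1 := hx.letter_fstBefore (k - 1)
      have h2 := hx.fstAfter_fstBefore (k := k - 1) (by rwa [sub_add_cancel])
      simp [sewRot, sewRotInv, h, h1, h2]

/-- The rotation system as a permutation. -/
noncomputable def sewPerm : Equiv.Perm (Dart ℤ) :=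
  ⟨sewRot x, sewRotInv x, hx.sewRotInv_sewRot, hx.sewRot_sewRotInv⟩

omit hx in
theorem follows_of_steps {w : ℤ → ℤ × ℤ} (hw : ∀ n, w n - w (n - 1) = stepOf (x n)) :
    Follows x (fun n => (w n).1) (fun n => (w n).2) := by
  constructor <;> intro n <;> rw [← hw n] <;> simp

theorem frontierAbove_iff {w : ℤ → ℤ × ℤ} (hw : ∀ n, w n - w (n - 1) = stepOf (x n)) (k j : ℤ) :
    FrontierAbove w k j ↔ fstAfter x k = j := by
  have h := (follows_of_steps hw).fstAfter hx k
  have h' : FrontierAbove w k (fstAfter x k) := by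
    refine ⟨⟨h.1, h.2.1⟩, fun i hi => ?_⟩
    by_contra hlt
    have := h.2.2 i hi.1.le (by omega)
    have := hi.2
    simp only at *
    omega
  exact ⟨fun hj => h'.unique hj, fun hj => hj ▸ h'⟩

theorem frontierBelow_iff {w : ℤ → ℤ × ℤ} (hw : ∀ n, w n - w (n - 1) = stepOf (x n)) (k j : ℤ) :
    FrontierBelow w k j ↔ sndBefore x k = j := by
  have h := (follows_of_steps hw).sndBefore hx k
  have h' : FrontierBelow w k (sndBefore x k) := by
    refine ⟨⟨h.1, h.2.1⟩, fun i hi => ?_⟩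
    by_contra hlt
    have := h.2.2 i (by omega) hi.1.le
    have := hi.2
    simp only at *
    omega
  exact ⟨fun hj => h'.unique hj, fun hj => hj ▸ h'⟩

omit hx in
theorem step_eq_iff {w : ℤ → ℤ × ℤ} (hw : ∀ n, w n - w (n - 1) = stepOf (x n)) (k : ℤ) :
    (w (k + 1) - w k = (1, 0) ↔ x (k + 1) = 0) ∧ (w (k + 1) - w k = (0, -1) ↔ x (k + 1) = 1) := by
  have := hw (k + 1)
  rw [add_sub_cancel_right] at this
  rw [this]
  generalize x (k + 1) = a
  fin_cases a <;> simp [stepOf]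

/-- The letter next to a dart decides in which triangle its corner lies. The letters 0 and 1 sew a
triangle at that very step, which has the corner at its top or bottom. A letter 2 sews nothing; the
corner is then the middle one of the triangle sewn at the matching step, a letter 1 later on or a
letter 0 earlier. -/
theorem sewnCorner_iff {w : ℤ → ℤ × ℤ} (hw : ∀ n, w n - w (n - 1) = stepOf (x n))
    (d d' : Dart ℤ) : SewnCorner w d d' ↔ sewRot x d = d' := by
  constructor
  · intro h
    cases h with
    | right_top k j h1 h2 =>
      rw [(step_eq_iff hw k).1] at h1; rw [hx.frontierAbove_iff hw] at h2
      simp [sewRot, h1, h2]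
    | right_bottom k j h1 h2 =>
      rw [(step_eq_iff hw k).1] at h1
      simp [sewRot, h1]
    | right_middle k j h1 h2 =>
      rw [(step_eq_iff hw k).1] at h1; rw [hx.frontierAbove_iff hw] at h2
      subst h2
      simp [sewRot, hx.letter_fstAfter, hx.fstBefore_fstAfter h1]
    | left_top k j h1 h2 =>
      rw [(step_eq_iff hw k).2] at h1
      simp [sewRot, h1]
    | left_bottom k j h1 h2 =>
      rw [(step_eq_iff hw k).2] at h1; rw [hx.frontierBelow_iff hw] at h2
      simp [sewRot, h1, h2]
    | left_middle k j h1 h2 =>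
      rw [(step_eq_iff hw k).2] at h1; rw [hx.frontierBelow_iff hw] at h2
      subst h2
      simp [sewRot, hx.letter_sndBefore, hx.sndAfter_sndBefore h1]
  · rintro rfl
    obtain ⟨k, b⟩ := d
    cases b
    · obtain ⟨k, rfl⟩ : ∃ l, k = l + 1 := ⟨k - 1, by ring⟩
      rcases letter_cases (x (k + 1)) with h | h | h
      · have := SewnCorner.right_bottom k _ ((step_eq_iff hw k).1.2 h)
          ((hx.frontierAbove_iff hw _ _).2 rfl)
        simpa [sewRot, h] using this
      · have := SewnCorner.left_bottom k _ ((step_eq_iff hw k).2.2 h)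
          ((hx.frontierBelow_iff hw _ _).2 rfl)
        simpa [sewRot, h] using this
      · have := SewnCorner.right_middle (fstBefore x k) _
          ((step_eq_iff hw _).1.2 (hx.letter_fstBefore k))
          ((hx.frontierAbove_iff hw _ _).2 (hx.fstAfter_fstBefore h))
        simpa [sewRot, h] using this
    · rcases letter_cases (x (k + 1)) with h | h | h
      · have := SewnCorner.right_top k _ ((step_eq_iff hw k).1.2 h)
          ((hx.frontierAbove_iff hw _ _).2 rfl)
        simpa [sewRot, h] using this
      · have := SewnCorner.left_top k _ ((step_eq_iff hw k).2.2 h)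
          ((hx.frontierBelow_iff hw _ _).2 rfl)
        simpa [sewRot, h] using this
      · have h1 := hx.letter_sndAfter (k + 1)
        have h2 := hx.sndBefore_sndAfter h
        rw [add_sub_cancel_right] at h2
        have := SewnCorner.left_middle (sndAfter x (k + 1) - 1) k
          ((step_eq_iff hw _).2.2 (by rwa [sub_add_cancel]))
          ((hx.frontierBelow_iff hw _ _).2 h2)
        simpa [sewRot, h] using this

/-- The relation `SewnCorner` is the graph of `sewPerm`; hence the permutation chosen in `sewnMap`
exists and can be no other. -/
theorem sewnMap_rot {w : ℤ → ℤ × ℤ} (hw : ∀ n, w n - w (n - 1) = stepOf (x n)) :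
    (sewnMap w).rot = hx.sewPerm := by
  have h : ∃ σ : Equiv.Perm (Dart ℤ), ∀ d d', SewnCorner w d d' ↔ σ d = d' :=
    ⟨hx.sewPerm, fun d d' => hx.sewnCorner_iff hw d d'⟩
  rw [sewnMap, dif_pos h]
  ext1 d
  exact (h.choose_spec d _).1 ((hx.sewnCorner_iff hw d _).2 rfl)

end Recurrent

/-- `FirstHit σ b d e`: the first dart among `σ d, σ (σ d), ...` with second component `b`
belongs to the edge `e`. -/
inductive FirstHit {E : Type*} (σ : Equiv.Perm (Dart E)) (b : Bool) : Dart E → E → Prop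
  | base (d : Dart E) : (σ d).2 = b → FirstHit σ b d (σ d).1
  | step (d : Dart E) (e : E) : (σ d).2 ≠ b → FirstHit σ b (σ d) e → FirstHit σ b d e

theorem FirstHit.exists_pow {E : Type*} {σ : Equiv.Perm (Dart E)} {b : Bool} {d : Dart E} {e : E}
    (h : FirstHit σ b d e) : ∃ k : ℕ, 0 < k ∧ ((σ ^ k) d).2 = b ∧ ((σ ^ k) d).1 = e ∧
      ∀ j, 0 < j → j < k → ((σ ^ j) d).2 ≠ b := by
  induction h with
  | base d hd => exact ⟨1, one_pos, by simpa using hd, by simp, fun j h1 h2 => by omega⟩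
  | step d e hd _ ih =>
    obtain ⟨k, hk, h1, h2, h3⟩ := ih
    refine ⟨k + 1, by omega, ?_, ?_, fun j hj hj' => ?_⟩
    · rw [pow_succ]; exact h1
    · rw [pow_succ]; exact h2
    · obtain ⟨i, rfl⟩ : ∃ i, j = i + 1 := ⟨j - 1, by omega⟩
      rw [pow_succ]
      rcases Nat.eq_zero_or_pos i with rfl | hi
      · simpa using hd
      · exact h3 i hi (by omega)

theorem FirstHit.firstEdge_eq {E : Type*} {σ : Equiv.Perm (Dart E)} {b : Bool} {d : Dart E} {e : E}
    (h : FirstHit σ b d e) : firstEdge σ b d = e := by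
  obtain ⟨k, hk, h1, h2, h3⟩ := h.exists_pow
  have : sInf {k : ℕ | 0 < k ∧ ((σ ^ k) d).2 = b} = k := by
    refine IsLeast.csInf_eq ⟨⟨hk, h1⟩, fun j hj => ?_⟩
    by_contra hlt
    exact h3 j hj.1 (by omega) hj.2
  rw [firstEdge, this, h2]

theorem FirstHit.base' {E : Type*} {σ : Equiv.Perm (Dart E)} {b : Bool} {d : Dart E} {e : E}
    (h : σ d = (e, b)) : FirstHit σ b d e := by
  have := FirstHit.base (σ := σ) (b := b) d (by rw [h])
  rwa [h] at this

theorem FirstHit.step' {E : Type*} {σ : Equiv.Perm (Dart E)} {b : Bool} {d d' : Dart E} {e : E}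
    (h : σ d = d') (h' : d'.2 ≠ b) (h'' : FirstHit σ b d' e) : FirstHit σ b d e :=
  FirstHit.step d e (by rwa [h]) (by rwa [h])

/-- Needed for the double dual, which is the original map with all edges reversed: its rotation is
conjugate to the original one under `flipDart`, and outgoing edges become incoming. -/
theorem FirstHit.conj {E : Type*} {σ τ : Equiv.Perm (Dart E)} {b : Bool} {d : Dart E} {e : E}
    (hτ : ∀ d, τ (flipDart E d) = flipDart E (σ d)) (h : FirstHit σ b d e) :
    FirstHit τ (!b) (flipDart E d) e := by
  induction h with
  | base d hd =>
    refine FirstHit.base' ?_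
    rw [hτ, ← hd]
    rfl
  | step d e hd _ ih =>
    refine FirstHit.step' (hτ d) ?_ ih
    simp [flipDart, hd]

/-! ### Trees and Peano curves of the sewn map and of its dual in terms of letters -/

namespace Recurrent

variable {x : ℤ → Fin 3} (hx : Recurrent x)
include hx

theorem firstHit_north (e : ℤ) : FirstHit hx.sewPerm false (e, true) (northNext x e) := by
  -- Turning past an incoming edge leaves `fstAfter x e` unchanged and moves `e` closer to it, so
  -- this distance decreases.
  induction hn : (fstAfter x e - e).toNat using Nat.strong_induction_on generalizing e with
  | _ n ih =>
    rcases letter_cases (x (e + 1)) with h | h | h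
    · have h1 := hx.lt_fstAfter (e + 1)
      have h2 := hx.lt_fstAfter (fstAfter x (e + 1))
      have h3 := hx.fstAfter_zero h
      refine FirstHit.step' (d' := (fstAfter x (e + 1), true)) ?_ (by simp) ?_
      · simp [sewPerm, sewRot, h]
      · rw [hx.northNext_zero h]
        exact ih _ (by omega) _ rfl
    · have h1 := hx.lt_fstAfter (e + 1)
      have h3 := hx.fstAfter_one h
      refine FirstHit.step' (d' := (e + 1, true)) ?_ (by simp) ?_
      · simp [sewPerm, sewRot, h]
      · rw [hx.northNext_one h]
        exact ih _ (by omega) _ rfl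
    · refine FirstHit.base' ?_
      rw [hx.northNext_two h]
      simp [sewPerm, sewRot, h]

theorem firstHit_south (e : ℤ) : FirstHit hx.sewPerm true (e, false) (southNext x e) := by
  induction hn : (e - sndBefore x e).toNat using Nat.strong_induction_on generalizing e with
  | _ n ih =>
    rcases letter_cases (x e) with h | h | h
    · have h1 := hx.sndBefore_lt (e - 1)
      have h3 := hx.sndBefore_zero h
      refine FirstHit.step' (d' := (e - 1, false)) ?_ (by simp) ?_
      · simp [sewPerm, sewRot, h]
      · rw [hx.southNext_zero h]
        exact ih _ (by omega) _ rfl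
    · have h1 := hx.sndBefore_lt (e - 1)
      have h2 := hx.sndBefore_lt (sndBefore x (e - 1))
      have h3 := hx.sndBefore_one h
      refine FirstHit.step' (d' := (sndBefore x (e - 1), false)) ?_ (by simp) ?_
      · simp [sewPerm, sewRot, h]
      · rw [hx.southNext_one h]
        exact ih _ (by omega) _ rfl
    · refine FirstHit.base' ?_
      rw [hx.southNext_two h]
      simp [sewPerm, sewRot, h]

variable {M : OrientedMap ℤ} (hM : M.rot = hx.sewPerm)
include hM

theorem northParent_eq : M.northParent = northNext x := by
  funext e
  rw [OrientedMap.northParent, hM]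
  exact (hx.firstHit_north e).firstEdge_eq

theorem southParent_eq : M.southParent = southNext x := by
  funext e
  rw [OrientedMap.southParent, hM]
  exact (hx.firstHit_south e).firstEdge_eq

theorem rot_mk (d : Dart ℤ) : M.rot d = sewRot x d := by rw [hM]; rfl

theorem rot_symm_mk (d : Dart ℤ) : M.rot.symm d = sewRotInv x d := by rw [hM]; rfl

theorem dual_rot_symm (d : Dart ℤ) : M.dual.rot.symm d = sewRot x (flipDart ℤ d) := by
  have : M.dual.rot.symm d = M.rot ((flipDart ℤ).symm d) := rfl
  rw [this, hx.rot_mk hM]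
  rfl

theorem mirror_dual_rot (d : Dart ℤ) : M.mirror.dual.rot d = flipDart ℤ (sewRot x d) := by
  have : M.mirror.dual.rot d = flipDart ℤ (M.rot d) := rfl
  rw [this, hx.rot_mk hM]

theorem dual_dual_rot (d : Dart ℤ) :
    M.dual.dual.rot (flipDart ℤ d) = flipDart ℤ (hx.sewPerm d) := by
  have : M.dual.dual.rot (flipDart ℤ d) =
    flipDart ℤ (M.rot ((flipDart ℤ).symm (flipDart ℤ d))) := rfl
  rw [this, hM, Equiv.symm_apply_apply]

theorem dual_westParent_eq : M.dual.westParent = dualSouthNext x := by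
  funext e
  refine FirstHit.firstEdge_eq ?_
  have h1 := hx.letter_fstBefore (e - 1)
  rcases letter_cases (x e) with h | h | h
  · refine FirstHit.base' ?_
    rw [hx.dual_rot_symm hM]; simp [flipDart, sewRot, dualSouthNext, h]
  · refine FirstHit.base' ?_
    rw [hx.dual_rot_symm hM]; simp [flipDart, sewRot, dualSouthNext, h]
  -- Here `e` is the upper of the two right edges of the triangle on its left. The rotation meets
  -- the lower right edge first and then the left side.
  · refine FirstHit.step' (d' := (fstBefore x (e - 1) + 1, true)) ?_ (by simp) (FirstHit.base' ?_)
    · rw [hx.dual_rot_symm hM]; simp [flipDart, sewRot, h]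
    · rw [hx.dual_rot_symm hM]; simp [flipDart, sewRot, dualSouthNext, h, h1]

theorem dual_eastParent_eq : M.dual.eastParent = dualNorthNext x := by
  funext e
  refine FirstHit.firstEdge_eq ?_
  have h1 := hx.letter_sndAfter (e + 1)
  rcases letter_cases (x (e + 1)) with h | h | h
  · refine FirstHit.base' ?_
    rw [hx.dual_rot_symm hM]; simp [flipDart, sewRot, dualNorthNext, h]
  · refine FirstHit.base' ?_
    rw [hx.dual_rot_symm hM]; simp [flipDart, sewRot, dualNorthNext, h]
  · refine FirstHit.step' (d' := (sndAfter x (e + 1) - 1, false)) ?_ (by simp) (FirstHit.base' ?_)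
    · rw [hx.dual_rot_symm hM]; simp [flipDart, sewRot, h]
    · rw [hx.dual_rot_symm hM]; simp [flipDart, sewRot, dualNorthNext, h, h1]

theorem dual_peanoNext_eq : M.dual.peanoNext = westNext x := by
  funext e
  have h0 : M.dual.rot (e, true) = flipDart ℤ (sewRotInv x (e, true)) := by
    rw [← hx.rot_symm_mk hM]; rfl
  rw [OrientedMap.peanoNext, h0, hx.dual_westParent_eq hM]
  rcases letter_cases (x e) with h | h | h
  -- Crossing a face of the dual map means turning around a primal vertex. The double dual only
  -- reverses the edges, so the edge found is the north-going successor.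
  · have := ((hx.firstHit_north e).conj (hx.dual_dual_rot hM)).firstEdge_eq
    rw [westNext_zero h, ← this]
    simp [sewRotInv, flipDart, h]
  · simp [sewRotInv, flipDart, h, dualSouthNext, westNext]
  · simp [sewRotInv, flipDart, h, dualSouthNext, westNext]

theorem dual_peanoPrev_eq : M.dual.peanoPrev = westPrev x := by
  funext e
  have h0 : M.dual.rot (e, false) = flipDart ℤ (sewRotInv x (e, false)) := by
    rw [← hx.rot_symm_mk hM]; rfl
  rw [OrientedMap.peanoPrev, h0, hx.dual_eastParent_eq hM]
  rcases letter_cases (x (e + 1)) with h | h | h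
  · simp [sewRotInv, flipDart, h, dualNorthNext, westPrev]
  · have := ((hx.firstHit_south e).conj (hx.dual_dual_rot hM)).firstEdge_eq
    rw [westPrev_one h, ← this]
    simp [sewRotInv, flipDart, h]
  · simp [sewRotInv, flipDart, h, dualNorthNext, westPrev]

theorem mirror_peanoNext_eq : M.mirror.peanoNext = westNext x := by
  funext e
  have h0 : M.mirror.rot (e, true) = sewRotInv x (e, true) := by rw [← hx.rot_symm_mk hM]; rfl
  have h1 : M.mirror.westParent e = northNext x e := by
    rw [← hx.northParent_eq hM]; rfl
  rw [OrientedMap.peanoNext, h0, h1]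
  rcases letter_cases (x e) with h | h | h
  · simp [sewRotInv, h, westNext]
  · have : FirstHit M.mirror.dual.rot true (e, false) (westNext x e) := by
      refine FirstHit.base' ?_
      rw [hx.mirror_dual_rot hM]; simp [flipDart, sewRot, h, westNext]
    rw [this.firstEdge_eq]
    simp [sewRotInv, h]
  · have : FirstHit M.mirror.dual.rot true (e, false) (westNext x e) := by
      refine FirstHit.step' (d' := (fstBefore x (e - 1) + 1, false)) ?_ (by simp)
        (FirstHit.base' ?_)
      · rw [hx.mirror_dual_rot hM]; simp [flipDart, sewRot, h]
      · rw [hx.mirror_dual_rot hM]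
        simp [flipDart, sewRot, h, westNext, hx.letter_fstBefore]
    rw [this.firstEdge_eq]
    simp [sewRotInv, h]

theorem mirror_peanoPrev_eq : M.mirror.peanoPrev = westPrev x := by
  funext e
  have h0 : M.mirror.rot (e, false) = sewRotInv x (e, false) := by rw [← hx.rot_symm_mk hM]; rfl
  have h1 : M.mirror.eastParent e = southNext x e := by
    rw [← hx.southParent_eq hM]; rfl
  rw [OrientedMap.peanoPrev, h0, h1]
  rcases letter_cases (x (e + 1)) with h | h | h
  · have : FirstHit M.mirror.dual.rot false (e, true) (westPrev x e) := by
      refine FirstHit.base' ?_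
      rw [hx.mirror_dual_rot hM]; simp [flipDart, sewRot, h, westPrev]
    rw [this.firstEdge_eq]
    simp [sewRotInv, h]
  · simp [sewRotInv, h, westPrev]
  · have : FirstHit M.mirror.dual.rot false (e, true) (westPrev x e) := by
      refine FirstHit.step' (d' := (sndAfter x (e + 1) - 1, true)) ?_ (by simp)
        (FirstHit.base' ?_)
      · rw [hx.mirror_dual_rot hM]; simp [flipDart, sewRot, h]
      · rw [hx.mirror_dual_rot hM]
        simp [flipDart, sewRot, h, westPrev, hx.letter_sndAfter]
    rw [this.firstEdge_eq]
    simp [sewRotInv, h]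

end Recurrent

/-! ## Heights in trees of edges -/

/-- The branches of `a` and `b` merge, and `a` is by `h` higher than `b`. -/
def MergesWith {E : Type*} (p : E → E) (a b : E) (h : ℤ) : Prop :=
  ∃ i j : ℕ, p^[i] a = p^[j] b ∧ (i : ℤ) - j = h

theorem MergesWith.refl {E : Type*} (p : E → E) (a : E) : MergesWith p a a 0 := ⟨0, 0, rfl, by simp⟩

theorem MergesWith.symm {E : Type*} {p : E → E} {a b : E} {h : ℤ} (H : MergesWith p a b h) :
    MergesWith p b a (-h) := by
  obtain ⟨i, j, h1, h2⟩ := H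
  exact ⟨j, i, h1.symm, by omega⟩

theorem MergesWith.trans {E : Type*} {p : E → E} {a b c : E} {h h' : ℤ} (H : MergesWith p a b h)
    (H' : MergesWith p b c h') : MergesWith p a c (h + h') := by
  obtain ⟨i, j, h1, h2⟩ := H
  obtain ⟨k, l, h3, h4⟩ := H'
  refine ⟨k + i, j + l, ?_, by push_cast; omega⟩
  rw [Function.iterate_add_apply, h1, Function.iterate_add_apply, ← h3,
    ← Function.iterate_add_apply, ← Function.iterate_add_apply, add_comm]

theorem iterate_injective_of_lt {p : ℤ → ℤ} (hp : ∀ e, p e < e) (e : ℤ) :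
    Function.Injective fun i : ℕ => p^[i] e := by
  refine (strictAnti_nat_of_succ_lt fun n => ?_).injective
  rw [Function.iterate_succ_apply']
  exact hp _

theorem iterate_injective_of_gt {p : ℤ → ℤ} (hp : ∀ e, e < p e) (e : ℤ) :
    Function.Injective fun i : ℕ => p^[i] e := by
  refine (strictMono_nat_of_lt_succ fun n => ?_).injective
  rw [Function.iterate_succ_apply']
  exact hp _

/-- On injective orbits any common point of the two branches can be used instead of the first one:
beyond the first meeting point both branches have the same number of surplus steps. -/
theorem MergesWith.relHeight_eq {E : Type*} {p : E → E}
    (hp : ∀ e, Function.Injective fun i : ℕ => p^[i] e) {a b : E} {h : ℤ}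
    (H : MergesWith p a b h) : relHeight p a b = h := by
  obtain ⟨i, j, h1, h2⟩ := H
  have e1 : {k : ℕ | ∃ j : ℕ, p^[k] a = p^[j] b}.Nonempty := ⟨i, j, h1⟩
  have e2 : {k : ℕ | ∃ j : ℕ, p^[k] b = p^[j] a}.Nonempty := ⟨j, i, h1.symm⟩
  have l1 : sInf {k : ℕ | ∃ j : ℕ, p^[k] a = p^[j] b} ≤ i := Nat.sInf_le ⟨j, h1⟩
  have l2 : sInf {k : ℕ | ∃ j : ℕ, p^[k] b = p^[j] a} ≤ j := Nat.sInf_le ⟨i, h1.symm⟩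
  have m1 := Nat.sInf_mem e1
  have m2 := Nat.sInf_mem e2
  rw [relHeight]
  set k0 := sInf {k : ℕ | ∃ j : ℕ, p^[k] a = p^[j] b} with hk0
  set j0 := sInf {k : ℕ | ∃ j : ℕ, p^[k] b = p^[j] a} with hj0
  obtain ⟨j1, hj1⟩ := m1
  obtain ⟨i1, hi1⟩ := m2
  have l3 : k0 ≤ i1 := Nat.sInf_le ⟨j0, hi1.symm⟩
  have l4 : j0 ≤ j1 := Nat.sInf_le ⟨k0, hj1.symm⟩
  have q1 : (i - k0) + j1 = j := by
    refine hp b ?_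
    change p^[(i - k0) + j1] b = p^[j] b
    rw [Function.iterate_add_apply, ← hj1, ← Function.iterate_add_apply, Nat.sub_add_cancel l1, h1]
  have q2 : (j - j0) + i1 = i := by
    refine hp a ?_
    change p^[(j - j0) + i1] a = p^[i] a
    rw [Function.iterate_add_apply, ← hi1, ← Function.iterate_add_apply, Nat.sub_add_cancel l2, h1]
  omega

theorem relHeight_conj {E F : Type*} (φ : E ≃ F) {p : E → E} {q : F → F}
    (h : ∀ e, q (φ e) = φ (p e)) (a b : E) : relHeight q (φ a) (φ b) = relHeight p a b := by
  have h1 : ∀ (k : ℕ) (e : E), q^[k] (φ e) = φ (p^[k] e) := by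
    intro k
    induction k with
    | zero => intro e; rfl
    | succ k ih => intro e; rw [Function.iterate_succ_apply, h, ih, ← Function.iterate_succ_apply]
  simp only [relHeight, h1, φ.injective.eq_iff]

/-! ## The west-going Peano curve and its walk -/

/-- The west-going Peano curve, in terms of letters. -/
noncomputable def westPath (x : ℤ → Fin 3) : ℤ → ℤ
  | Int.ofNat n => (westNext x)^[n] 0
  | Int.negSucc n => (westPrev x)^[n + 1] 0

theorem westPath_zero (x : ℤ → Fin 3) : westPath x 0 = 0 := rfl

/-- The steps of the walk of the west-going Peano curve. -/
def westStep : Fin 3 → ℤ × ℤ := ![(1, -1), (0, 1), (-1, 0)]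

/-- The letters read along the west-going Peano curve. -/
noncomputable def westLetter (x : ℤ → Fin 3) (n : ℤ) : Fin 3 := x (westPath x (n - 1))

/-- Height in the south-going tree along the west-going Peano curve. -/
noncomputable def southHeight (x : ℤ → Fin 3) (n : ℤ) : ℤ :=
  relHeight (southNext x) (westPath x n) 0

/-- Height in the dual south-going tree along the west-going Peano curve. -/
noncomputable def dualSouthHeight (x : ℤ → Fin 3) (n : ℤ) : ℤ :=
  relHeight (dualSouthNext x) (westPath x n) 0

/-- The lattice walk with the steps `westStep` of the letters `y`. -/
noncomputable def westWalk (y : ℤ → Fin 3) : ℤ → ℤ × ℤ := intSum fun n => westStep (y n)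

namespace Recurrent

variable {x : ℤ → Fin 3} (hx : Recurrent x)
include hx

theorem westPath_succ (n : ℤ) : westPath x (n + 1) = westNext x (westPath x n) := by
  rcases n with n | n
  · exact Function.iterate_succ_apply' _ n 0
  · rcases n with _ | n
    · exact (hx.westNext_westPrev 0).symm
    · have h1 : westPath x (Int.negSucc (n + 1)) = westPrev x (westPath x (Int.negSucc n)) :=
        Function.iterate_succ_apply' _ (n + 1) 0
      rw [h1, hx.westNext_westPrev]
      rfl

theorem westPath_pred (n : ℤ) : westPath x (n - 1) = westPrev x (westPath x n) := by
  have := hx.westPath_succ (n - 1)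
  rw [sub_add_cancel] at this
  rw [this, hx.westPrev_westNext]

/-- The forward recursion determines the whole curve, also at negative times, because `westNext` is
injective. -/
theorem eq_westPath {f : ℤ → ℤ} (h0 : f 0 = 0) (hf : ∀ n, f (n + 1) = westNext x (f n)) :
    f = westPath x := by
  funext n
  induction n using Int.induction_on with
  | zero => rw [h0, westPath_zero]
  | succ n ih => rw [hf, ih, hx.westPath_succ]
  | pred n ih =>
    have := hf (-n - 1)
    rw [sub_add_cancel, ih] at this
    rw [hx.westPath_pred, this, hx.westPrev_westNext]

theorem westPath_revSeq (n : ℤ) : westPath (revSeq x) n = -westPath x (-n) := by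
  have := hx.rev.eq_westPath (f := fun n => -westPath x (-n)) (by simp [westPath_zero])
    (fun n => by
      rw [westNext_revSeq, neg_neg, ← hx.westPath_pred, neg_add, ← sub_eq_add_neg])
  exact (congrFun this n).symm

theorem dualSouthNext_lt (e : ℤ) : dualSouthNext x e < e := by
  have h1 := hx.sndBefore_lt (e - 1)
  have h2 := hx.fstBefore_lt (e - 1)
  rw [dualSouthNext]
  split_ifs <;> omega

theorem southNext_mergesWith (e : ℤ) :
    MergesWith (southNext x) (westNext x e) e (westStep (x e)).1 := by
  rcases letter_cases (x e) with h | h | h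
  · exact ⟨1, 0, hx.southNext_westNext_zero h, by simp [h, westStep]⟩
  · exact ⟨1, 1, hx.southNext_westNext_one h, by simp [h, westStep]⟩
  · exact ⟨1, 2, hx.southNext_westNext_two h, by simp [h, westStep]⟩

theorem northNext_mergesWith (e : ℤ) :
    MergesWith (northNext x) (westNext x e) e (westStep (x e)).2 := by
  rcases letter_cases (x e) with h | h | h
  · exact ⟨0, 1, westNext_zero h, by simp [h, westStep]⟩
  · exact ⟨2, 1, hx.northNext_westNext_one h, by simp [h, westStep]⟩
  · exact ⟨1, 1, hx.northNext_westNext_two h, by simp [h, westStep]⟩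

omit hx in
theorem mergesWith_of_step {p f : ℤ → ℤ} {g : ℤ → ℤ}
    (h : ∀ n, MergesWith p (f (n + 1)) (f n) (g (n + 1) - g n)) (n : ℤ) :
    MergesWith p (f n) (f 0) (g n - g 0) := by
  induction n using Int.induction_on with
  | zero => rw [sub_self]; exact MergesWith.refl _ _
  | succ n ih => have := (h n).trans ih; rwa [sub_add_sub_cancel] at this
  | pred n ih =>
    have := h (-n - 1)
    rw [sub_add_cancel] at this
    have := this.symm.trans ih
    rwa [neg_sub, sub_add_sub_cancel] at this

omit hx in
theorem westWalk_succ (n : ℤ) : westWalk (westLetter x) (n + 1) =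
    westWalk (westLetter x) n + westStep (x (westPath x n)) := by
  rw [westWalk, intSum_step _ (n + 1), add_sub_cancel_right, westLetter, add_sub_cancel_right]

theorem south_mergesWith (n : ℤ) :
    MergesWith (southNext x) (westPath x n) 0 (westWalk (westLetter x) n).1 := by
  have := mergesWith_of_step (p := southNext x) (f := westPath x)
    (g := fun n => (westWalk (westLetter x) n).1) (fun n => by
      rw [hx.westPath_succ, westWalk_succ, Prod.fst_add, add_sub_cancel_left]
      exact hx.southNext_mergesWith _) n
  simpa [westWalk, intSum_zero, westPath_zero] using this

theorem north_mergesWith (n : ℤ) :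
    MergesWith (northNext x) (westPath x n) 0 (westWalk (westLetter x) n).2 := by
  have := mergesWith_of_step (p := northNext x) (f := westPath x)
    (g := fun n => (westWalk (westLetter x) n).2) (fun n => by
      rw [hx.westPath_succ, westWalk_succ, Prod.snd_add, add_sub_cancel_left]
      exact hx.northNext_mergesWith _) n
  simpa [westWalk, intSum_zero, westPath_zero] using this

theorem southHeight_eq (n : ℤ) : southHeight x n = (westWalk (westLetter x) n).1 :=
  (hx.south_mergesWith n).relHeight_eq (iterate_injective_of_lt hx.southNext_lt)

theorem relHeight_north_eq (n : ℤ) :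
    relHeight (northNext x) (westPath x n) 0 = (westWalk (westLetter x) n).2 :=
  (hx.north_mergesWith n).relHeight_eq (iterate_injective_of_gt hx.lt_northNext)

theorem southHeight_revSeq (n : ℤ) :
    southHeight (revSeq x) (-n) = relHeight (northNext x) (westPath x n) 0 := by
  have := relHeight_conj (Equiv.neg ℤ) (p := northNext x) (q := southNext (revSeq x))
    (fun e => by simp [southNext_revSeq]) (westPath x n) 0
  rw [southHeight, hx.westPath_revSeq, neg_neg]
  simpa using this

theorem dualSouthHeight_revSeq (n : ℤ) :
    dualSouthHeight (revSeq x) (-n) = relHeight (dualNorthNext x) (westPath x n) 0 := by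
  have := relHeight_conj (Equiv.neg ℤ) (p := dualNorthNext x) (q := dualSouthNext (revSeq x))
    (fun e => by simp [dualSouthNext_revSeq]) (westPath x n) 0
  rw [dualSouthHeight, hx.westPath_revSeq, neg_neg]
  simpa using this

theorem primalWestWalk_eq {w : ℤ → ℤ × ℤ} (hw : ∀ n, w n - w (n - 1) = stepOf (x n)) :
    (sewnMap w).primalWestWalk 0 = westWalk (westLetter x) := by
  have hM := hx.sewnMap_rot hw
  have h1 : (sewnMap w).primalWestPeano 0 = westPath x := by
    refine hx.eq_westPath rfl fun n => ?_
    rw [OrientedMap.primalWestPeano]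
    have h2 := hx.mirror_peanoNext_eq hM
    have h3 := hx.mirror_peanoPrev_eq hM
    have h4 : (sewnMap w).mirror.peano 0 = westPath x := by
      funext m
      rcases m with m | m
      · rw [OrientedMap.peano, h2]; rfl
      · rw [OrientedMap.peano, h3]; rfl
    rw [h4, hx.westPath_succ]
  funext n
  rw [OrientedMap.primalWestWalk, h1, hx.southParent_eq hM, hx.northParent_eq hM,
    hx.relHeight_north_eq, ← southHeight, hx.southHeight_eq]

theorem dualWalk_eq {w : ℤ → ℤ × ℤ} (hw : ∀ n, w n - w (n - 1) = stepOf (x n)) (n : ℤ) :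
    (sewnMap w).dualWalk 0 n = (dualSouthHeight x n, dualSouthHeight (revSeq x) (-n)) := by
  have hM := hx.sewnMap_rot hw
  have h4 : (sewnMap w).dual.peano 0 = westPath x := by
    funext m
    rcases m with m | m
    · rw [OrientedMap.peano, hx.dual_peanoNext_eq hM]; rfl
    · rw [OrientedMap.peano, hx.dual_peanoPrev_eq hM]; rfl
  rw [OrientedMap.dualWalk, OrientedMap.encodingWalk, h4, hx.dual_westParent_eq hM,
    hx.dual_eastParent_eq hM, hx.dualSouthHeight_revSeq]
  rfl

end Recurrent

/-! ## Comparison of dual and primal heights -/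

/-- The number of letters `2` among the first `i` letters on the dual south-going branch of `e`. -/
noncomputable def upCount (x : ℤ → Fin 3) (e : ℤ) (i : ℕ) : ℕ :=
  ((Finset.range i).filter fun t => x ((dualSouthNext x)^[t] e) = 2).card

theorem upCount_succ (x : ℤ → Fin 3) (e : ℤ) (i : ℕ) : upCount x e (i + 1) =
    upCount x e i + if x ((dualSouthNext x)^[i] e) = 2 then 1 else 0 := by
  rw [upCount, upCount, Finset.range_add_one, Finset.filter_insert]
  split_ifs with h
  · rw [Finset.card_insert_of_notMem (by simp)]
  · simp

namespace Recurrent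

variable {x : ℤ → Fin 3} (hx : Recurrent x)
include hx

/-- A letter 0 or 1 on the dual branch leaves the south-going successor unchanged, and a letter 2
replaces it by its own successor. So the letters 2 measure the progress of the primal branch. -/
theorem southNext_dual_iterate (e : ℤ) (i : ℕ) :
    southNext x ((dualSouthNext x)^[i] e) = (southNext x)^[upCount x e i] (southNext x e) := by
  induction i with
  | zero => simp [upCount]
  | succ i ih =>
    rw [Function.iterate_succ_apply', upCount_succ]
    set d := (dualSouthNext x)^[i] e with hd
    rcases letter_cases (x d) with h | h | h
    · rw [dualSouthNext, if_pos h, ← hx.southNext_zero h, ih]; simp [h]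
    · rw [dualSouthNext, if_neg (by simp [h]), if_pos h, ← hx.southNext_one h, ih]; simp [h]
    · rw [dualSouthNext, if_neg (by simp [h]), if_neg (by simp [h]), if_pos h,
        Function.iterate_succ_apply', ← ih, ← hx.southNext_westNext_two h, westNext_two h]

/-- When the dual branch has read `a` letters `2`, the last of them just now, it is next to the
primal branch. -/
theorem dual_iterate_eq {e : ℤ} {i a : ℕ} (h1 : upCount x e i = a)
    (h2 : x ((dualSouthNext x)^[i] e) = 2) :
    (dualSouthNext x)^[i + 1] e = (southNext x)^[a + 1] e - 1 := by
  have h3 := hx.southNext_dual_iterate e i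
  rw [h1, ← Function.iterate_succ_apply (southNext x) a e, hx.southNext_two h2] at h3
  rw [← h3, Function.iterate_succ_apply', dualSouthNext, if_neg (by simp [h2]),
    if_neg (by simp [h2])]
  ring

omit hx in
theorem exists_upCount (x : ℤ → Fin 3) (e : ℤ) (a K : ℕ) (h : a < upCount x e K) :
    ∃ i < K, upCount x e i = a ∧ x ((dualSouthNext x)^[i] e) = 2 := by
  induction K with
  | zero => simp [upCount] at h
  | succ K ih =>
    by_cases h' : a < upCount x e K
    · obtain ⟨i, hi, h1⟩ := ih h'
      exact ⟨i, by omega, h1⟩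
    · rw [upCount_succ] at h
      split_ifs at h with h2
      · exact ⟨K, by omega, by omega, h2⟩
      · omega

/-- Where the primal branches have met, the dual branches meet as well, right after their `(a +
1)`-st and `(b + 1)`-st letters 2 (`dual_iterate_eq`). These letters are read at times `i` and `j`
within `δ` of `3 a` and `3 b`; the bounds on `K` ensure that they occur among the controlled
letters. -/
theorem abs_relHeight_sub_le {e e' : ℤ} {a b K : ℕ} {δ : ℤ}
    (hab : (southNext x)^[a + 1] e = (southNext x)^[b + 1] e')
    (he : ∀ i ≤ K, |(i : ℤ) - 3 * upCount x e i| ≤ δ)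
    (he' : ∀ i ≤ K, |(i : ℤ) - 3 * upCount x e' i| ≤ δ)
    (ha : 3 * (a : ℤ) + δ < K) (hb : 3 * (b : ℤ) + δ < K) :
    |relHeight (dualSouthNext x) e e' - 3 * relHeight (southNext x) e e'| ≤ 2 * δ := by
  have key : ∀ {e a}, (∀ i ≤ K, |(i : ℤ) - 3 * upCount x e i| ≤ δ) → 3 * ((a : ℕ) : ℤ) + δ < K →
      ∃ i < K, upCount x e i = a ∧ x ((dualSouthNext x)^[i] e) = 2 := by
    intro e a he ha
    refine exists_upCount x e a K ?_
    have := he K le_rfl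
    rw [abs_le] at this
    omega
  obtain ⟨i, hi, hi1, hi2⟩ := key he ha
  obtain ⟨j, hj, hj1, hj2⟩ := key he' hb
  have h1 : MergesWith (southNext x) e e' ((a : ℤ) - b) := ⟨a + 1, b + 1, hab, by push_cast; ring⟩
  have h2 : MergesWith (dualSouthNext x) e e' ((i : ℤ) - j) :=
    ⟨i + 1, j + 1, by rw [hx.dual_iterate_eq hi1 hi2, hx.dual_iterate_eq hj1 hj2, hab],
      by push_cast; ring⟩
  rw [h1.relHeight_eq (iterate_injective_of_lt hx.southNext_lt),
    h2.relHeight_eq (iterate_injective_of_lt hx.dualSouthNext_lt)]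
  have h3 := he i hi.le
  have h4 := he' j hj.le
  rw [hi1] at h3
  rw [hj1] at h4
  rw [abs_le] at *
  constructor <;> omega

/-- One step of the curve does not change the ancestor at height `-l`, provided that the curve stays
strictly above it: the local relations compare branches only after at least one step down. -/
theorem south_iterate_succ {n : ℤ} {l : ℕ} (h1 : 0 < southHeight x n + l)
    (h2 : 0 < southHeight x (n + 1) + l) :
    (southNext x)^[(southHeight x (n + 1) + l).toNat] (westPath x (n + 1)) =
      (southNext x)^[(southHeight x n + l).toNat] (westPath x n) := by
  have h3 : southHeight x (n + 1) = southHeight x n + (westStep (x (westPath x n))).1 := by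
    rw [hx.southHeight_eq, hx.southHeight_eq, westWalk_succ]; rfl
  rw [h3] at h2 ⊢
  obtain ⟨m, hm⟩ : ∃ m : ℕ, southHeight x n + l = m + 1 :=
    ⟨(southHeight x n + l - 1).toNat, by omega⟩
  rw [hx.westPath_succ]
  set e := westPath x n
  rcases letter_cases (x e) with h | h | h
  · rw [h, show (southHeight x n + (westStep 0).1 + l).toNat = m + 1 + 1 by simp [westStep]; omega,
      show (southHeight x n + l).toNat = m + 1 by omega,
      Function.iterate_succ_apply, hx.southNext_westNext_zero h]
  · rw [h, show (southHeight x n + (westStep 1).1 + l).toNat = m + 1 by simp [westStep]; omega,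
      show (southHeight x n + l).toNat = m + 1 by omega,
      Function.iterate_succ_apply, hx.southNext_westNext_one h, ← Function.iterate_succ_apply]
  · rw [h] at h2
    obtain ⟨k, rfl⟩ : ∃ k, m = k + 1 := ⟨m - 1, by simp [westStep] at h2; omega⟩
    rw [h, show (southHeight x n + (westStep 2).1 + l).toNat = k + 1 by simp [westStep]; omega,
      show (southHeight x n + l).toNat = k + 1 + 1 by omega,
      Function.iterate_succ_apply, hx.southNext_westNext_two h, ← Function.iterate_succ_apply,
      ← Function.iterate_succ_apply]

theorem south_iterate_eq {A : ℕ} {l : ℕ} (h : ∀ n : ℤ, |n| ≤ A → 0 < southHeight x n + l) (n : ℤ)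
    (hn : |n| ≤ A) :
    (southNext x)^[(southHeight x n + l).toNat] (westPath x n) = (southNext x)^[l] 0 := by
  have h0 : southHeight x 0 = 0 := by
    rw [hx.southHeight_eq, westWalk, intSum_zero]; rfl
  induction n using Int.induction_on with
  | zero => rw [h0, westPath_zero]; simp
  | succ n ih =>
    have h1 : |(n : ℤ)| ≤ A := by rw [abs_le] at *; omega
    rw [hx.south_iterate_succ (h _ h1) (h _ hn), ih h1]
  | pred n ih =>
    have h1 : |(-n : ℤ)| ≤ A := by rw [abs_le] at *; omega
    have h2 := h _ h1
    have h3 := hx.south_iterate_succ (n := -n - 1) (l := l) (h _ hn) (by rwa [sub_add_cancel])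
    rw [sub_add_cancel, ih h1] at h3
    exact h3.symm

/-- All edges visited up to time `A` are descendants of the ancestor of the root `l` steps down.
Their branches reach it in fewer than `2 l` steps, so `6 l + δ` dual letters are enough for
`abs_relHeight_sub_le`. -/
theorem abs_dualSouthHeight_sub_le {A l K : ℕ} {δ : ℤ}
    (h1 : ∀ n : ℤ, |n| ≤ A → |southHeight x n| < l)
    (h2 : ∀ n : ℤ, |n| ≤ A → ∀ i ≤ K, |(i : ℤ) - 3 * upCount x (westPath x n) i| ≤ δ)
    (hK : 6 * (l : ℤ) + δ < K) (n : ℤ) (hn : |n| ≤ A) :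
    |dualSouthHeight x n - 3 * southHeight x n| ≤ 2 * δ := by
  have h3 : ∀ n : ℤ, |n| ≤ A → 0 < southHeight x n + l := fun n hn => by
    have := h1 n hn; rw [abs_lt] at this; omega
  have h4 := hx.south_iterate_eq h3 n hn
  have h5 := h1 n hn
  have h6 := h1 0 (by simp)
  have h7 := abs_nonneg (southHeight x 0)
  rw [abs_lt] at h5
  obtain ⟨a, ha⟩ : ∃ a : ℕ, (southHeight x n + l).toNat = a + 1 :=
    ⟨(southHeight x n + l).toNat - 1, by omega⟩
  obtain ⟨b, rfl⟩ : ∃ b : ℕ, l = b + 1 := ⟨l - 1, by omega⟩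
  rw [ha] at h4
  have h8 := h2 0 (by simp)
  rw [westPath_zero] at h8
  exact hx.abs_relHeight_sub_le h4 (h2 n hn) h8 (by omega) (by omega)

end Recurrent

/-! ## Independent uniform letters -/

/-- The law of a family of independent uniform letters. -/
noncomputable def letterLaw (ι : Type*) : Measure (ι → Fin 3) :=
  Measure.infinitePi fun _ => uniformOn Set.univ

instance (ι : Type*) : IsProbabilityMeasure (letterLaw ι) := by
  unfold letterLaw
  have : IsProbabilityMeasure (uniformOn (Set.univ : Set (Fin 3))) :=
    isProbabilityMeasure_uniformOn Set.finite_univ Set.univ_nonempty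
  infer_instance

instance : IsProbabilityMeasure (uniformOn (Set.univ : Set (Fin 3))) :=
  isProbabilityMeasure_uniformOn Set.finite_univ Set.univ_nonempty

theorem uniformOn_univ_singleton (a : Fin 3) :
    uniformOn (Set.univ : Set (Fin 3)) {a} = 3⁻¹ := by
  rw [uniformOn_univ]; simp

theorem letterLaw_cylinder {ι : Type*} (s : Finset ι) (a : ι → Fin 3) :
    letterLaw ι {x | ∀ i ∈ s, x i = a i} = 3⁻¹ ^ s.card := by
  have : {x : ι → Fin 3 | ∀ i ∈ s, x i = a i} = Set.pi s fun i => {a i} := by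
    ext x; simp [Set.mem_pi]
  rw [this, letterLaw, Measure.infinitePi_pi _ fun i _ => measurableSet_singleton _]
  simp [uniformOn_univ_singleton]

/-- A family of letters with uniform cylinder probabilities on large finite sets is independent
and uniform. -/
theorem map_eq_letterLaw {Ω ι : Type*} [MeasurableSpace Ω] {P : Measure Ω} [IsProbabilityMeasure P]
    {Y : Ω → ι → Fin 3} (hY : Measurable Y)
    (h : ∀ I : Finset ι, ∃ J : Finset ι, I ⊆ J ∧
      ∀ a : ι → Fin 3, P {ω | ∀ i ∈ J, Y ω i = a i} = 3⁻¹ ^ J.card) :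
    P.map Y = letterLaw ι := by
  classical
  refine (Measure.isProjectiveLimit_infinitePi (fun _ : ι => uniformOn (Set.univ : Set (Fin 3)))
    ).unique (ν := P.map Y) ?_ |>.symm
  intro I
  obtain ⟨J, hIJ, hJ⟩ := h I
  have key : (P.map Y).map J.restrict = (letterLaw ι).map J.restrict := by
    refine Measure.ext_of_singleton fun b => ?_
    have hr : Measurable (J.restrict : (ι → Fin 3) → (J → Fin 3)) := Finset.measurable_restrict J
    obtain ⟨a, ha⟩ : ∃ a : ι → Fin 3, J.restrict a = b :=
      ⟨fun i => if hi : i ∈ J then b ⟨i, hi⟩ else 0, by funext i; simp⟩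
    have hs : (J.restrict : (ι → Fin 3) → (J → Fin 3)) ⁻¹' {b} = {x | ∀ i ∈ J, x i = a i} := by
      ext x
      rw [← ha]
      simp [funext_iff]
    rw [Measure.map_apply hr (measurableSet_singleton _),
      Measure.map_apply hr (measurableSet_singleton _), hs, letterLaw_cylinder, ← hJ a,
      Measure.map_apply hY]
    · rfl
    · rw [← hs]; exact hr (measurableSet_singleton _)
  have hcomp : (I.restrict : (ι → Fin 3) → (I → Fin 3)) =
      Finset.restrict₂ hIJ ∘ J.restrict := rfl
  have h2 : Measurable (Finset.restrict₂ (π := fun _ : ι => Fin 3) hIJ) :=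
    Finset.measurable_restrict₂ hIJ
  rw [hcomp, ← Measure.map_map h2 (Finset.measurable_restrict J), key,
    Measure.map_map h2 (Finset.measurable_restrict J), ← hcomp, letterLaw,
    Measure.infinitePi_map_restrict]

/-! ### Words -/

/-- The sequence `y` starts with the word `u`. -/
def StartsWith : List (Fin 3) → (ℕ → Fin 3) → Prop
  | [], _ => True
  | a :: u, y => y 0 = a ∧ StartsWith u fun i => y (i + 1)

theorem startsWith_iff (u : List (Fin 3)) (y : ℕ → Fin 3) :
    StartsWith u y ↔ ∀ i < u.length, y i = u.getD i 0 := by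
  induction u generalizing y with
  | nil => simp [StartsWith]
  | cons a u ih =>
    rw [StartsWith, ih]
    constructor
    · rintro ⟨h1, h2⟩ i hi
      rcases i with _ | i
      · simpa using h1
      · simpa using h2 i (by simpa using hi)
    · intro h
      exact ⟨by simpa using h 0 (by simp), fun i hi => by simpa using h (i + 1) (by simpa using hi)⟩

theorem startsWith_append (u v : List (Fin 3)) (y : ℕ → Fin 3) :
    StartsWith (u ++ v) y ↔ StartsWith u y ∧ StartsWith v fun i => y (i + u.length) := by
  induction u generalizing y with
  | nil => simp [StartsWith]
  | cons a u ih =>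
    simp only [List.cons_append, StartsWith, ih, List.length_cons, and_assoc]
    have : (fun i => y (i + u.length + 1)) = fun i => y (i + (u.length + 1)) := by
      funext i; rw [add_assoc]
    rw [this]

theorem bwd_add (x : ℤ → Fin 3) (k : ℤ) (n : ℕ) : (fun i => bwd x k (i + n)) = bwd x (k - n) := by
  funext i; simp only [bwd]; congr 1; push_cast; ring

theorem fwd_add (x : ℤ → Fin 3) (k : ℤ) (n : ℕ) : (fun i => fwd x k (i + n)) = fwd x (k + n) := by
  funext i; simp only [fwd]; congr 1; push_cast; ring

theorem startsWith_append_bwd (u v : List (Fin 3)) (x : ℤ → Fin 3) (k : ℤ) :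
    StartsWith (u ++ v) (bwd x k) ↔
      StartsWith u (bwd x k) ∧ StartsWith v (bwd x (k - u.length)) := by
  rw [startsWith_append, bwd_add]

theorem startsWith_append_fwd (u v : List (Fin 3)) (x : ℤ → Fin 3) (k : ℤ) :
    StartsWith (u ++ v) (fwd x k) ↔
      StartsWith u (fwd x k) ∧ StartsWith v (fwd x (k + u.length)) := by
  rw [startsWith_append, fwd_add]

theorem startsWith_cons_bwd (a : Fin 3) (u : List (Fin 3)) (x : ℤ → Fin 3) (k : ℤ) :
    StartsWith (a :: u) (bwd x k) ↔ x k = a ∧ StartsWith u (bwd x (k - 1)) := by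
  have := bwd_add x k 1
  rw [StartsWith, this]; simp [bwd]

theorem startsWith_cons_fwd (a : Fin 3) (u : List (Fin 3)) (x : ℤ → Fin 3) (k : ℤ) :
    StartsWith (a :: u) (fwd x k) ↔ x (k + 1) = a ∧ StartsWith u (fwd x (k + 1)) := by
  have := fwd_add x k 1
  rw [StartsWith, this]; simp [fwd]

theorem startsWith_reverse_fwd (u : List (Fin 3)) (x : ℤ → Fin 3) (k : ℤ) :
    StartsWith u.reverse (fwd x k) ↔ StartsWith u (bwd x (k + u.length)) := by
  induction u generalizing k with
  | nil => simp [StartsWith]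
  | cons a u ih =>
    rw [List.reverse_cons, startsWith_append_fwd, ih, startsWith_cons_fwd, startsWith_cons_bwd,
      List.length_reverse, List.length_cons]
    push_cast
    rw [show k + ((u.length : ℤ) + 1) - 1 = k + u.length by ring,
      show k + ((u.length : ℤ) + 1) = k + u.length + 1 by ring]
    simp only [StartsWith, and_true]
    exact and_comm

theorem measurableSet_startsWith (u : List (Fin 3)) : MeasurableSet {y | StartsWith u y} := by
  have : {y | StartsWith u y} = ⋂ i ∈ Finset.range u.length, {y | y i = u.getD i 0} := by
    ext y; simp [startsWith_iff]
  rw [this]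
  exact Finset.measurableSet_biInter _ fun i _ =>
    measurableSet_eq_fun (measurable_pi_apply i) measurable_const

theorem measurable_bwd (k : ℤ) : Measurable fun x : ℤ → Fin 3 => bwd x k :=
  measurable_pi_lambda _ fun _ => measurable_pi_apply _

theorem measurable_fwd (k : ℤ) : Measurable fun x : ℤ → Fin 3 => fwd x k :=
  measurable_pi_lambda _ fun _ => measurable_pi_apply _

theorem measurableSet_bwd (u : List (Fin 3)) (k : ℤ) :
    MeasurableSet {x | StartsWith u (bwd x k)} := measurable_bwd k (measurableSet_startsWith u)

theorem measurableSet_fwd (u : List (Fin 3)) (k : ℤ) :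
    MeasurableSet {x | StartsWith u (fwd x k)} := measurable_fwd k (measurableSet_startsWith u)

/-- The probability of a word. -/
noncomputable def wordWeight (u : List (Fin 3)) : ℝ≥0∞ := 3⁻¹ ^ u.length

theorem wordWeight_append (u v : List (Fin 3)) :
    wordWeight (u ++ v) = wordWeight u * wordWeight v := by
  simp [wordWeight, pow_add]

theorem letterLaw_words (u v : List (Fin 3)) (k : ℤ) :
    letterLaw ℤ {x | StartsWith u (bwd x k) ∧ StartsWith v (fwd x k)} =
      wordWeight u * wordWeight v := by
  have h : {x : ℤ → Fin 3 | StartsWith u (bwd x k) ∧ StartsWith v (fwd x k)} =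
      {x | ∀ i ∈ Finset.Ioc (k - u.length) (k + v.length),
        x i = if i ≤ k then u.getD (k - i).toNat 0 else v.getD (i - k - 1).toNat 0} := by
    ext x
    simp only [Set.mem_ofPred_eq, startsWith_iff, Finset.mem_Ioc, bwd, fwd]
    constructor
    · rintro ⟨h1, h2⟩ i ⟨h3, h4⟩
      split_ifs with h5
      · rw [← h1 _ (by omega)]; congr 1; omega
      · rw [← h2 _ (by omega)]; congr 1; omega
    · intro h
      constructor
      · intro i hi
        rw [h _ (by omega), if_pos (by omega)]; congr 1; omega
      · intro i hi
        rw [h _ (by omega), if_neg (by omega)]; congr 1; omega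
  rw [h, letterLaw_cylinder, Int.card_Ioc, wordWeight, wordWeight, ← pow_add]
  congr 1; omega

/-- Words along which the partial sums of `f` first reach `-h` at the end. -/
def DescendsBy (f : Fin 3 → ℤ) : ℕ → List (Fin 3) → Prop
  | 0, u => u = []
  | _ + 1, [] => False
  | h + 1, a :: u => DescendsBy f ((h : ℤ) + 1 + f a).toNat u

theorem descendsBy_spec {f : Fin 3 → ℤ} (hf : ∀ a, -1 ≤ f a) {h : ℕ} {u : List (Fin 3)}
    {y : ℕ → Fin 3} (hu : DescendsBy f h u) (hy : StartsWith u y) :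
    ∑ i ∈ Finset.range u.length, f (y i) = -h ∧
      ∀ n < u.length, -(h : ℤ) < ∑ i ∈ Finset.range n, f (y i) := by
  induction u generalizing h y with
  | nil =>
    rcases h with _ | h
    · simp
    · exact hu.elim
  | cons a u ih =>
    rcases h with _ | h
    · simp [DescendsBy] at hu
    · have ha := hf a
      obtain ⟨h1, h2⟩ := ih hu hy.2
      have h3 := hy.1
      refine ⟨?_, fun n hn => ?_⟩
      · rw [List.length_cons, Finset.sum_range_succ', h1, h3]; push_cast; omega
      · rcases n with _ | n
        · simp; omega
        · have := h2 n (by simpa using hn)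
          rw [Finset.sum_range_succ', h3]; push_cast; omega

theorem exists_descendsBy {f : Fin 3 → ℤ} (hf : ∀ a, -1 ≤ f a) {h n : ℕ} {y : ℕ → Fin 3}
    (hy : ∑ i ∈ Finset.range n, f (y i) = -h) : ∃ u, DescendsBy f h u ∧ StartsWith u y := by
  induction n generalizing h y with
  | zero =>
    have : h = 0 := by simpa using hy
    subst this
    exact ⟨[], rfl, trivial⟩
  | succ n ih =>
    rcases h with _ | h
    · exact ⟨[], rfl, trivial⟩
    · have ha := hf (y 0)
      rw [Finset.sum_range_succ'] at hy
      obtain ⟨u, h1, h2⟩ := ih (h := ((h : ℤ) + 1 + f (y 0)).toNat) (y := fun i => y (i + 1))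
        (by push_cast at hy; omega)
      exact ⟨y 0 :: u, h1, rfl, h2⟩

/-- Words that stop at a first passage form a prefix code: none is a proper prefix of another. Hence
their cylinders are disjoint and their weights can be added. -/
theorem DescendsBy.unique {f : Fin 3 → ℤ} {h : ℕ} {u v : List (Fin 3)} {y : ℕ → Fin 3}
    (hu : DescendsBy f h u) (hv : DescendsBy f h v) (hy : StartsWith u y) (hy' : StartsWith v y) :
    u = v := by
  induction u generalizing h v y with
  | nil =>
    rcases h with _ | h
    · simp only [DescendsBy] at hv; exact hv.symm
    · exact hu.elim
  | cons a u ih =>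
    rcases h with _ | h
    · simp [DescendsBy] at hu
    · rcases v with _ | ⟨b, v⟩
      · exact hv.elim
      · obtain rfl : a = b := hy.1.symm.trans hy'.1
        rw [ih hu hv hy.2 hy'.2]

theorem DescendsBy.append {f : Fin 3 → ℤ} (hf : ∀ a, -1 ≤ f a) {h h' : ℕ} {u v : List (Fin 3)}
    (hu : DescendsBy f h u) (hv : DescendsBy f h' v) : DescendsBy f (h + h') (u ++ v) := by
  induction u generalizing h with
  | nil =>
    rcases h with _ | h
    · simpa using hv
    · exact hu.elim
  | cons a u ih =>
    rcases h with _ | h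
    · simp [DescendsBy] at hu
    · have ha := hf a
      have := ih hu
      rw [show h + 1 + h' = (h + h') + 1 by ring, List.cons_append, DescendsBy]
      convert this using 1
      push_cast; omega

theorem DescendsBy.passTime_eq {f : Fin 3 → ℤ} (hf : ∀ a, -1 ≤ f a) {u : List (Fin 3)}
    {y : ℕ → Fin 3} (hu : DescendsBy f 1 u) (hy : StartsWith u y) : passTime f y = u.length := by
  obtain ⟨h1, h2⟩ := descendsBy_spec hf hu hy
  refine IsLeast.csInf_eq ⟨by simpa using h1, fun n hn => ?_⟩
  by_contra hlt
  have := h2 n (by omega)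
  have hn' : ∑ i ∈ Finset.range n, f (y i) = -1 := hn
  rw [hn'] at this
  simp at this

/-- The values of `f` are `-1`, `0` and `1`. -/
def IsStepValue (f : Fin 3 → ℤ) : Prop :=
  ∀ g : ℤ → ℝ≥0∞, ∑ a, g (f a) = g (-1) + g 0 + g 1

theorem isStepValue_fstFwd : IsStepValue fstFwd := fun g => by
  simp [Fin.sum_univ_three, fstFwd, stepOf]; ring
theorem isStepValue_sndFwd : IsStepValue sndFwd := fun g => by
  simp [Fin.sum_univ_three, sndFwd, stepOf]; ring
theorem isStepValue_fstBwd : IsStepValue fstBwd := fun g => by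
  simp [Fin.sum_univ_three, fstBwd, stepOf]
theorem isStepValue_sndBwd : IsStepValue sndBwd := fun g => by
  simp [Fin.sum_univ_three, sndBwd, stepOf]; ring

theorem tsum_list_cons {α : Type*} (g : List α → ℝ≥0∞) :
    ∑' u, g u = g [] + ∑' (a : α), ∑' u, g (a :: u) := by
  let e : Option (α × List α) ≃ List α :=
    { toFun := fun o => o.elim [] fun p => p.1 :: p.2
      invFun := fun u => match u with
        | [] => none
        | a :: u => some (a, u)
      left_inv := by rintro (_ | ⟨a, u⟩) <;> rfl
      right_inv := by rintro (_ | ⟨a, u⟩) <;> rfl }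
  rw [← e.tsum_eq, ENNReal.tsum_eq_add_tsum_ite none]
  congr 1
  rw [← ENNReal.tsum_prod (f := fun a u => g (a :: u)),
    ← Function.Injective.tsum_eq (Option.some_injective (α × List α))]
  · exact tsum_congr fun p => by simp [e]
  · rintro (_ | p) hp
    · simp at hp
    · exact ⟨p, rfl⟩

open Classical in
/-- The total weight of the words that descend by `h`. -/
noncomputable def descentWeight (f : Fin 3 → ℤ) (h : ℕ) : ℝ≥0∞ :=
  ∑' u, if DescendsBy f h u then wordWeight u else 0

theorem descentWeight_zero (f : Fin 3 → ℤ) : descentWeight f 0 = 1 := by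
  rw [descentWeight, tsum_eq_single []]
  · simp [DescendsBy, wordWeight]
  · intro u hu; simp [DescendsBy, hu]

/-- Conditioning on the first letter, which changes the remaining descent by -1, 0 or 1 with
probability 1/3 each. -/
theorem descentWeight_succ {f : Fin 3 → ℤ} (hf : IsStepValue f) (h : ℕ) :
    descentWeight f (h + 1) =
      3⁻¹ * (descentWeight f h + descentWeight f (h + 1) + descentWeight f (h + 2)) := by
  have h1 := hf fun z => 3⁻¹ * descentWeight f ((h : ℤ) + 1 + z).toNat
  have h2 : descentWeight f (h + 1) =
      ∑ a, 3⁻¹ * descentWeight f ((h : ℤ) + 1 + f a).toNat := by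
    rw [descentWeight, tsum_list_cons, tsum_fintype]
    rw [if_neg (by simp [DescendsBy]), zero_add]
    refine Finset.sum_congr rfl fun a _ => ?_
    simp only [DescendsBy]
    rw [descentWeight, ← ENNReal.tsum_mul_left]
    refine tsum_congr fun u => ?_
    by_cases hu : DescendsBy f ((h : ℤ) + 1 + f a).toNat u <;>
      simp [hu, wordWeight, pow_succ']
  refine h2.trans (h1.trans ?_)
  rw [show ((h : ℤ) + 1 + -1).toNat = h by omega,
    show ((h : ℤ) + 1 + 0).toNat = h + 1 by omega, show ((h : ℤ) + 1 + 1).toNat = h + 2 by omega]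
  ring

theorem tsum_ite_eq_measure {β : Type*} [Countable β] {p : β → Prop} [DecidablePred p]
    {Ω : Type*} [MeasurableSpace Ω] (P : Measure Ω) (A : β → Set Ω) (hA : ∀ b, MeasurableSet (A b))
    (hd : ∀ b b' ω, p b → p b' → ω ∈ A b → ω ∈ A b' → b = b') :
    P {ω | ∃ b, p b ∧ ω ∈ A b} = ∑' b, if p b then P (A b) else 0 := by
  have h : {ω | ∃ b, p b ∧ ω ∈ A b} = ⋃ b, {ω | p b ∧ ω ∈ A b} := by ext ω; simp
  have h' : ∀ b, {ω | p b ∧ ω ∈ A b} = if p b then A b else ∅ := fun b => by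
    split_ifs with hb <;> simp [hb]
  rw [h, measure_iUnion]
  · refine tsum_congr fun b => ?_
    rw [h']; split_ifs <;> simp
  · intro b b' hb
    refine Set.disjoint_left.2 fun ω h1 h2 => hb (hd b b' ω h1.1 h2.1 h1.2 h2.2)
  · intro b
    rw [h']
    split_ifs
    · exact hA b
    · exact MeasurableSet.empty

open Classical in
theorem letterLaw_exists_bwd (f : Fin 3 → ℤ) (h : ℕ) (k : ℤ) :
    letterLaw ℤ {x | ∃ u, DescendsBy f h u ∧ StartsWith u (bwd x k)} = descentWeight f h := by
  rw [descentWeight]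
  have := tsum_ite_eq_measure (p := DescendsBy f h) (letterLaw ℤ)
    (fun u => {x | StartsWith u (bwd x k)}) (fun u => measurableSet_bwd u k)
    (fun u v x h1 h2 h3 h4 => h1.unique h2 h3 h4)
  simp only [Set.mem_ofPred_eq] at this
  rw [this]
  refine tsum_congr fun u => ?_
  have := letterLaw_words u [] k
  simp only [StartsWith, and_true] at this
  rw [this]; simp [wordWeight]

open Classical in
theorem letterLaw_exists_fwd (f : Fin 3 → ℤ) (h : ℕ) (k : ℤ) :
    letterLaw ℤ {x | ∃ u, DescendsBy f h u ∧ StartsWith u (fwd x k)} = descentWeight f h := by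
  rw [descentWeight]
  have := tsum_ite_eq_measure (p := DescendsBy f h) (letterLaw ℤ)
    (fun u => {x | StartsWith u (fwd x k)}) (fun u => measurableSet_fwd u k)
    (fun u v x h1 h2 h3 h4 => h1.unique h2 h3 h4)
  simp only [Set.mem_ofPred_eq] at this
  rw [this]
  refine tsum_congr fun u => ?_
  have := letterLaw_words [] u k
  simp only [StartsWith, true_and] at this
  rw [this]; simp [wordWeight]

/-- The walk almost surely reaches every lower level. -/
theorem descentWeight_eq_one {f : Fin 3 → ℤ} (hf : IsStepValue f) (h : ℕ) :
    descentWeight f h = 1 := by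
  have hle : ∀ h, descentWeight f h ≤ 1 := fun h => by
    rw [← letterLaw_exists_bwd f h 0]; exact prob_le_one
  have hne : ∀ h, descentWeight f h ≠ ⊤ := fun h => ne_top_of_le_ne_top ENNReal.one_ne_top (hle h)
  set y : ℕ → ℝ := fun h => (descentWeight f h).toReal with hy
  have hy0 : y 0 = 1 := by simp [hy, descentWeight_zero]
  have hy1 : ∀ h, y h ≤ 1 := fun h => ENNReal.toReal_le_of_le_ofReal zero_le_one (by simpa using hle h)
  have hy2 : ∀ h, 0 ≤ y h := fun h => ENNReal.toReal_nonneg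
  have hrec : ∀ h, y (h + 2) = 2 * y (h + 1) - y h := fun h => by
    have := congrArg ENNReal.toReal (descentWeight_succ hf h)
    rw [ENNReal.toReal_mul, ENNReal.toReal_add (ENNReal.add_ne_top.2 ⟨hne _, hne _⟩) (hne _),
      ENNReal.toReal_add (hne _) (hne _)] at this
    simp only [ENNReal.toReal_inv, ENNReal.toReal_ofNat] at this
    simp only [hy]
    linarith
  -- The second differences of `y` vanish, so `y` is affine. It starts at 1 and stays in `[0, 1]`,
  -- hence it is constant.
  have hlin : ∀ h : ℕ, y h = 1 + h * (y 1 - 1) ∧ y (h + 1) = 1 + (h + 1) * (y 1 - 1) := by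
    intro h
    induction h with
    | zero => simp [hy0]
    | succ h ih =>
      refine ⟨by push_cast; exact ih.2, ?_⟩
      rw [hrec h, ih.1, ih.2]; push_cast; ring
  have hone : y 1 = 1 := by
    by_contra hne1
    have hlt : 0 < 1 - y 1 := by
      have := hy1 1
      exact sub_pos.2 (lt_of_le_of_ne this hne1)
    obtain ⟨n, hn⟩ := exists_nat_gt (1 / (1 - y 1))
    rw [div_lt_iff₀ hlt] at hn
    have h1 := (hlin n).1
    have h2 := hy2 n
    nlinarith
  have : y h = 1 := by rw [(hlin h).1, hone]; simp
  rw [← ENNReal.toReal_eq_one_iff]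
  exact this

open Classical in
theorem tsum_descendsBy_one {f : Fin 3 → ℤ} (hf : IsStepValue f) :
    ∑' u, (if DescendsBy f 1 u then wordWeight u else 0) = 1 := descentWeight_eq_one hf 1

theorem ae_exists_sum_bwd {f : Fin 3 → ℤ} (hf : IsStepValue f) (hf' : ∀ a, -1 ≤ f a) (k : ℤ) :
    ∀ᵐ x ∂letterLaw ℤ, ∃ n : ℕ, ∑ i ∈ Finset.range n, f (bwd x k i) = -1 := by
  have h := letterLaw_exists_bwd f 1 k
  rw [descentWeight_eq_one hf] at h
  have hm : MeasurableSet {x | ∃ u, DescendsBy f 1 u ∧ StartsWith u (bwd x k)} := by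
    have : {x | ∃ u, DescendsBy f 1 u ∧ StartsWith u (bwd x k)} =
        ⋃ u ∈ {u | DescendsBy f 1 u}, {x | StartsWith u (bwd x k)} := by ext; simp
    rw [this]
    exact MeasurableSet.biUnion (Set.to_countable _) fun u _ => measurableSet_bwd u k
  have := (prob_compl_eq_zero_iff hm).2 h
  rw [← mem_ae_iff] at this
  filter_upwards [this] with x ⟨u, h1, h2⟩
  exact ⟨_, by simpa using (descendsBy_spec hf' h1 h2).1⟩

theorem ae_exists_sum_fwd {f : Fin 3 → ℤ} (hf : IsStepValue f) (hf' : ∀ a, -1 ≤ f a) (k : ℤ) :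
    ∀ᵐ x ∂letterLaw ℤ, ∃ n : ℕ, ∑ i ∈ Finset.range n, f (fwd x k i) = -1 := by
  have h := letterLaw_exists_fwd f 1 k
  rw [descentWeight_eq_one hf] at h
  have hm : MeasurableSet {x | ∃ u, DescendsBy f 1 u ∧ StartsWith u (fwd x k)} := by
    have : {x | ∃ u, DescendsBy f 1 u ∧ StartsWith u (fwd x k)} =
        ⋃ u ∈ {u | DescendsBy f 1 u}, {x | StartsWith u (fwd x k)} := by ext; simp
    rw [this]
    exact MeasurableSet.biUnion (Set.to_countable _) fun u _ => measurableSet_fwd u k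
  have := (prob_compl_eq_zero_iff hm).2 h
  rw [← mem_ae_iff] at this
  filter_upwards [this] with x ⟨u, h1, h2⟩
  exact ⟨_, by simpa using (descendsBy_spec hf' h1 h2).1⟩

theorem ae_recurrent : ∀ᵐ x ∂letterLaw ℤ, Recurrent x := by
  filter_upwards [ae_all_iff.2 (ae_exists_sum_fwd isStepValue_fstFwd neg_one_le_fstFwd),
    ae_all_iff.2 (ae_exists_sum_fwd isStepValue_sndFwd neg_one_le_sndFwd),
    ae_all_iff.2 (ae_exists_sum_bwd isStepValue_fstBwd neg_one_le_fstBwd),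
    ae_all_iff.2 (ae_exists_sum_bwd isStepValue_sndBwd neg_one_le_sndBwd)] with x h1 h2 h3 h4
  exact ⟨h1, h2, h3, h4⟩

/-- Summing over the passage words that may follow a given word. -/
theorem measure_exists_passage {f : Fin 3 → ℤ} (hf : IsStepValue f) {E : List (Fin 3) → Set (ℤ → Fin 3)}
    {y : (ℤ → Fin 3) → ℕ → Fin 3}
    (hE : ∀ w, MeasurableSet (E w)) (hEy : ∀ w x, x ∈ E w → StartsWith w (y x)) {c : ℝ≥0∞}
    (hc : ∀ w, DescendsBy f 1 w → letterLaw ℤ (E w) = c * wordWeight w) :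
    letterLaw ℤ {x | ∃ w, DescendsBy f 1 w ∧ x ∈ E w} = c := by
  classical
  rw [tsum_ite_eq_measure _ E hE fun u v x h1 h2 h3 h4 => h1.unique h2 (hEy _ _ h3) (hEy _ _ h4)]
  calc ∑' w, (if DescendsBy f 1 w then letterLaw ℤ (E w) else 0)
      = ∑' w, c * (if DescendsBy f 1 w then wordWeight w else 0) := by
        refine tsum_congr fun w => ?_
        split_ifs with h
        · exact hc w h
        · simp
    _ = c := by rw [ENNReal.tsum_mul_left, tsum_descendsBy_one hf, mul_one]

/-! ## Measurability -/

theorem measurable_natSInf {X : Type*} [MeasurableSpace X] {p : ℕ → X → Prop}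
    (hp : ∀ n, MeasurableSet {x | p n x}) : Measurable fun x => sInf {n : ℕ | p n x} := by
  refine measurable_to_countable' fun n => ?_
  -- Either `p` holds for the first time at `n`, or `p` never holds and `n = 0`, by the convention
  -- `sInf ∅ = 0`.
  have : (fun x => sInf {n : ℕ | p n x}) ⁻¹' {n} =
      ({x | p n x} ∪ ⋂ m : ℕ, {x | p m x}ᶜ ∩ {_x | n = 0}) ∩
        ⋂ m ∈ Finset.range n, {x | p m x}ᶜ := by
    ext y
    simp only [Set.mem_preimage, Set.mem_singleton_iff, Set.mem_inter_iff, Set.mem_union,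
      Set.mem_ofPred_eq, Set.mem_iInter, Set.mem_compl_iff, Finset.mem_range]
    constructor
    · rintro rfl
      refine ⟨?_, fun m hm => Nat.notMem_of_lt_sInf hm⟩
      by_cases h : ∃ m, p m y
      · exact Or.inl (Nat.sInf_mem h)
      · push Not at h
        refine Or.inr fun m => ⟨h m, ?_⟩
        convert Nat.sInf_empty
        ext m; simpa using h m
    · rintro ⟨h1 | h1, h2⟩
      · refine IsLeast.csInf_eq ⟨h1, fun m hm => ?_⟩
        by_contra hlt
        exact h2 m (by omega) hm
      · rw [(h1 0).2]
        convert Nat.sInf_empty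
        ext m; simpa using (h1 m).1
  rw [this]
  refine ((hp n).union (MeasurableSet.iInter fun m => (hp m).compl.inter ?_)).inter
    (Finset.measurableSet_biInter _ fun m _ => (hp m).compl)
  exact MeasurableSet.const _

theorem measurable_passTime (f : Fin 3 → ℤ) : Measurable (passTime f) :=
  measurable_natSInf fun _ => measurableSet_eq_fun
    (Finset.measurable_sum _ fun i _ => (measurable_of_countable f).comp (measurable_pi_apply i))
    measurable_const

theorem measurable_index {X β : Type*} [MeasurableSpace X] [MeasurableSpace β] {F : X → ℤ → β}
    (hF : ∀ k, Measurable fun x => F x k) {g : X → ℤ} (hg : Measurable g) :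
    Measurable fun x => F x (g x) := by
  have : Measurable fun p : ℤ × X => F p.2 p.1 := measurable_from_prod_countable_right hF
  exact this.comp (hg.prodMk measurable_id)

theorem measurable_fstAfter (k : ℤ) : Measurable fun x => fstAfter x k :=
  measurable_const.add (measurable_of_countable (fun n : ℕ => (n : ℤ)) |>.comp
    ((measurable_passTime _).comp (measurable_fwd k)))

theorem measurable_sndAfter (k : ℤ) : Measurable fun x => sndAfter x k :=
  measurable_const.add (measurable_of_countable (fun n : ℕ => (n : ℤ)) |>.comp
    ((measurable_passTime _).comp (measurable_fwd k)))

theorem measurable_fstBefore (k : ℤ) : Measurable fun x => fstBefore x k :=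
  measurable_const.sub (measurable_of_countable (fun n : ℕ => (n : ℤ)) |>.comp
    ((measurable_passTime _).comp (measurable_bwd k)))

theorem measurable_sndBefore (k : ℤ) : Measurable fun x => sndBefore x k :=
  measurable_const.sub (measurable_of_countable (fun n : ℕ => (n : ℤ)) |>.comp
    ((measurable_passTime _).comp (measurable_bwd k)))

theorem measurableSet_letter (k : ℤ) (a : Fin 3) : MeasurableSet {x : ℤ → Fin 3 | x k = a} :=
  measurableSet_eq_fun (measurable_pi_apply k) measurable_const

theorem measurable_northNext (k : ℤ) : Measurable fun x => northNext x k :=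
  (measurable_index measurable_sndAfter (measurable_fstAfter k)).sub measurable_const

theorem measurable_southNext (k : ℤ) : Measurable fun x => southNext x k :=
  (measurable_index measurable_fstBefore (measurable_sndBefore k)).add measurable_const

theorem measurable_dualSouthNext (k : ℤ) : Measurable fun x => dualSouthNext x k :=
  Measurable.ite (measurableSet_letter k 0) measurable_const
    (Measurable.ite (measurableSet_letter k 1) (measurable_sndBefore _) (measurable_fstBefore _))

theorem measurable_westNext (k : ℤ) : Measurable fun x => westNext x k :=
  Measurable.ite (measurableSet_letter k 0) (measurable_northNext k)
    (Measurable.ite (measurableSet_letter k 1) (measurable_sndBefore _) (measurable_fstBefore _))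

theorem measurable_westPrev (k : ℤ) : Measurable fun x => westPrev x k :=
  Measurable.ite (measurableSet_letter (k + 1) 1) (measurable_southNext k)
    (Measurable.ite (measurableSet_letter (k + 1) 0) (measurable_fstAfter _) (measurable_sndAfter _))

theorem measurable_iterate {F : (ℤ → Fin 3) → ℤ → ℤ} (hF : ∀ k, Measurable fun x => F x k) (n : ℕ)
    (k : ℤ) : Measurable fun x => (F x)^[n] k := by
  induction n with
  | zero => exact measurable_const
  | succ n ih =>
    simp only [Function.iterate_succ_apply']
    exact measurable_index hF ih

theorem measurable_westPath (n : ℤ) : Measurable fun x => westPath x n := by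
  rcases n with n | n
  · exact measurable_iterate measurable_westNext n 0
  · exact measurable_iterate measurable_westPrev (n + 1) 0

theorem measurable_westLetter : Measurable westLetter :=
  measurable_pi_lambda _ fun n => measurable_index measurable_pi_apply (measurable_westPath (n - 1))

/-! ### Invariance of the letter law under reindexing, shift and time reversal -/

theorem map_letterLaw {ι κ : Type*} {φ : κ → ι} (hφ : Function.Injective φ)
    (τ : Equiv.Perm (Fin 3)) :
    (letterLaw ι).map (fun x i => τ (x (φ i))) = letterLaw κ := by
  classical
  refine map_eq_letterLaw ?_ fun I => ⟨I, le_rfl, fun a => ?_⟩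
  · exact measurable_pi_lambda _ fun i =>
      (measurable_of_countable τ).comp (measurable_pi_apply (φ i))
  · have h := letterLaw_cylinder (I.map ⟨φ, hφ⟩) (Function.extend φ (fun i => τ.symm (a i)) 0)
    rw [Finset.card_map] at h
    rw [← h]
    congr 1
    ext x
    simp [hφ.extend_apply, Equiv.eq_symm_apply]

theorem measurable_shiftSeq (j : ℤ) : Measurable (shiftSeq j) :=
  measurable_pi_lambda _ fun _ => measurable_pi_apply _

theorem map_shiftSeq (j : ℤ) : (letterLaw ℤ).map (shiftSeq j) = letterLaw ℤ :=
  map_letterLaw (add_left_injective j) (Equiv.refl _)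

theorem measurable_revSeq : Measurable revSeq :=
  measurable_pi_lambda _ fun _ =>
    (measurable_of_countable (Equiv.swap (0 : Fin 3) 1)).comp (measurable_pi_apply _)

theorem map_revSeq : (letterLaw ℤ).map revSeq = letterLaw ℤ :=
  map_letterLaw (sub_right_injective (b := (1 : ℤ))) (Equiv.swap 0 1)

/-! ## Stationarity along the Peano curve -/

theorem Recurrent.westPath_shiftSeq {x : ℤ → Fin 3} (hx : Recurrent x) (m n : ℤ) :
    westPath (shiftSeq (westPath x m) x) n = westPath x (m + n) - westPath x m := by
  have := (hx.shift (westPath x m)).eq_westPath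
    (f := fun n => westPath x (m + n) - westPath x m) (by simp) (fun n => by
      rw [westNext_shiftSeq, sub_add_cancel, ← hx.westPath_succ, add_assoc])
  exact (congrFun this n).symm

theorem shiftSeq_shiftSeq (i j : ℤ) (x : ℤ → Fin 3) :
    shiftSeq i (shiftSeq j x) = shiftSeq (i + j) x := by
  funext n; simp only [shiftSeq]; congr 1; ring

theorem shiftSeq_zero (x : ℤ → Fin 3) : shiftSeq 0 x = x := by
  funext n; simp [shiftSeq]

theorem Recurrent.westPath_shiftSeq_neg_eq_iff {x : ℤ → Fin 3} (hx : Recurrent x) (n k : ℤ) :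
    westPath (shiftSeq (-k) x) n = k ↔ westPath x (-n) = -k := by
  constructor
  · intro h
    have h1 := (hx.shift (-k)).westPath_shiftSeq n (-n)
    rw [h, shiftSeq_shiftSeq, add_neg_cancel, shiftSeq_zero, add_neg_cancel, westPath_zero] at h1
    rw [h1, zero_sub]
  · intro h
    have h1 := hx.westPath_shiftSeq (-n) n
    rw [h, neg_add_cancel, westPath_zero] at h1
    rw [h1]; ring

/-- The letters seen from the edge visited at time `n` by the Peano curve have the same law as
those seen from the root. -/
theorem letterLaw_westPath {Q : Set (ℤ → Fin 3)} (hQ : MeasurableSet Q) (n : ℤ) :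
    letterLaw ℤ {x | shiftSeq (westPath x n) x ∈ Q} = letterLaw ℤ Q := by
  have hm : ∀ k, MeasurableSet {x | westPath x n = k} := fun k =>
    measurableSet_eq_fun (measurable_westPath n) measurable_const
  have hm' : ∀ k, MeasurableSet {x | westPath x (-n) = k} := fun k =>
    measurableSet_eq_fun (measurable_westPath (-n)) measurable_const
  have e1 : {x | shiftSeq (westPath x n) x ∈ Q} =
      ⋃ k : ℤ, {x | westPath x n = k} ∩ shiftSeq k ⁻¹' Q := by
    ext x; simp
  have e2 : Q = ⋃ k : ℤ, {x | westPath x (-n) = -k} ∩ Q := by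
    ext x
    simp only [Set.mem_iUnion, Set.mem_inter_iff, Set.mem_ofPred_eq]
    exact ⟨fun h => ⟨-westPath x (-n), by simp, h⟩, fun ⟨k, _, h⟩ => h⟩
  rw [e1]
  conv_rhs => rw [e2]
  rw [measure_iUnion, measure_iUnion]
  · refine tsum_congr fun k => ?_
    -- Mass transport: the shift that recentres at `k` preserves the law and turns "the curve is at
    -- `k` at time `n`" into "the curve is at `-k` at time `-n`". Summing over `k` gives the whole
    -- space again.
    have : letterLaw ℤ ({x | westPath x n = k} ∩ shiftSeq k ⁻¹' Q) =
        letterLaw ℤ (shiftSeq (-k) ⁻¹' ({x | westPath x n = k} ∩ shiftSeq k ⁻¹' Q)) := by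
      conv_lhs => rw [← map_shiftSeq (-k)]
      exact Measure.map_apply (measurable_shiftSeq _) ((hm k).inter (measurable_shiftSeq k hQ))
    rw [this]
    refine measure_congr ?_
    filter_upwards [ae_recurrent] with x hx
    have h1 := hx.westPath_shiftSeq_neg_eq_iff n k
    refine propext ?_
    change (westPath (shiftSeq (-k) x) n = k ∧ shiftSeq k (shiftSeq (-k) x) ∈ Q) ↔
      (westPath x (-n) = -k ∧ x ∈ Q)
    rw [h1, shiftSeq_shiftSeq, add_neg_cancel, shiftSeq_zero]
  · intro i j hij
    refine Set.disjoint_left.2 fun x h1 h2 => hij ?_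
    have h3 : westPath x (-n) = -i := h1.1
    have h4 : westPath x (-n) = -j := h2.1
    omega
  · exact fun k => (hm' _).inter hQ
  · intro i j hij
    refine Set.disjoint_left.2 fun x h1 h2 => hij ?_
    have h3 : westPath x n = i := h1.1
    have h4 : westPath x n = j := h2.1
    omega
  · exact fun k => (hm k).inter (measurable_shiftSeq k hQ)

/-! ## The words along the south-going and north-going branches -/

/-- Passage words of the second coordinate, read backward. -/
def SndPass (d : List (Fin 3)) : Prop := DescendsBy sndBwd 1 d

/-- The passage words read from `e` and from the vertices below it on the south-going branch. -/
def PastWords (x : ℤ → Fin 3) : ℤ → List (List (Fin 3)) → Prop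
  | _, [] => True
  | k, d :: ds => StartsWith d (bwd x k) ∧ PastWords x (fstBefore x (k - d.length)) ds

/-- The passage words read from the edges above `e` on the north-going branch. -/
def FutureWords (x : ℤ → Fin 3) : ℤ → List (List (Fin 3)) → Prop
  | _, [] => True
  | k, d :: ds => StartsWith d (bwd x (sndAfter x (fstAfter x k) - 1)) ∧
      FutureWords x (sndAfter x (fstAfter x k)) ds

/-- `PastWords` as a countable union of cylinders. -/
def PastCyl (x : ℤ → Fin 3) : ℤ → List (List (Fin 3)) → Prop
  | _, [] => True
  | k, d :: ds => StartsWith d (bwd x k) ∧ ∃ b, DescendsBy fstBwd 1 b ∧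
      StartsWith b (bwd x (k - d.length)) ∧ PastCyl x (k - d.length - b.length) ds

/-- A passage word of the second coordinate, read forward up to the end of the passage. -/
def turnWord (d : List (Fin 3)) : List (Fin 3) := d.dropLast.reverse ++ [1]

/-- `FutureWords` as a countable union of cylinders. -/
def FutureCyl (x : ℤ → Fin 3) : ℤ → List (List (Fin 3)) → Prop
  | _, [] => True
  | k, d :: ds => ∃ c, DescendsBy fstFwd 1 c ∧ StartsWith c (fwd x k) ∧
      StartsWith (turnWord d) (fwd x (k + c.length)) ∧
      FutureCyl x (k + c.length + (turnWord d).length) ds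

theorem DescendsBy.fstAfter_eq {x : ℤ → Fin 3} {k : ℤ} {u : List (Fin 3)}
    (hu : DescendsBy fstFwd 1 u) (h : StartsWith u (fwd x k)) : fstAfter x k = k + u.length := by
  rw [fstAfter, hu.passTime_eq neg_one_le_fstFwd h]

theorem DescendsBy.fstBefore_eq {x : ℤ → Fin 3} {k : ℤ} {u : List (Fin 3)}
    (hu : DescendsBy fstBwd 1 u) (h : StartsWith u (bwd x k)) : fstBefore x k = k - u.length := by
  rw [fstBefore, hu.passTime_eq neg_one_le_fstBwd h]

theorem SndPass.sndBefore_eq {x : ℤ → Fin 3} {k : ℤ} {u : List (Fin 3)}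
    (hu : SndPass u) (h : StartsWith u (bwd x k)) : sndBefore x k = k - u.length := by
  rw [sndBefore, DescendsBy.passTime_eq neg_one_le_sndBwd hu h]

theorem DescendsBy.eq_append_two {h : ℕ} {u : List (Fin 3)} (hu : DescendsBy sndBwd (h + 1) u) :
    ∃ v, u = v ++ [2] := by
  induction u generalizing h with
  | nil => exact hu.elim
  | cons a u ih =>
    rw [DescendsBy] at hu
    rcases hn : ((h : ℤ) + 1 + sndBwd a).toNat with _ | n
    · rw [hn, DescendsBy] at hu
      refine ⟨[], ?_⟩
      have h2 : sndBwd a = -1 := by have := neg_one_le_sndBwd a; omega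
      rw [hu]
      have : a = 2 := by
        clear hn hu ih
        revert h2; revert a; decide
      simp [this]
    · rw [hn] at hu
      obtain ⟨v, rfl⟩ := ih hu
      exact ⟨a :: v, rfl⟩

theorem SndPass.exists_eq {d : List (Fin 3)} (hd : SndPass d) : ∃ v, d = v ++ [2] :=
  DescendsBy.eq_append_two hd

theorem SndPass.length_turnWord {d : List (Fin 3)} (hd : SndPass d) :
    (turnWord d).length = d.length := by
  obtain ⟨v, rfl⟩ := hd.exists_eq
  simp [turnWord]

theorem SndPass.two : SndPass [2] := by simp [SndPass, DescendsBy, sndBwd, stepOf]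

theorem SndPass.zero {d : List (Fin 3)} (hd : SndPass d) : SndPass (0 :: d) := by
  simpa [SndPass, DescendsBy, sndBwd, stepOf] using hd

theorem SndPass.one {d d' : List (Fin 3)} (hd : SndPass d) (hd' : SndPass d') :
    SndPass (1 :: (d ++ d')) := by
  have := DescendsBy.append neg_one_le_sndBwd hd hd'
  simpa [SndPass, DescendsBy, sndBwd, stepOf] using this

namespace Recurrent

variable {x : ℤ → Fin 3} (hx : Recurrent x)
include hx

theorem exists_sndPass (k : ℤ) : ∃ d, SndPass d ∧ StartsWith d (bwd x k) := by
  obtain ⟨n, hn⟩ := hx.snd_bwd k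
  exact exists_descendsBy neg_one_le_sndBwd (h := 1) (by simpa using hn)

/-- The passage of the first coordinate, over which `PastWords` silently jumps, is spelled out as a
word. In this form probabilities can be computed by summing over cylinders. -/
theorem pastWords_iff (k : ℤ) (ds : List (List (Fin 3))) : PastWords x k ds ↔ PastCyl x k ds := by
  induction ds generalizing k with
  | nil => rfl
  | cons d ds ih =>
    rw [PastWords, PastCyl]
    refine and_congr_right fun _ => ?_
    rw [ih]
    constructor
    · intro h
      obtain ⟨n, hn⟩ := hx.fst_bwd (k - d.length)
      obtain ⟨b, h1, h2⟩ := exists_descendsBy neg_one_le_fstBwd (h := 1) (by simpa using hn)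
      exact ⟨b, h1, h2, by rwa [h1.fstBefore_eq h2] at h⟩
    · rintro ⟨b, h1, h2, h⟩
      rwa [h1.fstBefore_eq h2]

/-- The backward word is `d = v ++ [2]`, its last letter being the 2 at `q`. Read forward after `q`,
the same passage shows `v` reversed and then the letter 1 that closes the bracket. So the letter 2,
which already belongs to the preceding passage, is traded for that 1 and the length is preserved. -/
theorem startsWith_turnWord_iff {d : List (Fin 3)} (hd : SndPass d) (q : ℤ) (hq : x q = 2) :
    StartsWith (turnWord d) (fwd x q) ↔
      StartsWith d (bwd x (sndAfter x q - 1)) ∧ sndAfter x q = q + d.length := by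
  obtain ⟨v, hv⟩ := hd.exists_eq
  have hlen : (d.length : ℤ) = v.length + 1 := by rw [hv]; simp
  have h0 : StartsWith (turnWord d) (fwd x q) ↔
      StartsWith v (bwd x (q + v.length)) ∧ x (q + d.length) = 1 := by
    rw [turnWord, startsWith_append_fwd, hv, List.dropLast_concat, startsWith_reverse_fwd,
      startsWith_cons_fwd, List.length_reverse, ← hv, hlen, ← add_assoc]
    simp [StartsWith]
  have h1 : StartsWith d (bwd x (q + v.length)) ↔ StartsWith v (bwd x (q + v.length)) := by
    rw [hv, startsWith_append_bwd, add_sub_cancel_right, startsWith_cons_bwd]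
    simp [StartsWith, hq]
  rw [h0, ← h1]
  constructor
  · rintro ⟨h2, h3⟩
    have h4 := hd.sndBefore_eq h2
    have h5 := hx.sndAfter_sndBefore (k := q + v.length) (by rw [← h3, hlen, add_assoc])
    rw [h4, show q + v.length - d.length + 1 = q by omega] at h5
    refine ⟨?_, by omega⟩
    rwa [h5, add_sub_cancel_right]
  · rintro ⟨h2, h3⟩
    rw [h3, show q + d.length - 1 = q + (v.length : ℤ) by omega] at h2
    exact ⟨h2, by rw [← h3]; exact hx.letter_sndAfter q⟩

theorem futureWords_iff (k : ℤ) {ds : List (List (Fin 3))} (hds : ∀ d ∈ ds, SndPass d) :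
    FutureWords x k ds ↔ FutureCyl x k ds := by
  induction ds generalizing k with
  | nil => rfl
  | cons d ds ih =>
    have hd : SndPass d := hds d (by simp)
    rw [FutureWords, FutureCyl, ih _ fun d h => hds d (by simp [h])]
    have h0 := hx.startsWith_turnWord_iff hd (fstAfter x k) (hx.letter_fstAfter k)
    have h4 := hx.sndBefore_sndAfter (hx.letter_fstAfter k)
    constructor
    · rintro ⟨h1, h2⟩
      obtain ⟨n, hn⟩ := hx.fst_fwd k
      obtain ⟨c, h5, h6⟩ := exists_descendsBy neg_one_le_fstFwd (h := 1) (by simpa using hn)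
      have h7 := h5.fstAfter_eq h6
      have h8 := hd.sndBefore_eq h1
      have h9 : sndAfter x (fstAfter x k) = fstAfter x k + d.length := by omega
      refine ⟨c, h5, h6, ?_, ?_⟩
      · rw [← h7]; exact h0.2 ⟨h1, h9⟩
      · rwa [← h7, hd.length_turnWord, ← h9]
    · rintro ⟨c, h5, h6, h7, h8⟩
      have h9 := h5.fstAfter_eq h6
      rw [← h9] at h7 h8
      have h10 := h0.1 h7
      refine ⟨h10.1, ?_⟩
      rwa [h10.2, ← hd.length_turnWord]

theorem existsUnique_pastWords (n : ℕ) (k : ℤ) :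
    ∃! ds : List (List (Fin 3)), (ds.length = n ∧ ∀ d ∈ ds, SndPass d) ∧ PastWords x k ds := by
  induction n generalizing k with
  | zero =>
    refine ⟨[], ⟨⟨rfl, by simp⟩, trivial⟩, ?_⟩
    rintro ds ⟨⟨h, -⟩, -⟩
    exact List.length_eq_zero_iff.1 h
  | succ n ih =>
    obtain ⟨d, h1, h2⟩ := hx.exists_sndPass k
    obtain ⟨ds, ⟨⟨h3, h4⟩, h5⟩, h6⟩ := ih (fstBefore x (k - d.length))
    refine ⟨d :: ds, ⟨⟨by simp [h3], by simpa [h1] using h4⟩, h2, h5⟩, ?_⟩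
    rintro (_ | ⟨d', ds'⟩) ⟨⟨h7, h8⟩, h9⟩
    · simp at h7
    · obtain rfl : d' = d := DescendsBy.unique (h8 d' (by simp)) h1 h9.1 h2
      rw [h6 ds' ⟨⟨by simpa using h7, fun d h => h8 d (by simp [h])⟩, h9.2⟩]

theorem existsUnique_futureWords (n : ℕ) (k : ℤ) :
    ∃! ds : List (List (Fin 3)), (ds.length = n ∧ ∀ d ∈ ds, SndPass d) ∧ FutureWords x k ds := by
  induction n generalizing k with
  | zero =>
    refine ⟨[], ⟨⟨rfl, by simp⟩, trivial⟩, ?_⟩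
    rintro ds ⟨⟨h, -⟩, -⟩
    exact List.length_eq_zero_iff.1 h
  | succ n ih =>
    obtain ⟨d, h1, h2⟩ := hx.exists_sndPass (sndAfter x (fstAfter x k) - 1)
    obtain ⟨ds, ⟨⟨h3, h4⟩, h5⟩, h6⟩ := ih (sndAfter x (fstAfter x k))
    refine ⟨d :: ds, ⟨⟨by simp [h3], by simpa [h1] using h4⟩, h2, h5⟩, ?_⟩
    rintro (_ | ⟨d', ds'⟩) ⟨⟨h7, h8⟩, h9⟩
    · simp at h7
    · obtain rfl : d' = d := DescendsBy.unique (h8 d' (by simp)) h1 h9.1 h2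
      rw [h6 ds' ⟨⟨by simpa using h7, fun d h => h8 d (by simp [h])⟩, h9.2⟩]

omit hx in
theorem futureWords_congr {k k' : ℤ}
    (h : sndAfter x (fstAfter x k) = sndAfter x (fstAfter x k')) (es : List (List (Fin 3))) :
    FutureWords x k es ↔ FutureWords x k' es := by
  rcases es with _ | ⟨e, es⟩
  · rfl
  · rw [FutureWords, FutureWords, h]

/-! Effect of one step of the Peano curve on the words. -/

/-- A passage word that starts with 2 is complete. The curve jumps to the place where the next past
word begins; the first passage after it is unchanged, so the future words stay the same. -/
theorem words_two (e : ℤ) (ds es : List (List (Fin 3))) :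
    (x e = 2 ∧ PastWords x (westNext x e) ds ∧ FutureWords x (westNext x e) es) ↔
      PastWords x e ([2] :: ds) ∧ FutureWords x e es := by
  have h0 : StartsWith [2] (bwd x e) ↔ x e = 2 := by
    rw [startsWith_cons_bwd]; simp [StartsWith]
  rw [PastWords, h0, and_assoc]
  refine and_congr_right fun h => ?_
  have h1 : fstAfter x (westNext x e) = fstAfter x e := by
    rw [westNext_two h, hx.fstAfter_zero (hx.letter_fstBefore _),
      hx.fstAfter_fstBefore (by rwa [sub_add_cancel]), sub_add_cancel]
  have hF := futureWords_congr (x := x) (k := westNext x e) (k' := e) (by rw [h1]) es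
  rw [hF, westNext_two h]
  simp

/-- After an initial 1 the word has to descend by two, so it splits into passage words `d'` and `d`.
The curve jumps back over `d'`, which becomes the first future word, and `d` becomes the first past
word. -/
theorem words_one (e : ℤ) {d d' : List (Fin 3)} (hd' : SndPass d')
    (ds es : List (List (Fin 3))) :
    (x e = 1 ∧ PastWords x (westNext x e) (d :: ds) ∧ FutureWords x (westNext x e) (d' :: es)) ↔
      PastWords x e ((1 :: (d' ++ d)) :: ds) ∧ FutureWords x e es := by
  have hL : PastWords x (westNext x e) (d :: ds) ↔ StartsWith d (bwd x (westNext x e)) ∧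
    PastWords x (fstBefore x (westNext x e - d.length)) ds := Iff.rfl
  rw [hL, PastWords, startsWith_cons_bwd, and_assoc (a := x e = 1), and_assoc (a := x e = 1)]
  refine and_congr_right fun h => ?_
  have h1 : sndAfter x (fstAfter x (westNext x e)) = e := by
    rw [westNext_one h, hx.fstAfter_two (hx.letter_sndBefore _),
      hx.sndAfter_sndBefore (by rwa [sub_add_cancel]), sub_add_cancel]
  rw [FutureWords, h1, startsWith_append_bwd]
  have key : StartsWith d' (bwd x (e - 1)) → westNext x e = e - 1 - d'.length := fun h2 => by
    rw [westNext_one h, hd'.sndBefore_eq h2]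
  have hlen : e - ((1 :: (d' ++ d)).length : ℤ) = e - 1 - d'.length - d.length := by
    simp; ring
  rw [hlen]
  constructor
  · rintro ⟨⟨h2, h3⟩, h4, h5⟩
    rw [key h4] at h2 h3
    exact ⟨⟨⟨h4, h2⟩, h3⟩, h5⟩
  · rintro ⟨⟨⟨h4, h2⟩, h3⟩, h5⟩
    rw [key h4]
    exact ⟨⟨h2, h3⟩, h4, h5⟩

/-- The curve goes up to `northNext x e`, from where the first future word `d` is read backward; it
becomes the first past word. The next past position is `e - 1`, where the remainder `d'` of the old
first word begins. -/
theorem words_zero (e : ℤ) {d : List (Fin 3)} (hd : SndPass d) (d' : List (Fin 3))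
    (ds es : List (List (Fin 3))) :
    (x e = 0 ∧ PastWords x (westNext x e) (d :: d' :: ds) ∧ FutureWords x (westNext x e) es) ↔
      PastWords x e ((0 :: d') :: ds) ∧ FutureWords x e (d :: es) := by
  rw [PastWords, PastWords, PastWords, startsWith_cons_bwd, and_assoc (a := x e = 0),
    and_assoc (a := x e = 0)]
  refine and_congr_right fun h => ?_
  have h0 : westNext x e = sndAfter x (fstAfter x e) - 1 := westNext_zero h
  have h1 : fstAfter x (westNext x e) = fstAfter x (sndAfter x (fstAfter x e)) := by
    rw [h0, hx.fstAfter_one (by rw [sub_add_cancel]; exact hx.letter_sndAfter _), sub_add_cancel]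
  have key : StartsWith d (bwd x (westNext x e)) →
      fstBefore x (westNext x e - d.length) = e - 1 := fun h2 => by
    rw [← hd.sndBefore_eq h2, h0, hx.sndBefore_sndAfter (hx.letter_fstAfter e),
      hx.fstBefore_fstAfter h]
  have hF := futureWords_congr (x := x) (k := westNext x e)
    (k' := sndAfter x (fstAfter x e)) (by rw [h1]) es
  rw [hF, FutureWords, ← h0]
  have hlen : e - ((0 :: d').length : ℤ) = e - 1 - d'.length := by
    simp; ring
  rw [hlen]
  constructor
  · rintro ⟨⟨h2, h3, h4⟩, h5⟩
    rw [key h2] at h3 h4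
    exact ⟨⟨h3, h4⟩, h2, h5⟩
  · rintro ⟨⟨h3, h4⟩, h2, h5⟩
    rw [key h2]
    exact ⟨⟨h2, h3, h4⟩, h5⟩

end Recurrent

/-! ## The law of the letters along the Peano curve -/

theorem measurableSet_pastCyl (k : ℤ) (ds : List (List (Fin 3))) :
    MeasurableSet {x | PastCyl x k ds} := by
  induction ds generalizing k with
  | nil => exact MeasurableSet.const True
  | cons d ds ih =>
    have h : {x | PastCyl x k (d :: ds)} = {x | StartsWith d (bwd x k)} ∩ ⋃ b,
        ({_x | DescendsBy fstBwd 1 b} ∩ ({x | StartsWith b (bwd x (k - d.length))} ∩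
          {x | PastCyl x (k - d.length - b.length) ds})) := by
      ext x; simp [PastCyl]
    rw [h]
    exact (measurableSet_bwd d k).inter (MeasurableSet.iUnion fun b =>
      (MeasurableSet.const _).inter ((measurableSet_bwd b _).inter (ih _)))

theorem measurableSet_futureCyl (k : ℤ) (ds : List (List (Fin 3))) :
    MeasurableSet {x | FutureCyl x k ds} := by
  induction ds generalizing k with
  | nil => exact MeasurableSet.const True
  | cons d ds ih =>
    have h : {x | FutureCyl x k (d :: ds)} = ⋃ c,
        ({_x | DescendsBy fstFwd 1 c} ∩ ({x | StartsWith c (fwd x k)} ∩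
          ({x | StartsWith (turnWord d) (fwd x (k + c.length))} ∩
          {x | FutureCyl x (k + c.length + (turnWord d).length) ds}))) := by
      ext x; simp [FutureCyl]
    rw [h]
    exact MeasurableSet.iUnion fun b =>
      (MeasurableSet.const _).inter ((measurableSet_fwd b _).inter
      ((measurableSet_fwd _ _).inter (ih _)))

theorem measurableSet_index {p : (ℤ → Fin 3) → ℤ → Prop} (hp : ∀ k, MeasurableSet {x | p x k})
    {g : (ℤ → Fin 3) → ℤ} (hg : Measurable g) : MeasurableSet {x | p x (g x)} :=
  measurableSet_setOfPred.2 (measurable_index (fun k => measurableSet_setOfPred.1 (hp k)) hg)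

theorem measurableSet_pastWords (k : ℤ) (ds : List (List (Fin 3))) :
    MeasurableSet {x | PastWords x k ds} := by
  induction ds generalizing k with
  | nil => exact MeasurableSet.const True
  | cons d ds ih =>
    exact (measurableSet_bwd d k).inter (measurableSet_index ih (measurable_fstBefore _))

theorem measurable_sndAfter_fstAfter (k : ℤ) : Measurable fun x => sndAfter x (fstAfter x k) :=
  measurable_index measurable_sndAfter (measurable_fstAfter k)

theorem measurableSet_futureWords (k : ℤ) (ds : List (List (Fin 3))) :
    MeasurableSet {x | FutureWords x k ds} := by
  induction ds generalizing k with
  | nil => exact MeasurableSet.const True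
  | cons d ds ih =>
    exact (measurableSet_index (measurableSet_bwd d)
      ((measurable_sndAfter_fstAfter k).sub_const 1)).inter
      (measurableSet_index ih (measurable_sndAfter_fstAfter k))

/-- The probability of a list of independent words. -/
noncomputable def blockWeight (ds : List (List (Fin 3))) : ℝ≥0∞ := (ds.map wordWeight).prod

theorem blockWeight_nil : blockWeight [] = 1 := rfl

theorem blockWeight_cons (d : List (Fin 3)) (ds : List (List (Fin 3))) :
    blockWeight (d :: ds) = wordWeight d * blockWeight ds := by simp [blockWeight]

theorem wordWeight_cons (a : Fin 3) (d : List (Fin 3)) :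
    wordWeight (a :: d) = 3⁻¹ * wordWeight d := by simp [wordWeight, pow_succ']

theorem wordWeight_nil : wordWeight [] = 1 := by simp [wordWeight]

theorem SndPass.wordWeight_turnWord {d : List (Fin 3)} (hd : SndPass d) :
    wordWeight (turnWord d) = wordWeight d := by
  rw [wordWeight, hd.length_turnWord, wordWeight]

/-- The unspecified passage `c` before each turn word is summed out with total weight one. The word
`v` collects all that has been read so far, so that `v`, `c` and the turn word form one longer
cylinder for the induction. -/
theorem letterLaw_futureCyl {es : List (List (Fin 3))} (hes : ∀ d ∈ es, SndPass d)
    (u v : List (Fin 3)) (k : ℤ) :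
    letterLaw ℤ {x | StartsWith u (bwd x k) ∧ StartsWith v (fwd x k) ∧
      FutureCyl x (k + v.length) es} = wordWeight u * wordWeight v * blockWeight es := by
  induction es generalizing v with
  | nil =>
    simp only [FutureCyl, and_true]
    rw [letterLaw_words, blockWeight_nil, mul_one]
  | cons d es ih =>
    have hd : SndPass d := hes d (by simp)
    have h := measure_exists_passage isStepValue_fstFwd
      (E := fun c => {x | StartsWith u (bwd x k) ∧ StartsWith (v ++ (c ++ turnWord d)) (fwd x k) ∧
        FutureCyl x (k + (v ++ (c ++ turnWord d)).length) es})
      (y := fun x => fwd x (k + v.length))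
      (c := wordWeight u * wordWeight v * blockWeight (d :: es))
      (fun c => (measurableSet_bwd _ _).inter ((measurableSet_fwd _ _).inter
        (measurableSet_futureCyl _ _)))
      (fun c x hx => by
        have := hx.2.1
        rw [startsWith_append_fwd, startsWith_append_fwd] at this
        exact this.2.1)
      (fun c hc => by
        rw [ih (fun d h => hes d (by simp [h])), wordWeight_append, wordWeight_append,
          hd.wordWeight_turnWord, blockWeight_cons]
        ring)
    rw [← h]
    congr 1
    ext x
    simp only [Set.mem_ofPred_eq, FutureCyl, startsWith_append_fwd, List.length_append,
      Nat.cast_add, ← add_assoc]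
    constructor
    · rintro ⟨h1, h2, c, h3, h4, h5, h6⟩
      exact ⟨c, h3, h1, ⟨h2, h4, h5⟩, h6⟩
    · rintro ⟨c, h3, h1, ⟨h2, h4, h5⟩, h6⟩
      exact ⟨h1, h2, c, h3, h4, h5, h6⟩

theorem letterLaw_cyl (ds : List (List (Fin 3))) {es : List (List (Fin 3))}
    (hes : ∀ d ∈ es, SndPass d) (u : List (Fin 3)) (k : ℤ) :
    letterLaw ℤ {x | StartsWith u (bwd x k) ∧ PastCyl x (k - u.length) ds ∧ FutureCyl x k es} =
      wordWeight u * blockWeight ds * blockWeight es := by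
  induction ds generalizing u with
  | nil =>
    have := letterLaw_futureCyl hes u [] k
    simp only [StartsWith, true_and, List.length_nil, Nat.cast_zero, add_zero] at this
    simp only [PastCyl, true_and]
    rw [this, wordWeight_nil, blockWeight_nil]
  | cons d ds ih =>
    have h := measure_exists_passage isStepValue_fstBwd
      (E := fun b => {x | StartsWith (u ++ (d ++ b)) (bwd x k) ∧
        PastCyl x (k - (u ++ (d ++ b)).length) ds ∧ FutureCyl x k es})
      (y := fun x => bwd x (k - u.length - d.length))
      (c := wordWeight u * blockWeight (d :: ds) * blockWeight es)
      (fun c => (measurableSet_bwd _ _).inter ((measurableSet_pastCyl _ _).inter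
        (measurableSet_futureCyl _ _)))
      (fun c x hx => by
        have := hx.1
        rw [startsWith_append_bwd, startsWith_append_bwd] at this
        exact this.2.2)
      (fun c hc => by
        rw [ih, wordWeight_append, wordWeight_append, blockWeight_cons]
        ring)
    rw [← h]
    congr 1
    ext x
    simp only [Set.mem_ofPred_eq, PastCyl, startsWith_append_bwd, List.length_append,
      Nat.cast_add, ← sub_sub]
    constructor
    · rintro ⟨h1, ⟨h2, c, h3, h4, h5⟩, h6⟩
      exact ⟨c, h3, ⟨h1, h2, h4⟩, h5, h6⟩
    · rintro ⟨c, h3, ⟨h1, h2, h4⟩, h5, h6⟩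
      exact ⟨h1, ⟨h2, c, h3, h4, h5⟩, h6⟩

/-- The words along the south-going and north-going branches are independent. -/
theorem letterLaw_pastWords_futureWords (ds : List (List (Fin 3))) {es : List (List (Fin 3))}
    (hes : ∀ d ∈ es, SndPass d) (k : ℤ) :
    letterLaw ℤ {x | PastWords x k ds ∧ FutureWords x k es} = blockWeight ds * blockWeight es := by
  have h := letterLaw_cyl ds hes [] k
  simp only [StartsWith, true_and, List.length_nil, Nat.cast_zero, sub_zero, wordWeight_nil,
    one_mul] at h
  rw [← h]
  refine measure_congr ?_
  filter_upwards [ae_recurrent] with x hx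
  refine propext ?_
  change _ ∧ _ ↔ _ ∧ _
  rw [hx.pastWords_iff, hx.futureWords_iff _ hes]

/-- One step of the Peano curve back, on the words. -/
theorem exists_words_back (a : Fin 3) {ds es : List (List (Fin 3))} {n : ℕ}
    (hds : ∀ d ∈ ds, SndPass d) (hes : ∀ d ∈ es, SndPass d) (hds' : n + 1 < ds.length)
    (hes' : n < es.length) :
    ∃ ds' es' : List (List (Fin 3)), (∀ d ∈ ds', SndPass d) ∧ (∀ d ∈ es', SndPass d) ∧
      n < ds'.length ∧ n ≤ es'.length ∧
      blockWeight ds' * blockWeight es' = 3⁻¹ * (blockWeight ds * blockWeight es) ∧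
      ∀ x, Recurrent x → ∀ e,
        (x e = a ∧ PastWords x (westNext x e) ds ∧ FutureWords x (westNext x e) es) ↔
          PastWords x e ds' ∧ FutureWords x e es' := by
  rcases ds with _ | ⟨d, _ | ⟨d', ds⟩⟩
  · simp at hds'
  · simp at hds'
  rcases es with _ | ⟨d₁, es⟩
  · simp at hes'
  have hd : SndPass d := hds d (by simp)
  have hd' : SndPass d' := hds d' (by simp)
  have hd₁ : SndPass d₁ := hes d₁ (by simp)
  simp only [List.length_cons] at hds' hes'
  have h1 : ∀ d ∈ ds, SndPass d := fun d h => hds d (by simp [h])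
  have h2 : ∀ d ∈ es, SndPass d := fun d h => hes d (by simp [h])
  -- Undoing a letter 0 moves a past word to the future, undoing a letter 1 merges a future word
  -- into the first past word, and undoing a letter 2 adds the past word `[2]`. So each list loses
  -- at most one word.
  rcases letter_cases a with rfl | rfl | rfl
  · refine ⟨(0 :: d') :: ds, d :: d₁ :: es, ?_, ?_, ?_, ?_, ?_,
      fun x hx e => hx.words_zero e hd d' ds (d₁ :: es)⟩
    · simpa [hd'.zero] using h1
    · simpa [hd, hd₁] using h2
    · simp only [List.length_cons]; omega
    · simp only [List.length_cons]; omega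
    · simp only [blockWeight_cons, wordWeight_cons]; ring
  · refine ⟨(1 :: (d₁ ++ d)) :: d' :: ds, es, ?_, ?_, ?_, ?_, ?_,
      fun x hx e => hx.words_one e hd₁ (d' :: ds) es⟩
    · simpa [hd₁.one hd, hd'] using h1
    · exact h2
    · simp only [List.length_cons]; omega
    · omega
    · simp only [blockWeight_cons, wordWeight_cons, wordWeight_append]; ring
  · refine ⟨[2] :: d :: d' :: ds, d₁ :: es, ?_, ?_, ?_, ?_, ?_,
      fun x hx e => hx.words_two e (d :: d' :: ds) (d₁ :: es)⟩
    · simpa [SndPass.two, hd, hd'] using h1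
    · simpa [hd₁] using h2
    · simp only [List.length_cons]; omega
    · simp only [List.length_cons]; omega
    · simp only [blockWeight_cons, wordWeight_cons, wordWeight_nil]; ring

/-- The joint law of the first letters along the Peano curve and the words seen afterwards. -/
theorem letterLaw_westPath_words (a : ℕ → Fin 3) (n : ℕ) {ds es : List (List (Fin 3))}
    (hds : ∀ d ∈ ds, SndPass d) (hes : ∀ d ∈ es, SndPass d) (hds' : n < ds.length)
    (hes' : n ≤ es.length) :
    letterLaw ℤ {x | (∀ i < n, x (westPath x i) = a i) ∧ PastWords x (westPath x n) ds ∧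
      FutureWords x (westPath x n) es} = 3⁻¹ ^ n * (blockWeight ds * blockWeight es) := by
  induction n generalizing ds es with
  | zero => simpa [westPath_zero] using letterLaw_pastWords_futureWords ds hes 0
  | succ n ih =>
    -- The last letter is absorbed into the words seen one step earlier, whose weight contains the
    -- additional factor 1/3.
    obtain ⟨ds', es', h1, h2, h3, h4, h5, h6⟩ := exists_words_back (a n) hds hes hds' hes'
    have := ih h1 h2 h3 h4
    rw [h5, ← mul_assoc, ← pow_succ] at this
    rw [← this]
    refine measure_congr ?_
    filter_upwards [ae_recurrent] with x hx
    refine propext ?_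
    change ((∀ i < n + 1, x (westPath x i) = a i) ∧ PastWords x (westPath x (n + 1 : ℕ)) ds ∧
      FutureWords x (westPath x (n + 1 : ℕ)) es) ↔ ((∀ i < n, x (westPath x i) = a i) ∧
      PastWords x (westPath x n) ds' ∧ FutureWords x (westPath x n) es')
    rw [← h6 x hx, Nat.forall_lt_succ_right, and_assoc, Nat.cast_add_one, hx.westPath_succ]

theorem PastWords.unique {x : ℤ → Fin 3} {k : ℤ} {ds ds' : List (List (Fin 3))}
    (hds : ∀ d ∈ ds, SndPass d) (hds' : ∀ d ∈ ds', SndPass d) (hl : ds.length = ds'.length)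
    (h : PastWords x k ds) (h' : PastWords x k ds') : ds = ds' := by
  induction ds generalizing k ds' with
  | nil => exact (List.length_eq_zero_iff.1 hl.symm).symm
  | cons d ds ih =>
    rcases ds' with _ | ⟨d', ds'⟩
    · simp at hl
    · obtain rfl : d = d' := DescendsBy.unique (hds d (by simp)) (hds' d' (by simp)) h.1 h'.1
      rw [ih (fun d h => hds d (by simp [h])) (fun d h => hds' d (by simp [h])) (by simpa using hl)
        h.2 h'.2]

theorem FutureWords.unique {x : ℤ → Fin 3} {k : ℤ} {ds ds' : List (List (Fin 3))}
    (hds : ∀ d ∈ ds, SndPass d) (hds' : ∀ d ∈ ds', SndPass d) (hl : ds.length = ds'.length)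
    (h : FutureWords x k ds) (h' : FutureWords x k ds') : ds = ds' := by
  induction ds generalizing k ds' with
  | nil => exact (List.length_eq_zero_iff.1 hl.symm).symm
  | cons d ds ih =>
    rcases ds' with _ | ⟨d', ds'⟩
    · simp at hl
    · obtain rfl : d = d' := DescendsBy.unique (hds d (by simp)) (hds' d' (by simp)) h.1 h'.1
      rw [ih (fun d h => hds d (by simp [h])) (fun d h => hds' d (by simp [h])) (by simpa using hl)
        h.2 h'.2]

theorem measurableSet_westPath_letters (a : ℕ → Fin 3) (n : ℕ) :
    MeasurableSet {x : ℤ → Fin 3 | ∀ i < n, x (westPath x i) = a i} := by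
  have : {x : ℤ → Fin 3 | ∀ i < n, x (westPath x i) = a i} =
      ⋂ i ∈ Finset.range n, {x | x (westPath x i) = a i} := by ext; simp
  rw [this]
  exact Finset.measurableSet_biInter _ fun i _ =>
    measurableSet_index (fun k => measurableSet_letter k (a i)) (measurable_westPath i)

/-- Pairs of lists of `l` passage words. -/
def IsBlockPair (l : ℕ) (b : List (List (Fin 3)) × List (List (Fin 3))) : Prop :=
  (b.1.length = l ∧ ∀ d ∈ b.1, SndPass d) ∧ b.2.length = l ∧ ∀ d ∈ b.2, SndPass d

-- Almost surely an edge sees exactly one list of `l` past words and one list of `l` future words,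
-- so any event splits accordingly.
open Classical in
theorem measure_eq_tsum_words {Q : Set (ℤ → Fin 3)} (hQ : MeasurableSet Q) (l : ℕ) (n : ℤ) :
    letterLaw ℤ Q = ∑' b : List (List (Fin 3)) × List (List (Fin 3)), if IsBlockPair l b then
      letterLaw ℤ {x | x ∈ Q ∧ PastWords x (westPath x n) b.1 ∧ FutureWords x (westPath x n) b.2}
      else 0 := by
  have h := tsum_ite_eq_measure (p := IsBlockPair l) (letterLaw ℤ) (fun b => {x | x ∈ Q ∧
      PastWords x (westPath x n) b.1 ∧ FutureWords x (westPath x n) b.2}) ?_ ?_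
  · refine Eq.trans ?_ h
    refine measure_congr ?_
    filter_upwards [ae_recurrent] with x hx
    refine propext ?_
    obtain ⟨ds, ⟨h1, h2⟩, -⟩ := hx.existsUnique_pastWords l (westPath x n)
    obtain ⟨es, ⟨h3, h4⟩, -⟩ := hx.existsUnique_futureWords l (westPath x n)
    exact ⟨fun h => ⟨(ds, es), ⟨h1, h3⟩, h, h2, h4⟩, fun ⟨_, _, h, _⟩ => h⟩
  · exact fun b => hQ.inter ((measurableSet_index (fun k => measurableSet_pastWords k b.1)
      (measurable_westPath n)).inter (measurableSet_index (fun k => measurableSet_futureWords k b.2)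
      (measurable_westPath n)))
  · rintro ⟨ds, es⟩ ⟨ds', es'⟩ x ⟨h1, h2⟩ ⟨h1', h2'⟩ ⟨-, h3, h4⟩ ⟨-, h3', h4'⟩
    exact Prod.ext (h3.unique h1.2 h1'.2 (h1.1.trans h1'.1.symm) h3')
      (h4.unique h2.2 h2'.2 (h2.1.trans h2'.1.symm) h4')

/-- The words are summed out: up to the factor `3⁻¹ ^ n`, the terms at time `n` equal those at time
0, which add up to one. Lists of length `n + 1` are long enough to undo `n` steps. -/
theorem letterLaw_westPath_letters (a : ℕ → Fin 3) (n : ℕ) :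
    letterLaw ℤ {x | ∀ i < n, x (westPath x i) = a i} = 3⁻¹ ^ n := by
  classical
  rw [measure_eq_tsum_words (measurableSet_westPath_letters a n) (n + 1) n]
  have h1 := measure_eq_tsum_words MeasurableSet.univ (n + 1) 0
  rw [measure_univ] at h1
  rw [← mul_one (3⁻¹ ^ n), h1, ← ENNReal.tsum_mul_left]
  refine tsum_congr fun b => ?_
  split_ifs with hb
  · have := letterLaw_westPath_words a n hb.1.2 hb.2.2 (by rw [hb.1.1]; omega)
      (by rw [hb.2.1]; omega)
    simp only [Set.mem_univ, true_and, westPath_zero]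
    rw [letterLaw_pastWords_futureWords b.1 hb.2.2]
    exact this
  · simp

/-- The letters along the Peano curve are independent and uniform. -/
theorem map_westLetter : (letterLaw ℤ).map westLetter = letterLaw ℤ := by
  refine map_eq_letterLaw measurable_westLetter fun I => ?_
  obtain ⟨N, hN⟩ : ∃ N : ℕ, ∀ i ∈ I, -(N : ℤ) < i ∧ i ≤ N := by
    refine ⟨I.sup (fun i => i.natAbs + 1), fun i hi => ?_⟩
    have := Finset.le_sup (f := fun i : ℤ => i.natAbs + 1) hi
    omega
  refine ⟨Finset.Ioc (-N) N, fun i hi => Finset.mem_Ioc.2 (hN i hi), fun a => ?_⟩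
  -- Seen from the edge visited at time `-N`, the window `(-N, N]` consists of the first `2 N`
  -- letters along the curve.
  have h := letterLaw_westPath (measurableSet_westPath_letters
    (fun j => a (j + 1 - N)) (2 * N)) (-N)
  rw [letterLaw_westPath_letters] at h
  rw [Int.card_Ioc, show ((N : ℤ) - -N).toNat = 2 * N by omega, ← h]
  refine measure_congr ?_
  filter_upwards [ae_recurrent] with x hx
  refine propext ?_
  change (∀ i ∈ Finset.Ioc (-(N : ℤ)) N, x (westPath x (i - 1)) = a i) ↔
    ∀ j < 2 * N, shiftSeq (westPath x (-N)) x (westPath (shiftSeq (westPath x (-N)) x) j) =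
      a (j + 1 - N)
  simp only [hx.westPath_shiftSeq, shiftSeq, sub_add_cancel, Finset.mem_Ioc]
  constructor
  · intro H j hj
    rw [← H (j + 1 - N) (by omega)]
    congr 2; ring
  · intro H i hi
    have := H (i - 1 + N).toNat (by omega)
    rw [Int.toNat_of_nonneg (by omega)] at this
    rw [show i = i - 1 + N + 1 - N by ring, ← this]
    congr 2; ring

/-! ## The letters along the dual south-going branch -/

/-- The letters read along the dual south-going branch of the root. -/
noncomputable def dualLetter (x : ℤ → Fin 3) (i : ℕ) : Fin 3 := x ((dualSouthNext x)^[i] 0)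

theorem measurable_dualLetter : Measurable dualLetter :=
  measurable_pi_lambda _ fun i =>
    measurable_index measurable_pi_apply (measurable_iterate measurable_dualSouthNext i 0)

theorem measurableSet_dual_letters (v : List (Fin 3)) (k : ℤ) :
    MeasurableSet {x : ℤ → Fin 3 | StartsWith v fun i => x ((dualSouthNext x)^[i] k)} := by
  have : Measurable fun (x : ℤ → Fin 3) (i : ℕ) => x ((dualSouthNext x)^[i] k) :=
    measurable_pi_lambda _ fun i =>
      measurable_index measurable_pi_apply (measurable_iterate measurable_dualSouthNext i k)
  exact this (measurableSet_startsWith v)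

/-- Here `u` is the part of the past that has been explored, and the branch always stands just
beyond it, at a fresh letter. A letter 0 extends `u` by itself only. A letter 1 or 2 also reveals
the passage word over which the branch jumps, and this word is summed out with total weight one. -/
theorem letterLaw_dual_letters (u v : List (Fin 3)) (k : ℤ) :
    letterLaw ℤ {x | StartsWith u (bwd x k) ∧
      StartsWith v fun i => x ((dualSouthNext x)^[i] (k - u.length))} =
      wordWeight u * wordWeight v := by
  induction v generalizing u with
  | nil => simpa [StartsWith] using letterLaw_words u [] k
  | cons a v ih =>
    have hstep : ∀ x : ℤ → Fin 3, (StartsWith (a :: v) fun i => x ((dualSouthNext x)^[i]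
        (k - u.length))) ↔ x (k - u.length) = a ∧
        StartsWith v fun i => x ((dualSouthNext x)^[i] (dualSouthNext x (k - u.length))) :=
      fun x => Iff.rfl
    simp only [hstep]
    have hu : ∀ x : ℤ → Fin 3, StartsWith (u ++ [a]) (bwd x k) ↔
        StartsWith u (bwd x k) ∧ x (k - u.length) = a := fun x => by
      rw [startsWith_append_bwd, startsWith_cons_bwd]; simp [StartsWith]
    rcases letter_cases a with rfl | h | h
    · have := ih (u ++ [0])
      rw [wordWeight_append, wordWeight_cons, wordWeight_nil, mul_one] at this
      rw [wordWeight_cons, ← mul_assoc, ← this]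
      congr 1
      ext x
      simp only [Set.mem_ofPred_eq, hu, and_assoc]
      refine and_congr_right fun _ => and_congr_right fun h => ?_
      simp [dualSouthNext, h, sub_sub]
    · have h0 := measure_exists_passage isStepValue_sndBwd
        (E := fun b => {x | StartsWith ((u ++ [a]) ++ b) (bwd x k) ∧
          StartsWith v fun i => x ((dualSouthNext x)^[i] (k - ((u ++ [a]) ++ b).length))})
        (y := fun x => bwd x (k - (u ++ [a]).length))
        (c := wordWeight u * wordWeight (a :: v))
        (fun c => (measurableSet_bwd _ _).inter (measurableSet_dual_letters _ _))
        (fun c x hx => by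
          have := hx.1
          rw [startsWith_append_bwd] at this
          exact this.2)
        (fun c hc => by
          rw [ih, wordWeight_append, wordWeight_append, wordWeight_cons, wordWeight_cons,
            wordWeight_nil]
          ring)
      rw [← h0]
      refine measure_congr ?_
      filter_upwards [ae_recurrent] with x hx
      refine propext ?_
      change (_ ∧ _ ∧ _) ↔ ∃ w, _ ∧ _ ∧ _
      have hd : x (k - u.length) = a → ∀ w, DescendsBy sndBwd 1 w →
          StartsWith w (bwd x (k - (u ++ [a]).length)) →
          dualSouthNext x (k - u.length) = k - ((u ++ [a]) ++ w).length := fun h1 w h2 h3 => by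
        have h4 := SndPass.sndBefore_eq h2 h3
        rw [dualSouthNext, if_neg (by rw [h1, h]; decide), if_pos (by rw [h1, h])]
        rw [List.length_append, List.length_singleton] at h4
        rw [show k - u.length - 1 = k - ((u.length + 1 : ℕ) : ℤ) by push_cast; ring, h4]
        simp; ring
      constructor
      · rintro ⟨h1, h2, h3⟩
        obtain ⟨w, hw, hw'⟩ := hx.exists_sndPass (k - (u ++ [a]).length)
        refine ⟨w, hw, ?_, ?_⟩
        · rw [startsWith_append_bwd, hu]
          exact ⟨⟨h1, h2⟩, hw'⟩
        · rwa [← hd h2 w hw hw']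
      · rintro ⟨w, hw, h1, h2⟩
        rw [startsWith_append_bwd, hu] at h1
        refine ⟨h1.1.1, h1.1.2, ?_⟩
        rwa [hd h1.1.2 w hw h1.2]
    · have h0 := measure_exists_passage isStepValue_fstBwd
        (E := fun b => {x | StartsWith ((u ++ [a]) ++ b) (bwd x k) ∧
          StartsWith v fun i => x ((dualSouthNext x)^[i] (k - ((u ++ [a]) ++ b).length))})
        (y := fun x => bwd x (k - (u ++ [a]).length))
        (c := wordWeight u * wordWeight (a :: v))
        (fun c => (measurableSet_bwd _ _).inter (measurableSet_dual_letters _ _))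
        (fun c x hx => by
          have := hx.1
          rw [startsWith_append_bwd] at this
          exact this.2)
        (fun c hc => by
          rw [ih, wordWeight_append, wordWeight_append, wordWeight_cons, wordWeight_cons,
            wordWeight_nil]
          ring)
      rw [← h0]
      refine measure_congr ?_
      filter_upwards [ae_recurrent] with x hx
      refine propext ?_
      change (_ ∧ _ ∧ _) ↔ ∃ w, _ ∧ _ ∧ _
      have hd : x (k - u.length) = a → ∀ w, DescendsBy fstBwd 1 w →
          StartsWith w (bwd x (k - (u ++ [a]).length)) →
          dualSouthNext x (k - u.length) = k - ((u ++ [a]) ++ w).length := fun h1 w h2 h3 => by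
        have h4 := h2.fstBefore_eq h3
        rw [dualSouthNext, if_neg (by rw [h1, h]; decide), if_neg (by rw [h1, h]; decide)]
        rw [List.length_append, List.length_singleton] at h4
        rw [show k - u.length - 1 = k - ((u.length + 1 : ℕ) : ℤ) by push_cast; ring, h4]
        simp; ring
      constructor
      · rintro ⟨h1, h2, h3⟩
        obtain ⟨n, hn⟩ := hx.fst_bwd (k - (u ++ [a]).length)
        obtain ⟨w, hw, hw'⟩ := exists_descendsBy (y := bwd x (k - (u ++ [a]).length))
          neg_one_le_fstBwd (h := 1) (by simpa using hn)
        refine ⟨w, hw, ?_, ?_⟩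
        · rw [startsWith_append_bwd, hu]
          exact ⟨⟨h1, h2⟩, hw'⟩
        · rwa [← hd h2 w hw hw']
      · rintro ⟨w, hw, h1, h2⟩
        rw [startsWith_append_bwd, hu] at h1
        refine ⟨h1.1.1, h1.1.2, ?_⟩
        rwa [hd h1.1.2 w hw h1.2]

/-- The letters along a dual branch are independent and uniform. -/
theorem map_dualLetter : (letterLaw ℤ).map dualLetter = letterLaw ℕ := by
  refine map_eq_letterLaw measurable_dualLetter fun I => ?_
  obtain ⟨n, hn⟩ : ∃ n, n = I.sup id + 1 := ⟨_, rfl⟩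
  refine ⟨Finset.range n, fun i hi => ?_, fun a => ?_⟩
  · rw [hn]
    exact Finset.mem_range.2 (Nat.lt_succ_of_le (Finset.le_sup (f := id) hi))
  · have := letterLaw_dual_letters [] (List.ofFn fun i : Fin n => a i) 0
    simp only [StartsWith, true_and, List.length_nil, Nat.cast_zero, sub_zero, wordWeight_nil,
      one_mul] at this
    rw [wordWeight, List.length_ofFn] at this
    rw [Finset.card_range, ← this]
    congr 1
    ext x
    simp only [Set.mem_ofPred_eq, startsWith_iff, List.length_ofFn, Finset.mem_range, dualLetter]
    refine forall₂_congr fun i hi => ?_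
    simp [hi]

/-! ## A maximal inequality -/

/-- Put a letter in front of a sequence. -/
def consSeq (a : Fin 3) (y : ℕ → Fin 3) : ℕ → Fin 3
  | 0 => a
  | i + 1 => y i

theorem measurable_consSeq : Measurable fun p : Fin 3 × (ℕ → Fin 3) => consSeq p.1 p.2 := by
  refine measurable_pi_lambda _ fun i => ?_
  rcases i with _ | i
  · exact measurable_fst
  · exact (measurable_pi_apply i).comp measurable_snd

theorem map_consSeq : ((uniformOn (Set.univ : Set (Fin 3))).prod (letterLaw ℕ)).map
    (fun p => consSeq p.1 p.2) = letterLaw ℕ := by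
  refine map_eq_letterLaw measurable_consSeq fun I => ?_
  refine ⟨Finset.range (I.sup id + 1), fun i hi => ?_, fun a => ?_⟩
  · exact Finset.mem_range.2 (Nat.lt_succ_of_le (Finset.le_sup (f := id) hi))
  · generalize I.sup id = n
    have h : {p : Fin 3 × (ℕ → Fin 3) | ∀ i ∈ Finset.range (n + 1), consSeq p.1 p.2 i = a i} =
        {a 0} ×ˢ {y | ∀ i ∈ Finset.range n, y i = a (i + 1)} := by
      ext ⟨b, y⟩
      simp only [Finset.mem_range, Set.mem_ofPred_eq, Set.mem_prod, Set.mem_singleton_iff]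
      constructor
      · exact fun H => ⟨H 0 (by omega), fun i hi => H (i + 1) (by omega)⟩
      · rintro ⟨h1, h2⟩ i hi
        rcases i with _ | i
        · exact h1
        · exact h2 i (by omega)
    rw [h, Measure.prod_prod, uniformOn_univ_singleton,
      letterLaw_cylinder (Finset.range n) fun i => a (i + 1), Finset.card_range,
      Finset.card_range, pow_succ']

theorem letterLaw_consSeq {Q : Set (ℕ → Fin 3)} (hQ : MeasurableSet Q) :
    letterLaw ℕ Q = ∑ a, 3⁻¹ * letterLaw ℕ {y | consSeq a y ∈ Q} := by
  conv_lhs => rw [← map_consSeq]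
  rw [Measure.map_apply measurable_consSeq hQ, Measure.prod_apply (measurable_consSeq hQ),
    lintegral_fintype]
  refine Finset.sum_congr rfl fun a _ => ?_
  rw [uniformOn_univ_singleton, mul_comm]
  rfl

theorem measurable_letterSum {ι M : Type*} [AddCommMonoid M] [MeasurableSpace M] [MeasurableAdd₂ M]
    (f : Fin 3 → M) (s : Finset ι) : Measurable fun y : ι → Fin 3 => ∑ i ∈ s, f (y i) :=
  Finset.measurable_sum _ fun i _ => (measurable_of_countable f).comp (measurable_pi_apply i)

theorem measurableSet_exists_le_abs (f : Fin 3 → ℤ) (r z : ℤ) (n : ℕ) :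
    MeasurableSet {y : ℕ → Fin 3 | ∃ j ≤ n, r ≤ |z + ∑ i ∈ Finset.range j, f (y i)|} := by
  have : {y : ℕ → Fin 3 | ∃ j ≤ n, r ≤ |z + ∑ i ∈ Finset.range j, f (y i)|} =
      ⋃ j ∈ Finset.range (n + 1), {y | r ≤ |z + ∑ i ∈ Finset.range j, f (y i)|} := by
    ext y; simp
  rw [this]
  refine Finset.measurableSet_biUnion _ fun j _ => ?_
  exact measurableSet_le measurable_const
    ((measurable_of_countable fun v : ℤ => |v|).comp ((measurable_letterSum f _).const_add z))

/-- The three values of `f` are `-1`, `0` and `1`. -/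
def IsUnitStep (f : Fin 3 → ℤ) : Prop := ∀ g : ℤ → ℝ, ∑ a, g (f a) = g (-1) + g 0 + g 1

/-- The numerator is the fourth moment of `z + S n`, where `S n` is a sum of `n` independent uniform
values in `{-1, 0, 1}`: the variance is `2 n / 3` and the fourth moment of `S n` is `4 n ^ 2 / 3 - 2
n / 3`. Averaging over the first letter reproduces the bound exactly, and if `|z|` is at least `r`
at the start, the bound is at least one. -/
theorem letterLaw_max_le {f : Fin 3 → ℤ} (hf : IsUnitStep f) {r : ℤ} (hr : 0 < r) (n : ℕ) (z : ℤ) :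
    letterLaw ℕ {y | ∃ j ≤ n, r ≤ |z + ∑ i ∈ Finset.range j, f (y i)|} ≤
      ENNReal.ofReal (((z : ℝ) ^ 4 + 4 * n * z ^ 2 + (4 / 3 * n ^ 2 - 2 / 3 * n)) / r ^ 4) := by
  have hr' : (0 : ℝ) < r := by exact_mod_cast hr
  have hn : ∀ n : ℕ, 0 ≤ 4 / 3 * (n : ℝ) ^ 2 - 2 / 3 * n := fun n => by
    rcases n with _ | n
    · simp
    · push_cast; nlinarith [(Nat.cast_nonneg n : (0 : ℝ) ≤ n)]
  induction n generalizing z with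
  | zero =>
    by_cases h : r ≤ |z|
    · refine prob_le_one.trans ?_
      rw [ENNReal.one_le_ofReal, le_div_iff₀ (by positivity)]
      have h' : (r : ℝ) ≤ |(z : ℝ)| := by exact_mod_cast h
      have := pow_le_pow_left₀ hr'.le h' 4
      rw [Even.pow_abs (by decide)] at this
      simpa using this
    · simp [h]
  | succ n ih =>
    by_cases h : r ≤ |z|
    · refine prob_le_one.trans ?_
      rw [ENNReal.one_le_ofReal, le_div_iff₀ (by positivity)]
      have h' : (r : ℝ) ≤ |(z : ℝ)| := by exact_mod_cast h
      have := pow_le_pow_left₀ hr'.le h' 4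
      rw [Even.pow_abs (by decide)] at this
      have h1 := hn (n + 1)
      have h2 : 0 ≤ 4 * ((n + 1 : ℕ) : ℝ) * (z : ℝ) ^ 2 := by positivity
      linarith
    · rw [letterLaw_consSeq (measurableSet_exists_le_abs f r z _)]
      have hs : ∀ a, {y | consSeq a y ∈ {y : ℕ → Fin 3 | ∃ j ≤ n + 1, r ≤ |z +
          ∑ i ∈ Finset.range j, f (y i)|}} =
          {y | ∃ j ≤ n, r ≤ |(z + f a) + ∑ i ∈ Finset.range j, f (y i)|} := by
        intro a
        ext y
        simp only [Set.mem_ofPred_eq]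
        constructor
        · rintro ⟨j, hj, h1⟩
          rcases j with _ | j
          · exact absurd (by simpa using h1) h
          · refine ⟨j, by omega, ?_⟩
            rw [Finset.sum_range_succ'] at h1
            simp only [consSeq] at h1
            convert h1 using 2; ring
        · rintro ⟨j, hj, h1⟩
          refine ⟨j + 1, by omega, ?_⟩
          rw [Finset.sum_range_succ']
          simp only [consSeq]
          convert h1 using 2; ring
      simp only [hs]
      have key : ∀ z : ℤ, 0 ≤ ((z : ℝ) ^ 4 + 4 * n * z ^ 2 + (4 / 3 * n ^ 2 - 2 / 3 * n)) / r ^ 4 :=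
        fun z => by have := hn n; positivity
      calc ∑ a, 3⁻¹ * letterLaw ℕ {y | ∃ j ≤ n, r ≤ |(z + f a) + ∑ i ∈ Finset.range j, f (y i)|}
          ≤ ∑ a, ENNReal.ofReal (3⁻¹ * ((((z + f a : ℤ) : ℝ) ^ 4 + 4 * n * ((z + f a : ℤ) : ℝ) ^ 2 +
              (4 / 3 * n ^ 2 - 2 / 3 * n)) / r ^ 4)) := by
            refine Finset.sum_le_sum fun a _ => ?_
            rw [ENNReal.ofReal_mul (by norm_num), ENNReal.ofReal_inv_of_pos (by norm_num),
              ENNReal.ofReal_ofNat]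
            gcongr
            exact ih _
        _ = ENNReal.ofReal (∑ a, 3⁻¹ * ((((z + f a : ℤ) : ℝ) ^ 4 + 4 * n * ((z + f a : ℤ) : ℝ) ^ 2 +
              (4 / 3 * n ^ 2 - 2 / 3 * n)) / r ^ 4)) := by
            rw [ENNReal.ofReal_sum_of_nonneg]
            exact fun a _ => mul_nonneg (by norm_num) (key _)
        _ ≤ _ := by
            refine le_of_eq (congrArg _ ?_)
            rw [hf fun v => 3⁻¹ * ((((z + v : ℤ) : ℝ) ^ 4 + 4 * n * ((z + v : ℤ) : ℝ) ^ 2 +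
              (4 / 3 * n ^ 2 - 2 / 3 * n)) / r ^ 4)]
            push_cast
            field_simp
            ring

/-- A maximal inequality of Kolmogorov's type with fourth moments. -/
theorem letterLaw_max_sum_le {f : Fin 3 → ℤ} (hf : IsUnitStep f) {r : ℤ} (hr : 0 < r) (n : ℕ) :
    letterLaw ℕ {y | ∃ j ≤ n, r ≤ |∑ i ∈ Finset.range j, f (y i)|} ≤
      ENNReal.ofReal (4 / 3 * n ^ 2 / r ^ 4) := by
  have h := letterLaw_max_le hf hr n 0
  simp only [zero_add] at h
  refine h.trans (ENNReal.ofReal_le_ofReal ?_)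
  have hr' : (0 : ℝ) < r := by exact_mod_cast hr
  gcongr
  have : (0 : ℝ) ≤ n := n.cast_nonneg
  simp

theorem isUnitStep_westStep_fst : IsUnitStep fun a => (westStep a).1 := fun g => by
  simp [Fin.sum_univ_three, westStep]; ring

theorem isUnitStep_westStep_snd : IsUnitStep fun a => (westStep a).2 := fun g => by
  simp [Fin.sum_univ_three, westStep]; ring

theorem sum_westStep (y : ℤ → Fin 3) (b : ℤ) (n : ℕ) :
    westWalk y (b + n) - westWalk y b = ∑ i ∈ Finset.range n, westStep (y (b + 1 + i)) := by
  induction n with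
  | zero => simp
  | succ n ih =>
    rw [Finset.sum_range_succ, ← ih, westWalk, intSum_step _ (b + (n + 1 : ℕ))]
    rw [show b + ((n + 1 : ℕ) : ℤ) - 1 = b + n by push_cast; ring,
      show b + ((n + 1 : ℕ) : ℤ) = b + 1 + n by push_cast; ring]
    abel

theorem letterLaw_westWalk_max_fst (b : ℤ) {r : ℤ} (hr : 0 < r) (n : ℕ) :
    letterLaw ℤ {y | ∃ j ≤ n, r ≤ |(westWalk y (b + j) - westWalk y b).1|} ≤
      ENNReal.ofReal (4 / 3 * n ^ 2 / r ^ 4) := by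
  have h := letterLaw_max_sum_le isUnitStep_westStep_fst hr n
  have hi : Function.Injective fun i : ℕ => b + 1 + (i : ℤ) := fun i j h => by simpa using h
  rw [← map_letterLaw hi (Equiv.refl _)] at h
  rw [Measure.map_apply] at h
  · convert h using 3
    ext y
    simp [sum_westStep, Prod.fst_sum]
  · exact measurable_pi_lambda _ fun _ => measurable_pi_apply _
  · simpa using measurableSet_exists_le_abs (fun a => (westStep a).1) r 0 n

theorem letterLaw_westWalk_max_snd (b : ℤ) {r : ℤ} (hr : 0 < r) (n : ℕ) :
    letterLaw ℤ {y | ∃ j ≤ n, r ≤ |(westWalk y (b + j) - westWalk y b).2|} ≤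
      ENNReal.ofReal (4 / 3 * n ^ 2 / r ^ 4) := by
  have h := letterLaw_max_sum_le isUnitStep_westStep_snd hr n
  have hi : Function.Injective fun i : ℕ => b + 1 + (i : ℤ) := fun i j h => by simpa using h
  rw [← map_letterLaw hi (Equiv.refl _)] at h
  rw [Measure.map_apply] at h
  · convert h using 3
    ext y
    simp [sum_westStep, Prod.snd_sum]
  · exact measurable_pi_lambda _ fun _ => measurable_pi_apply _
  · simpa using measurableSet_exists_le_abs (fun a => (westStep a).2) r 0 n

/-! ## Concentration of the letters on a dual branch -/

/-- Hoeffding's inequality. Values in `[-2, 2]` give the subgaussian parameter `((2 + 2) / 2) ^ 2 =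
4`, hence the denominator `2 * 4 * n`. -/
theorem letterLaw_sum_ge_le {g : Fin 3 → ℝ} (hg : ∀ a, g a ∈ Set.Icc (-2) 2)
    (hg0 : ∑ a, g a = 0) (n : ℕ) {ε : ℝ} (hε : 0 ≤ ε) :
    (letterLaw ℕ).real {y | ε ≤ ∑ i ∈ Finset.range n, g (y i)} ≤ Real.exp (-ε ^ 2 / (8 * n)) := by
  have hindep : iIndepFun (fun (i : ℕ) (y : ℕ → Fin 3) => g (y i)) (letterLaw ℕ) :=
    iIndepFun_infinitePi fun _ => measurable_of_countable g
  have hmean : ∀ i : ℕ, ∫ y, g (y i) ∂letterLaw ℕ = 0 := fun i => by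
    have h1 : (letterLaw ℕ).map (fun y => y i) = uniformOn Set.univ := by
      rw [letterLaw]; exact Measure.infinitePi_map_eval _ i
    rw [← integral_map (φ := fun y : ℕ → Fin 3 => y i) (f := g) (measurable_pi_apply i).aemeasurable
      (measurable_of_countable g).aestronglyMeasurable, h1, integral_fintype .of_finite]
    simp [measureReal_def, uniformOn_univ_singleton, ← Finset.mul_sum, hg0]
  have hsub : ∀ i < n, HasSubgaussianMGF (fun y : ℕ → Fin 3 => g (y i)) 4 (letterLaw ℕ) := by
    intro i _
    have := hasSubgaussianMGF_of_mem_Icc_of_integral_eq_zero (μ := letterLaw ℕ)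
      (X := fun y : ℕ → Fin 3 => g (y i)) (a := -2) (b := 2)
      ((measurable_of_countable g).comp (measurable_pi_apply i)).aemeasurable
      (ae_of_all _ fun y => hg (y i)) (hmean i)
    convert this using 1
    ext; simp; norm_num
  have := HasSubgaussianMGF.measure_sum_range_ge_le_of_iIndepFun hindep hsub hε
  convert this using 3
  push_cast; ring

theorem letterLaw_abs_sum_gt_le {g : Fin 3 → ℝ} (hg : ∀ a, g a ∈ Set.Icc (-2) 2)
    (hg0 : ∑ a, g a = 0) (K : ℕ) {δ : ℝ} (hδ : 0 ≤ δ) :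
    (letterLaw ℕ).real {y | ∃ i ≤ K, δ < |∑ t ∈ Finset.range i, g (y t)|} ≤
      K * (2 * Real.exp (-δ ^ 2 / (8 * K))) := by
  have hsub : {y : ℕ → Fin 3 | ∃ i ≤ K, δ < |∑ t ∈ Finset.range i, g (y t)|} ⊆
      ⋃ i ∈ Finset.Icc 1 K, ({y | δ ≤ ∑ t ∈ Finset.range i, g (y t)} ∪
        {y | δ ≤ ∑ t ∈ Finset.range i, -g (y t)}) := by
    rintro y ⟨i, hi, h⟩
    have h1 : 1 ≤ i := by
      by_contra h1
      obtain rfl : i = 0 := by omega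
      simp at h; linarith
    simp only [Set.mem_iUnion, Finset.mem_Icc]
    refine ⟨i, ⟨h1, hi⟩, ?_⟩
    rcases lt_abs.1 h with h | h
    · exact Or.inl h.le
    · refine Or.inr ?_
      change δ ≤ ∑ t ∈ Finset.range i, -g (y t)
      rw [Finset.sum_neg_distrib]; exact h.le
  have hneg := letterLaw_sum_ge_le (g := fun a => -g a)
    (fun a => ⟨by linarith [(hg a).2], by linarith [(hg a).1]⟩) (by simp [hg0])
  calc _ ≤ (letterLaw ℕ).real (⋃ i ∈ Finset.Icc 1 K, ({y | δ ≤ ∑ t ∈ Finset.range i, g (y t)} ∪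
        {y | δ ≤ ∑ t ∈ Finset.range i, -g (y t)})) := measureReal_mono hsub (measure_ne_top _ _)
    _ ≤ ∑ i ∈ Finset.Icc 1 K, (letterLaw ℕ).real ({y | δ ≤ ∑ t ∈ Finset.range i, g (y t)} ∪
        {y | δ ≤ ∑ t ∈ Finset.range i, -g (y t)}) := measureReal_biUnion_finset_le _ _
    _ ≤ ∑ i ∈ Finset.Icc 1 K, 2 * Real.exp (-δ ^ 2 / (8 * K)) := by
        refine Finset.sum_le_sum fun i hi => ?_
        rw [Finset.mem_Icc] at hi
        have hmono : Real.exp (-δ ^ 2 / (8 * i)) ≤ Real.exp (-δ ^ 2 / (8 * K)) := by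
          rw [Real.exp_le_exp, neg_div, neg_div, neg_le_neg_iff]
          have h1 : (0 : ℝ) < i := by exact_mod_cast hi.1
          have h2 : (i : ℝ) ≤ K := by exact_mod_cast hi.2
          gcongr
        refine (measureReal_union_le _ _).trans ?_
        have h1 := letterLaw_sum_ge_le hg hg0 i hδ
        have h2 := hneg i hδ
        linarith
    _ = _ := by simp

/-- The number of letters `2` among the first `i` letters. -/
def twoCount (y : ℕ → Fin 3) (i : ℕ) : ℕ := ((Finset.range i).filter fun t => y t = 2).card

theorem sub_three_twoCount (y : ℕ → Fin 3) (i : ℕ) : ((i : ℤ) - 3 * twoCount y i : ℤ) =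
    ∑ t ∈ Finset.range i, (![(1 : ℤ), 1, -2] : Fin 3 → ℤ) (y t) := by
  have h : ∀ a : Fin 3, (![(1 : ℤ), 1, -2] : Fin 3 → ℤ) a = 1 - 3 * if a = 2 then 1 else 0 := by
    decide
  simp only [h, Finset.sum_sub_distrib, ← Finset.mul_sum, Finset.sum_boole, twoCount]
  simp

theorem letterLaw_twoCount (K : ℕ) {δ : ℤ} (hδ : 0 ≤ δ) :
    (letterLaw ℕ).real {y | ∃ i ≤ K, δ < |(i : ℤ) - 3 * twoCount y i|} ≤
      K * (2 * Real.exp (-(δ : ℝ) ^ 2 / (8 * K))) := by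
  have h := letterLaw_abs_sum_gt_le (g := fun a => (((![(1 : ℤ), 1, -2] : Fin 3 → ℤ) a : ℤ) : ℝ))
    (fun a => by fin_cases a <;> simp <;> norm_num) (by simp [Fin.sum_univ_three]; norm_num) K
    (δ := δ) (by exact_mod_cast hδ)
  refine le_trans (le_of_eq ?_) h
  congr 1
  ext y
  simp only [Set.mem_ofPred_eq, sub_three_twoCount]
  refine exists_congr fun i => and_congr_right fun _ => ?_
  rw [← Int.cast_sum, ← Int.cast_abs, Int.cast_lt]

theorem measurableSet_twoCount (K : ℕ) (δ : ℤ) :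
    MeasurableSet {y : ℕ → Fin 3 | ∃ i ≤ K, δ < |(i : ℤ) - 3 * twoCount y i|} := by
  have : {y : ℕ → Fin 3 | ∃ i ≤ K, δ < |(i : ℤ) - 3 * twoCount y i|} =
      ⋃ i ∈ Finset.range (K + 1), {y | δ < |∑ t ∈ Finset.range i,
        (![(1 : ℤ), 1, -2] : Fin 3 → ℤ) (y t)|} := by
    ext y; simp [← sub_three_twoCount]
  rw [this]
  refine Finset.measurableSet_biUnion _ fun j _ => ?_
  exact measurableSet_lt measurable_const
    ((measurable_of_countable fun v : ℤ => |v|).comp (measurable_letterSum _ _))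

theorem dualSouthNext_iterate_shiftSeq (j : ℤ) (x : ℤ → Fin 3) (i : ℕ) (k : ℤ) :
    (dualSouthNext (shiftSeq j x))^[i] k = (dualSouthNext x)^[i] (k + j) - j := by
  induction i with
  | zero => simp
  | succ i ih =>
    rw [Function.iterate_succ_apply', ih, dualSouthNext_shiftSeq, sub_add_cancel,
      Function.iterate_succ_apply']

theorem upCount_eq_twoCount (x : ℤ → Fin 3) (e : ℤ) (i : ℕ) :
    upCount x e i = twoCount (dualLetter (shiftSeq e x)) i := by
  simp [upCount, twoCount, dualLetter, dualSouthNext_iterate_shiftSeq, shiftSeq]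

/-- By stationarity the dual branch of the edge visited at time `n` has the law of the branch of the
root, whose letters are iid. -/
theorem letterLaw_upCount (n : ℤ) (K : ℕ) {δ : ℤ} (hδ : 0 ≤ δ) :
    (letterLaw ℤ).real {x | ∃ i ≤ K, δ < |(i : ℤ) - 3 * upCount x (westPath x n) i|} ≤
      K * (2 * Real.exp (-(δ : ℝ) ^ 2 / (8 * K))) := by
  have h1 := letterLaw_westPath (measurable_dualLetter (measurableSet_twoCount K δ)) n
  rw [← Measure.map_apply measurable_dualLetter (measurableSet_twoCount K δ), map_dualLetter] at h1
  refine le_trans (le_of_eq ?_) (letterLaw_twoCount K hδ)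
  rw [measureReal_def, measureReal_def, ← h1]
  simp only [upCount_eq_twoCount]
  rfl

/-! ## Dual and primal heights are asymptotically proportional -/

/-- The maximal inequality is applied to the walk started at time `-A`, over `2 A` steps. Recentring
at time 0 doubles the bound, hence `2 * r`. -/
theorem letterLaw_southHeight (A : ℕ) {r : ℤ} (hr : 0 < r) :
    letterLaw ℤ {x | ∃ n : ℤ, |n| ≤ A ∧ 2 * r ≤ |southHeight x n|} ≤
      ENNReal.ofReal (4 / 3 * (2 * A) ^ 2 / r ^ 4) := by
  have h := letterLaw_westWalk_max_fst (-A) hr (2 * A)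
  have hm : MeasurableSet {y | ∃ j ≤ 2 * A, r ≤ |(westWalk y (-A + j) - westWalk y (-A)).1|} := by
    simp only [sum_westStep]
    have hi : Measurable fun (y : ℤ → Fin 3) (i : ℕ) => y (-A + 1 + (i : ℤ)) :=
      measurable_pi_lambda _ fun _ => measurable_pi_apply _
    have := hi (measurableSet_exists_le_abs (fun a => (westStep a).1) r 0 (2 * A))
    simpa [Prod.fst_sum] using this
  rw [← map_westLetter, Measure.map_apply measurable_westLetter hm] at h
  push_cast at h
  refine le_trans (measure_mono_ae ?_) h
  filter_upwards [ae_recurrent] with x hx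
  rintro ⟨n, hn, h2⟩
  by_contra hc
  have hc' : ∀ j : ℕ, j ≤ 2 * A →
      |(westWalk (westLetter x) (-A + j) - westWalk (westLetter x) (-A)).1| < r := by
    intro j hj
    by_contra h'
    exact hc ⟨j, hj, not_lt.1 h'⟩
  rw [hx.southHeight_eq] at h2
  have e1 := hc' (n + A).toNat (by rw [abs_le] at hn; omega)
  have e2 := hc' A (by omega)
  rw [Int.toNat_of_nonneg (by rw [abs_le] at hn; omega), show -(A : ℤ) + (n + A) = n by ring] at e1
  rw [neg_add_cancel] at e2
  have e3 : westWalk (westLetter x) 0 = 0 := intSum_zero _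
  rw [e3] at e2
  simp only [Prod.fst_sub, Prod.fst_zero] at e1 e2
  rw [abs_lt] at e1 e2
  rw [le_abs] at h2
  omega

/-- The first term bounds the probability that the primal heights reach `2 * r`, the second that the
letters 2 are unevenly spread on one of the `2 * A + 1` dual branches. Otherwise
`abs_dualSouthHeight_sub_le` applies with `l = 2 * r`, which explains `12 * r`. -/
theorem letterLaw_dualSouthHeight (A : ℕ) {r K : ℕ} (hr : 0 < r) {δ : ℕ} (hK : 12 * r + δ < K) :
    letterLaw ℤ {x | ∃ n : ℤ, |n| ≤ A ∧ 2 * (δ : ℤ) < |dualSouthHeight x n - 3 * southHeight x n|} ≤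
      ENNReal.ofReal (4 / 3 * (2 * A) ^ 2 / r ^ 4 +
        (2 * A + 1) * (K * (2 * Real.exp (-(δ : ℝ) ^ 2 / (8 * K))))) := by
  rw [ENNReal.ofReal_add (by positivity) (by positivity)]
  have h1 := letterLaw_southHeight A (r := r) (by exact_mod_cast hr)
  have h2 : letterLaw ℤ (⋃ n ∈ Finset.Icc (-(A : ℤ)) A, {x | ∃ i ≤ K, (δ : ℤ) <
      |(i : ℤ) - 3 * upCount x (westPath x n) i|}) ≤
      ENNReal.ofReal ((2 * A + 1) * (K * (2 * Real.exp (-(δ : ℝ) ^ 2 / (8 * K))))) := by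
    rw [← ofReal_measureReal (measure_ne_top _ _)]
    refine ENNReal.ofReal_le_ofReal ((measureReal_biUnion_finset_le _ _).trans ?_)
    refine (Finset.sum_le_card_nsmul _ _ _ fun n _ =>
      letterLaw_upCount n K (δ := δ) (by omega)).trans ?_
    rw [Int.card_Icc, nsmul_eq_mul, show ((A : ℤ) + 1 - -A).toNat = 2 * A + 1 by omega]
    push_cast
    exact le_rfl
  refine le_trans (measure_mono_ae ?_) ((measure_union_le _ _).trans (add_le_add h1 h2))
  filter_upwards [ae_recurrent] with x hx
  rintro ⟨n, hn, h3⟩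
  by_contra hc
  refine absurd h3 (not_lt.2 ?_)
  refine hx.abs_dualSouthHeight_sub_le (A := A) (l := 2 * r) (K := K) (δ := δ) ?_ ?_ ?_ n hn
  · intro n hn
    by_contra h'
    exact hc (Or.inl ⟨n, hn, by push_cast at h'; exact not_lt.1 h'⟩)
  · intro n hn i hi
    by_contra h'
    refine hc (Or.inr ?_)
    simp only [Set.mem_iUnion, Finset.mem_Icc]
    exact ⟨n, abs_le.1 hn, i, hi, not_le.1 h'⟩
  · push_cast; omega

/-! ## Comparison of the rescaled paths -/

theorem interp_mem {s : Set (ℝ × ℝ)} (hs : Convex ℝ s) {x : ℤ → ℤ × ℤ} {t : ℝ}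
    (h : planePoint x ⌊t⌋ ∈ s) (h' : planePoint x (⌊t⌋ + 1) ∈ s) : interp x t ∈ s :=
  hs.add_smul_sub_mem h h' ⟨Int.fract_nonneg t, (Int.fract_lt_one t).le⟩

theorem planePoint_sub_three (x y : ℤ → ℤ × ℤ) (n : ℤ) :
    planePoint (fun n => x n - 3 • y n) n = planePoint x n - (3 : ℝ) • planePoint y n := by
  ext <;> simp [planePoint]

theorem interp_sub_three (x y : ℤ → ℤ × ℤ) (t : ℝ) :
    interp (fun n => x n - 3 • y n) t = interp x t - (3 : ℝ) • interp y t := by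
  simp only [interp, planePoint_sub_three]
  module

theorem norm_planePoint_le {x : ℤ → ℤ × ℤ} {n : ℤ} {r : ℤ} (h1 : |(x n).1| ≤ r)
    (h2 : |(x n).2| ≤ r) : ‖planePoint x n‖ ≤ r := by
  rw [planePoint, norm_prod_le_iff]
  simp only [Real.norm_eq_abs]
  exact ⟨by exact_mod_cast h1, by exact_mod_cast h2⟩

/-- The walk of the dual map, in terms of letters. -/
noncomputable def dualPath (x : ℤ → Fin 3) (n : ℤ) : ℤ × ℤ :=
  (dualSouthHeight x n, dualSouthHeight (revSeq x) (-n))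

/-- The walk of the primal trees, in terms of letters. -/
noncomputable def primalPath (x : ℤ → Fin 3) : ℤ → ℤ × ℤ := westWalk (westLetter x)

theorem letterLaw_dualPath (A : ℕ) {r K : ℕ} (hr : 0 < r) {δ : ℕ} (hK : 12 * r + δ < K) :
    letterLaw ℤ {x | ∃ n : ℤ, |n| ≤ A ∧ ¬ (|(dualPath x n - 3 • primalPath x n).1| ≤ 2 * (δ : ℤ) ∧
      |(dualPath x n - 3 • primalPath x n).2| ≤ 2 * (δ : ℤ))} ≤
      ENNReal.ofReal (2 * (4 / 3 * (2 * A) ^ 2 / r ^ 4 +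
        (2 * A + 1) * (K * (2 * Real.exp (-(δ : ℝ) ^ 2 / (8 * K)))))) := by
  set S := {x | ∃ n : ℤ, |n| ≤ A ∧ 2 * (δ : ℤ) < |dualSouthHeight x n - 3 * southHeight x n|}
  have h1 := letterLaw_dualSouthHeight A hr hK
  -- The second coordinate at time `n` is the first coordinate at time `-n` for the reversed
  -- letters, which have the same law.
  have h2 : letterLaw ℤ (revSeq ⁻¹' S) ≤ letterLaw ℤ S := by
    conv_rhs => rw [← map_revSeq]
    exact Measure.le_map_apply measurable_revSeq.aemeasurable _
  rw [two_mul (_ + _), ENNReal.ofReal_add (by positivity) (by positivity)]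
  refine le_trans (measure_mono_ae ?_) ((measure_union_le _ _).trans
    (add_le_add h1 (h2.trans h1)))
  filter_upwards [ae_recurrent] with x hx
  rintro ⟨n, hn, h3⟩
  rw [not_and_or, not_le, not_le] at h3
  have e1 := hx.southHeight_eq n
  have e2 := hx.southHeight_revSeq n
  rw [hx.relHeight_north_eq] at e2
  rcases h3 with h3 | h3
  · left
    refine ⟨n, hn, ?_⟩
    rw [e1]
    simpa [dualPath, primalPath] using h3
  · right
    refine ⟨-n, by rwa [abs_neg], ?_⟩
    rw [e2]
    simpa [dualPath, primalPath] using h3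

theorem norm_rescaled_sub_le {α : ℝ} {m : ℕ} {x y : ℤ → ℤ × ℤ} {A : ℕ} {r : ℤ}
    (h : ∀ n : ℤ, |n| ≤ A → |(x n - 3 • y n).1| ≤ r ∧ |(x n - 3 • y n).2| ≤ r) {t : ℝ}
    (ht : |t * m| + 1 ≤ A) :
    dist (rescaled α m x t) ((3 : ℝ) • rescaled α m y t) ≤
      Real.sqrt (3 * α / 2) * (Real.sqrt m)⁻¹ * r := by
  have hA : ∀ n : ℤ, n = ⌊t * m⌋ ∨ n = ⌊t * m⌋ + 1 → |n| ≤ A := by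
    intro n hn
    have h1 := Int.floor_le (t * m)
    have h2 := Int.lt_floor_add_one (t * m)
    have h3 := abs_le.1 (show |t * m| ≤ A - 1 by linarith)
    have h4 : |(n : ℝ)| ≤ A := by
      rw [abs_le]
      rcases hn with rfl | rfl
      · constructor <;> linarith
      · push_cast; constructor <;> linarith
    exact_mod_cast h4
  have key : interp (fun n => x n - 3 • y n) (t * m) ∈ Metric.closedBall (0 : ℝ × ℝ) r := by
    refine interp_mem (convex_closedBall _ _) ?_ ?_ <;> rw [mem_closedBall_zero_iff]
    · exact norm_planePoint_le (h _ (hA _ (Or.inl rfl))).1 (h _ (hA _ (Or.inl rfl))).2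
    · exact norm_planePoint_le (h _ (hA _ (Or.inr rfl))).1 (h _ (hA _ (Or.inr rfl))).2
  rw [mem_closedBall_zero_iff, interp_sub_three] at key
  have : rescaled α m x t - (3 : ℝ) • rescaled α m y t =
      (Real.sqrt (3 * α / 2) * (Real.sqrt m)⁻¹) • (interp x (t * m) - (3 : ℝ) • interp y (t * m)) := by
    simp only [rescaled, ContinuousMap.coe_mk]
    module
  rw [dist_eq_norm, this, norm_smul, Real.norm_of_nonneg (by positivity)]
  gcongr

theorem exp_neg_le_div {x : ℝ} (hx : 0 < x) : Real.exp (-x) ≤ 24 / x ^ 4 := by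
  have h := Real.pow_div_factorial_le_exp x hx.le 4
  have h4 : ((Nat.factorial 4 : ℕ) : ℝ) = 24 := by norm_num [Nat.factorial]
  rw [h4] at h
  rw [Real.exp_neg, ← one_div, div_le_div_iff₀ (Real.exp_pos _) (by positivity)]
  rw [div_le_iff₀ (by norm_num)] at h
  linarith

/-- Here `s` plays the role of the square root of `m`. In the first term the powers of `s` cancel,
and 171 is 512/3 rounded up. The exponent is at most `-s / (32 * D ^ 2 * (12 * L + 2))`, so the
exponential is of order `s ^ (-4)` at most, against a prefactor of order `s ^ 3`. -/
theorem tail_bound_le {s B L D : ℕ} (hs : 2 * D ≤ s) (hD : 0 < D) (hL : 0 < L) :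
    2 * (4 / 3 * (2 * ((4 * B * s ^ 2 : ℕ) : ℝ)) ^ 2 / ((L * s : ℕ) : ℝ) ^ 4 +
      (2 * ((4 * B * s ^ 2 : ℕ) : ℝ) + 1) * (((12 * L + 2) * s : ℕ) *
        (2 * Real.exp (-((s / D : ℕ) : ℝ) ^ 2 / (8 * ((12 * L + 2) * s : ℕ)))))) ≤
      171 * B ^ 2 / L ^ 4 +
        2 * (9 * (B + 1) * (12 * L + 2) * (2 * (24 * (32 * D ^ 2 * (12 * L + 2)) ^ 4))) / s := by
  have hs0 : (0 : ℝ) < s := by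
    have : 0 < s := by omega
    exact_mod_cast this
  have hs1 : (1 : ℝ) ≤ s := by
    have : 1 ≤ s := by omega
    exact_mod_cast this
  have hD0 : (0 : ℝ) < D := by exact_mod_cast hD
  have hL0 : (0 : ℝ) < L := by exact_mod_cast hL
  have hB0 : (0 : ℝ) ≤ B := B.cast_nonneg
  have hdiv : (s : ℝ) / (2 * D) ≤ ((s / D : ℕ) : ℝ) := by
    have h1 : (s : ℝ) / D < (s / D : ℕ) + 1 := by
      rw [div_lt_iff₀ hD0]
      exact_mod_cast (Nat.lt_mul_div_succ s hD).trans_eq (by ring)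
    have h2 : 1 ≤ (s : ℝ) / (2 * D) := by
      rw [one_le_div (by positivity)]
      exact_mod_cast hs
    have h3 : (s : ℝ) / D = 2 * (s / (2 * D)) := by field_simp
    linarith
  set γ : ℝ := 32 * D ^ 2 * (12 * L + 2) with hγ
  have hγ0 : 0 < γ := by positivity
  have hexp : Real.exp (-((s / D : ℕ) : ℝ) ^ 2 / (8 * ((12 * L + 2) * s : ℕ))) ≤
      24 * γ ^ 4 / s ^ 4 := by
    have h1 : (s : ℝ) / γ ≤ ((s / D : ℕ) : ℝ) ^ 2 / (8 * ((12 * L + 2) * s : ℕ)) := by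
      have : (s : ℝ) / γ = (s / (2 * D)) ^ 2 / (8 * ((12 * L + 2) * s : ℕ)) := by
        rw [hγ]; push_cast; field_simp; ring
      rw [this]
      gcongr
    rw [neg_div]
    refine (Real.exp_le_exp.2 (neg_le_neg h1)).trans ((exp_neg_le_div (by positivity)).trans ?_)
    rw [div_pow]
    apply le_of_eq
    field_simp
  have hfst : 2 * (4 / 3 * (2 * ((4 * B * s ^ 2 : ℕ) : ℝ)) ^ 2 / ((L * s : ℕ) : ℝ) ^ 4) ≤
      171 * B ^ 2 / L ^ 4 := by
    have : 2 * (4 / 3 * (2 * ((4 * B * s ^ 2 : ℕ) : ℝ)) ^ 2 / ((L * s : ℕ) : ℝ) ^ 4) =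
        512 / 3 * B ^ 2 / L ^ 4 := by
      push_cast; field_simp; ring
    rw [this]
    gcongr
    norm_num
  have hsnd : (2 * ((4 * B * s ^ 2 : ℕ) : ℝ) + 1) * (((12 * L + 2) * s : ℕ) *
        (2 * Real.exp (-((s / D : ℕ) : ℝ) ^ 2 / (8 * ((12 * L + 2) * s : ℕ))))) ≤
      (9 * (B + 1) * s ^ 2) * (((12 * L + 2) * s) * (2 * (24 * γ ^ 4 / s ^ 4))) := by
    push_cast at hexp ⊢
    gcongr
    have : (1 : ℝ) ≤ s ^ 2 := one_le_pow₀ hs1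
    nlinarith
  have heq : (9 * ((B : ℝ) + 1) * s ^ 2) * (((12 * L + 2) * s) * (2 * (24 * γ ^ 4 / s ^ 4))) =
      9 * (B + 1) * (12 * L + 2) * (2 * (24 * γ ^ 4)) / s := by
    field_simp
  rw [heq] at hsnd
  rw [mul_add]
  have : 2 * (9 * ((B : ℝ) + 1) * (12 * L + 2) * (2 * (24 * γ ^ 4))) / s =
    2 * (9 * (B + 1) * (12 * L + 2) * (2 * (24 * γ ^ 4)) / s) := by ring
  rw [this]
  linarith

/-- The rescaled walk of the dual map is close to three times that of the primal map. -/
theorem eventually_dualPath_close (α : ℝ) (T : ℝ) {η ε : ℝ} (hη : 0 < η) (hε : 0 < ε) :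
    ∀ᶠ m : ℕ in atTop, letterLaw ℤ {x | ∃ t : ℝ, |t| ≤ T ∧
      η < dist (rescaled α m (dualPath x) t) ((3 : ℝ) • rescaled α m (primalPath x) t)} ≤
      ENNReal.ofReal ε := by
  -- `B` covers the time window, `D` makes the error `2 * (s / D)` at most `η` after rescaling, `L`
  -- makes the first term of the tail bound at most `ε / 2`, and finally `s₀` does so for the second
  -- term.
  obtain ⟨B, hB⟩ := exists_nat_ge (T + 1)
  obtain ⟨D, hD⟩ := exists_nat_ge (2 * Real.sqrt (3 * α / 2) / η + 1)
  obtain ⟨L, hL⟩ := exists_nat_ge (171 * (B : ℝ) ^ 2 / (ε / 2) + 1)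
  have hc : 0 ≤ Real.sqrt (3 * α / 2) := Real.sqrt_nonneg _
  have hD0 : 0 < D := by
    have : (0 : ℝ) < D := lt_of_lt_of_le (by positivity) hD
    exact_mod_cast this
  have hL0 : 0 < L := by
    have : (0 : ℝ) < L := lt_of_lt_of_le (by positivity) hL
    exact_mod_cast this
  set C : ℝ := 2 * (9 * (B + 1) * (12 * L + 2) * (2 * (24 * (32 * D ^ 2 * (12 * L + 2)) ^ 4)))
  obtain ⟨s₀, hs₀⟩ := exists_nat_ge (C / (ε / 2) + 1)
  filter_upwards [eventually_ge_atTop ((s₀ + 2 * D) ^ 2)] with m hm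
  set s := Nat.sqrt m with hs
  have hs1 : s₀ + 2 * D ≤ s := Nat.le_sqrt'.2 hm
  have hs2 : s ^ 2 ≤ m := Nat.sqrt_le' m
  have hs3 : m < (s + 1) ^ 2 := Nat.lt_succ_sqrt' m
  have hs4 : (0 : ℝ) < s := by
    have : 0 < s := by omega
    exact_mod_cast this
  have hbound := letterLaw_dualPath (4 * B * s ^ 2) (r := L * s) (K := (12 * L + 2) * s)
    (δ := s / D) (Nat.mul_pos hL0 (by omega)) (by
      have := Nat.div_le_self s D
      have : 0 < s := by omega
      nlinarith)
  refine le_trans (measure_mono ?_) (hbound.trans (ENNReal.ofReal_le_ofReal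
    ((tail_bound_le (by omega) hD0 hL0).trans ?_)))
  · rintro x ⟨t, ht, hlt⟩
    by_contra hc'
    refine absurd hlt (not_lt.2 ?_)
    refine (norm_rescaled_sub_le (A := 4 * B * s ^ 2) (r := 2 * ((s / D : ℕ) : ℤ)) (fun n hn => ?_)
      ?_).trans ?_
    · by_contra h'
      exact hc' ⟨n, hn, h'⟩
    · have h1 : (m : ℝ) ≤ 4 * s ^ 2 := by
        have h2 : m ≤ 4 * s ^ 2 := by nlinarith
        exact_mod_cast h2
      have h2 : (1 : ℝ) ≤ 4 * s ^ 2 := by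
        have : 1 ≤ 4 * s ^ 2 := by nlinarith
        exact_mod_cast this
      rw [abs_mul, Nat.abs_cast]
      push_cast
      have h3 : 0 ≤ T := (abs_nonneg t).trans ht
      calc |t| * m + 1 ≤ T * (4 * s ^ 2) + 4 * s ^ 2 := by gcongr
        _ = 4 * (T + 1) * s ^ 2 := by ring
        _ ≤ 4 * B * s ^ 2 := by gcongr
    · have h1 : (s : ℝ) ≤ Real.sqrt m := by
        apply Real.le_sqrt_of_sq_le
        exact_mod_cast hs2
      have h2 : ((s / D : ℕ) : ℝ) ≤ s / D := Nat.cast_div_le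
      have hD1 : (0 : ℝ) < D := by exact_mod_cast hD0
      have h3 : 2 * Real.sqrt (3 * α / 2) / D ≤ η := by
        rw [div_le_iff₀ hD1]
        rw [← sub_nonneg] at hD
        have : 2 * Real.sqrt (3 * α / 2) / η ≤ D := by linarith
        rw [div_le_iff₀ hη] at this
        linarith
      refine le_trans ?_ h3
      push_cast
      calc Real.sqrt (3 * α / 2) * (Real.sqrt m)⁻¹ * (2 * ((s / D : ℕ) : ℝ))
          ≤ Real.sqrt (3 * α / 2) * (s : ℝ)⁻¹ * (2 * (s / D)) := by gcongr
        _ = 2 * Real.sqrt (3 * α / 2) / D := by field_simp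
  · have hL1 : (1 : ℝ) ≤ L := by exact_mod_cast hL0
    have h1 : 171 * (B : ℝ) ^ 2 / L ^ 4 ≤ ε / 2 := by
      rw [div_le_iff₀ (by positivity)]
      have h2 : 171 * (B : ℝ) ^ 2 / (ε / 2) ≤ L := by linarith
      rw [div_le_iff₀ (by positivity)] at h2
      have h3 : (L : ℝ) ≤ L ^ 4 := le_self_pow₀ hL1 (by norm_num)
      nlinarith
    have h2 : C / s ≤ ε / 2 := by
      rw [div_le_iff₀ hs4]
      have h3 : C / (ε / 2) ≤ s := by
        have : (s₀ : ℝ) ≤ s := by exact_mod_cast (by omega : s₀ ≤ s)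
        linarith
      rw [div_le_iff₀ (by positivity)] at h3
      linarith
    linarith

open scoped ENNReal Uniformity Topology

/-! ## Convergence in distribution in uniform spaces -/

section Approximation

variable {E Ω Ω' : Type*} [UniformSpace E] [IsCountablyGenerated (𝓤 E)] [MeasurableSpace E]
  [BorelSpace E] [MeasurableSpace Ω] [MeasurableSpace Ω'] {P : Measure Ω} [IsProbabilityMeasure P]
  {P' : Measure Ω'} [IsProbabilityMeasure P']

theorem abs_integral_sub_le {f g : Ω → ℝ} (hf : Integrable f P) (hg : Integrable g P) {B : Set Ω}
    {a M e : ℝ} (ha : 0 ≤ a) (hM : 0 ≤ M) (he : 0 ≤ e) (h1 : ∀ ω ∉ B, |f ω - g ω| ≤ a)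
    (h2 : ∀ ω, |f ω - g ω| ≤ M) (hB : P B ≤ ENNReal.ofReal e) :
    |∫ ω, f ω ∂P - ∫ ω, g ω ∂P| ≤ a + M * e := by
  rw [← integral_sub hf hg]
  -- The exceptional set need not be measurable; its measurable hull has the same measure.
  set B' := toMeasurable P B
  have hB' : MeasurableSet B' := measurableSet_toMeasurable P B
  have hint : Integrable (fun ω => a + B'.indicator (fun _ => M) ω) P :=
    (integrable_const a).add ((integrable_const M).indicator hB')
  calc |∫ ω, (f ω - g ω) ∂P| ≤ ∫ ω, |f ω - g ω| ∂P := abs_integral_le_integral_abs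
    _ ≤ ∫ ω, (a + B'.indicator (fun _ => M) ω) ∂P := by
        refine integral_mono (hf.sub hg).abs hint fun ω => ?_
        by_cases hω : ω ∈ B'
        · simp only [Set.indicator_of_mem hω]
          linarith [h2 ω]
        · simp only [Set.indicator_of_notMem hω, add_zero]
          exact h1 ω fun h => hω (subset_toMeasurable P B h)
    _ = a + P.real B' * M := by
        rw [integral_add (integrable_const a) ((integrable_const M).indicator hB'),
          integral_indicator_const _ hB']
        simp
    _ ≤ a + M * e := by
        rw [mul_comm]
        gcongr
        rw [measureReal_def, measure_toMeasurable]
        exact ENNReal.toReal_le_of_le_ofReal he hB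

/-- Approximation of a sequence by sequences that converge in distribution. -/
theorem tendstoInDistribution_of_approx {X : ℕ → Ω → E} {X' : ℕ → ℕ → Ω → E} {Z' : ℕ → Ω' → E}
    {Z : Ω' → E} (hX : ∀ i, AEMeasurable (X i) P)
    (h1 : ∀ k, TendstoInDistribution (X' k) atTop (Z' k) (fun _ => P) P')
    (h2 : TendstoInDistribution Z' atTop Z (fun _ => P') P')
    (h3 : ∀ V ∈ 𝓤 E, ∀ ε > 0, ∀ᶠ k in atTop, ∀ᶠ i in atTop,
      P {ω | (X i ω, X' k i ω) ∉ V} ≤ ENNReal.ofReal ε) :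
    TendstoInDistribution X atTop Z (fun _ => P) P' := by
  -- A countably generated uniformity comes from a pseudometric, so bounded Lipschitz functions can
  -- serve as test functions.
  let _ : PseudoMetricSpace E := UniformSpace.pseudoMetricSpace E
  refine ⟨hX, h2.aemeasurable_limit, ?_⟩
  refine tendsto_iff_forall_lipschitz_integral_tendsto.2 ?_
  rintro F ⟨M, hM⟩ ⟨L, hL⟩
  have hF : Continuous F := hL.continuous
  have hZne : Nonempty E := by
    obtain ⟨ω⟩ : Nonempty Ω' := nonempty_of_isProbabilityMeasure P'
    exact ⟨Z ω⟩
  obtain ⟨x₀⟩ := hZne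
  have hM0 : 0 ≤ M := dist_nonneg.trans (hM x₀ x₀)
  have hbound : ∀ x, ‖F x‖ ≤ ‖F x₀‖ + M := fun x => by
    have := hM x x₀
    rw [dist_eq_norm] at this
    have h := norm_sub_norm_le (F x) (F x₀)
    linarith
  have hint : ∀ {U : Ω → E}, AEMeasurable U P → Integrable (fun ω => F (U ω)) P := fun hU =>
    Integrable.of_bound (hF.measurable.comp_aemeasurable hU).aestronglyMeasurable _
      (ae_of_all _ fun ω => hbound _)
  have e1 : ∀ k, Tendsto (fun i => ∫ ω, F (X' k i ω) ∂P) atTop (𝓝 (∫ ω, F (Z' k ω) ∂P')) := by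
    intro k
    have := tendsto_iff_forall_lipschitz_integral_tendsto.1 (h1 k).tendsto F ⟨M, hM⟩ ⟨L, hL⟩
    simp only [ProbabilityMeasure.coe_mk] at this
    rw [integral_map (h1 k).aemeasurable_limit hF.aestronglyMeasurable] at this
    refine this.congr fun i => ?_
    rw [integral_map ((h1 k).forall_aemeasurable i) hF.aestronglyMeasurable]
  have e2 : Tendsto (fun k => ∫ ω, F (Z' k ω) ∂P') atTop (𝓝 (∫ ω, F (Z ω) ∂P')) := by
    have := tendsto_iff_forall_lipschitz_integral_tendsto.1 h2.tendsto F ⟨M, hM⟩ ⟨L, hL⟩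
    simp only [ProbabilityMeasure.coe_mk] at this
    rw [integral_map h2.aemeasurable_limit hF.aestronglyMeasurable] at this
    refine this.congr fun k => ?_
    rw [integral_map (h2.forall_aemeasurable k) hF.aestronglyMeasurable]
  simp only [ProbabilityMeasure.coe_mk]
  rw [integral_map h2.aemeasurable_limit hF.aestronglyMeasurable]
  have e3 : Tendsto (fun i => ∫ ω, F (X i ω) ∂P) atTop (𝓝 (∫ ω, F (Z ω) ∂P')) := by
    rw [Metric.tendsto_atTop']
    intro ε hε
    -- There are four errors of at most `ε / 4`: replacing `X` by `X' k` off and on the exceptional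
    -- event, the limit in `i`, and the limit in `k`.
    have hV : {p : E × E | dist p.1 p.2 < ε / (4 * (L + 1))} ∈ 𝓤 E :=
      Metric.dist_mem_uniformity (by positivity)
    have e4 := h3 _ hV (ε / (4 * (M + 1))) (by positivity)
    obtain ⟨k, hk1, hk2⟩ := (e4.and ((Metric.tendsto_nhds.1 e2) (ε / 4) (by positivity))).exists
    obtain ⟨N, hN⟩ := eventually_atTop.1 (hk1.and ((Metric.tendsto_nhds.1 (e1 k)) (ε / 4)
      (by positivity)))
    refine ⟨N, fun i hi => ?_⟩
    obtain ⟨h4, h5⟩ := hN i hi.le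
    have hL0 : (0 : ℝ) ≤ L := L.2
    have h6 := abs_integral_sub_le (hint (hX i)) (hint ((h1 k).forall_aemeasurable i))
      (a := ε / 4) (M := M) (e := ε / (4 * (M + 1))) (by positivity) hM0 (by positivity)
      (fun ω hω => by
        have h7 : dist (X i ω) (X' k i ω) < ε / (4 * (L + 1)) := by
          by_contra h; exact hω h
        rw [← Real.dist_eq]
        refine (hL.dist_le_mul _ _).trans ?_
        calc (L : ℝ) * dist (X i ω) (X' k i ω) ≤ (L + 1) * (ε / (4 * (L + 1))) := by
              gcongr; linarith
          _ = ε / 4 := by field_simp)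
      (fun ω => by rw [← Real.dist_eq]; exact hM _ _) h4
    have h8 : M * (ε / (4 * (M + 1))) ≤ ε / 4 := by
      rw [mul_div_assoc', div_le_div_iff₀ (by positivity) (by positivity)]
      nlinarith
    rw [Real.dist_eq, abs_lt] at *
    rw [abs_le] at h6
    constructor <;> linarith [h6.1, h6.2, h5.1, h5.2, hk2.1, hk2.2]
  refine e3.congr fun i => ?_
  rw [integral_map (hX i) hF.aestronglyMeasurable]

/-- Sequences that get close in probability have the same limit in distribution. -/
theorem tendstoInDistribution_of_close {X X' : ℕ → Ω → E} {Z : Ω' → E}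
    (hX : ∀ i, AEMeasurable (X i) P) (h1 : TendstoInDistribution X' atTop Z (fun _ => P) P')
    (h3 : ∀ V ∈ 𝓤 E, ∀ ε > 0, ∀ᶠ i in atTop,
      P {ω | (X i ω, X' i ω) ∉ V} ≤ ENNReal.ofReal ε) :
    TendstoInDistribution X atTop Z (fun _ => P) P' :=
  tendstoInDistribution_of_approx hX (fun _ => h1)
    (tendstoInDistribution_const h1.aemeasurable_limit)
    fun V hV ε hε => Eventually.of_forall fun _ => h3 V hV ε hε

omit [UniformSpace E] [IsCountablyGenerated (𝓤 E)] [BorelSpace E] [IsProbabilityMeasure P] in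
/-- Convergence in distribution only depends on the law of the underlying random object. -/
theorem tendstoInDistribution_comp_of_map_eq [TopologicalSpace E] [OpensMeasurableSpace E]
    {S : Type*} [MeasurableSpace S] {μ : Measure S} [IsProbabilityMeasure μ]
    [IsProbabilityMeasure P] {ξ : Ω → S} (hξ : AEMeasurable ξ P) (hμ : P.map ξ = μ)
    {X : ℕ → S → E} {Z : Ω' → E} (h : TendstoInDistribution X atTop Z (fun _ => μ) P') :
    TendstoInDistribution (fun n ω => X n (ξ ω)) atTop Z (fun _ => P) P' := by
  subst hμ
  refine ⟨fun n => (h.forall_aemeasurable n).comp_aemeasurable hξ, h.aemeasurable_limit, ?_⟩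
  refine h.tendsto.congr fun n => ?_
  refine Subtype.ext ?_
  exact AEMeasurable.map_map_of_aemeasurable (h.forall_aemeasurable n) hξ

end Approximation

/-! ## The space of paths -/

theorem mem_uniformity_of_forall_close {V : Set (C(ℝ, ℝ × ℝ) × C(ℝ, ℝ × ℝ))} (hV : V ∈ 𝓤 C(ℝ, ℝ × ℝ)) :
    ∃ T : ℕ, ∃ η > 0, ∀ f g : C(ℝ, ℝ × ℝ), (∀ t : ℝ, |t| ≤ T → dist (f t) (g t) ≤ η) →
      (f, g) ∈ V := by
  rw [ContinuousMap.mem_compactConvergence_entourage_iff] at hV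
  obtain ⟨K, U, hK, hU, hKU⟩ := hV
  obtain ⟨η, hη, hηU⟩ := Metric.mem_uniformity_dist.1 hU
  obtain ⟨R, hR⟩ := hK.isBounded.exists_norm_le
  obtain ⟨T, hT⟩ := exists_nat_ge R
  refine ⟨T, η / 2, by positivity, fun f g h => hKU fun t ht => hηU ?_⟩
  exact (h t ((hR t ht).trans hT)).trans_lt (by linarith)

theorem tendsto_path_of_forall_close {f : ℕ → C(ℝ, ℝ × ℝ)} {g : C(ℝ, ℝ × ℝ)}
    (h : ∀ T : ℕ, ∀ η > 0, ∀ᶠ n in atTop, ∀ t : ℝ, |t| ≤ T → dist (g t) (f n t) ≤ η) :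
    Tendsto f atTop (𝓝 g) := by
  rw [Uniform.tendsto_nhds_right, tendsto_def]
  intro V hV
  obtain ⟨T, η, hη, hV⟩ := mem_uniformity_of_forall_close hV
  filter_upwards [h T η hη] with n hn
  exact hV _ _ hn

instance : PolishSpace C(ℝ, ℝ × ℝ) := by
  let _ := UniformSpace.metricSpace C(ℝ, ℝ × ℝ)
  infer_instance

/-- A continuous injection of a Polish space is a measurable embedding. So measurability of a random
path can be tested at rational times. -/
theorem measurableEmbedding_eval_rat :
    MeasurableEmbedding fun (f : C(ℝ, ℝ × ℝ)) (q : ℚ) => f (q : ℝ) := by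
  refine Continuous.measurableEmbedding (by fun_prop) fun f g h => ?_
  refine ContinuousMap.coe_injective
    (Rat.denseRange_cast.equalizer f.continuous g.continuous ?_)
  exact h

theorem measurable_path {S : Type*} [MeasurableSpace S] {F : S → C(ℝ, ℝ × ℝ)}
    (h : ∀ t : ℝ, Measurable fun s => F s t) : Measurable F :=
  measurableEmbedding_eval_rat.measurable_comp_iff.1
    (measurable_pi_lambda _ fun q => h q)

theorem aemeasurable_path {S : Type*} [MeasurableSpace S] {μ : Measure S} {F : S → C(ℝ, ℝ × ℝ)}
    (h : ∀ t : ℝ, AEMeasurable (fun s => F s t) μ) : AEMeasurable F μ :=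
  measurableEmbedding_eval_rat.aemeasurable_comp_iff.1
    (aemeasurable_pi_lambda _ fun q => h q)

theorem measurable_rescaled {S : Type*} [MeasurableSpace S] {F : S → ℤ → ℤ × ℤ}
    (h : ∀ n, Measurable fun s => F s n) (α : ℝ) (m : ℕ) :
    Measurable fun s => rescaled α m (F s) := by
  have h1 : ∀ n, Measurable fun s => planePoint (F s) n := fun n =>
    (measurable_of_countable (fun p : ℤ × ℤ => (((p.1 : ℝ), (p.2 : ℝ)) : ℝ × ℝ))).comp (h n)
  refine measurable_path fun t => ?_
  simp only [rescaled, interp, ContinuousMap.coe_mk]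
  have h2 : Measurable fun s => planePoint (F s) (⌊t * m⌋ + 1) - planePoint (F s) ⌊t * m⌋ :=
    (h1 _).sub (h1 _)
  have h3 := (h1 ⌊t * m⌋).add (h2.const_smul (Int.fract (t * m)))
  exact h3.const_smul (Real.sqrt (3 * α / 2) * (Real.sqrt m)⁻¹)

open scoped ENNReal Uniformity Topology RealInnerProductSpace

/-! ## Increments of the limit process -/

theorem covariance_combination {Ω : Type*} [MeasurableSpace Ω] {P : Measure Ω} [IsFiniteMeasure P]
    {X Y X' Y' : Ω → ℝ} (hX : MemLp X 2 P) (hY : MemLp Y 2 P) (hX' : MemLp X' 2 P)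
    (hY' : MemLp Y' 2 P) (a b a' b' : ℝ) :
    covariance (fun ω => a * X ω + b * Y ω) (fun ω => a' * X' ω + b' * Y' ω) P =
      a * a' * covariance X X' P + a * b' * covariance X Y' P + b * a' * covariance Y X' P +
        b * b' * covariance Y Y' P := by
  have h1 : MemLp (fun ω => a * X ω) 2 P := hX.const_mul a
  have h2 : MemLp (fun ω => b * Y ω) 2 P := hY.const_mul b
  have h3 : MemLp (fun ω => a' * X' ω) 2 P := hX'.const_mul a'
  have h4 : MemLp (fun ω => b' * Y' ω) 2 P := hY'.const_mul b'
  have h5 := covariance_add_left (μ := P) h1 h2 (h3.add h4)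
  have h6 := covariance_add_right (μ := P) h1 h3 h4
  have h7 := covariance_add_right (μ := P) h2 h3 h4
  rw [h6, h7] at h5
  simp only [covariance_const_mul_left, covariance_const_mul_right] at h5
  refine Eq.trans ?_ (h5.trans ?_)
  · rfl
  · ring

namespace IsCorrelatedBrownian

variable {Ω : Type*} [MeasurableSpace Ω] {P : Measure Ω} [IsProbabilityMeasure P] {α : ℝ}
  {Z : Ω → C(ℝ, ℝ × ℝ)} (hZ : IsCorrelatedBrownian α Z P)
include hZ

omit [IsProbabilityMeasure P] in
theorem memLp_fst (t : ℝ) : MemLp (fun ω => (Z ω t).1) 2 P :=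
  ((hZ.gaussian.hasGaussianLaw_eval t).map_fun (ContinuousLinearMap.fst ℝ ℝ ℝ)).memLp_two

omit [IsProbabilityMeasure P] in
theorem memLp_snd (t : ℝ) : MemLp (fun ω => (Z ω t).2) 2 P :=
  ((hZ.gaussian.hasGaussianLaw_eval t).map_fun (ContinuousLinearMap.snd ℝ ℝ ℝ)).memLp_two

omit [IsProbabilityMeasure P] in
theorem aemeasurable : AEMeasurable Z P :=
  aemeasurable_path fun t => hZ.gaussian.aemeasurable t

theorem ae_zero : ∀ᵐ ω ∂P, Z ω 0 = 0 := by
  have h1 : Var[fun ω => (Z ω 0).1; P] = 0 := by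
    rw [← covariance_self (hZ.memLp_fst 0).aemeasurable, hZ.cov_fst]; simp
  have h2 : Var[fun ω => (Z ω 0).2; P] = 0 := by
    rw [← covariance_self (hZ.memLp_snd 0).aemeasurable, hZ.cov_snd]; simp
  filter_upwards [ae_eq_integral_of_variance_eq_zero (hZ.memLp_fst 0) h1,
    ae_eq_integral_of_variance_eq_zero (hZ.memLp_snd 0) h2] with ω e1 e2
  rw [hZ.mean_fst] at e1
  rw [hZ.mean_snd] at e2
  exact Prod.ext e1 e2

/-- Increments over disjoint cells of a grid are uncorrelated. -/
theorem covariance_increments {k : ℝ} (hk : 0 < k) (a b a' b' : ℝ) (i j : ℤ) :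
    covariance (fun ω => a * ((Z ω ((i + 1) / k)).1 - (Z ω (i / k)).1) +
        b * ((Z ω ((i + 1) / k)).2 - (Z ω (i / k)).2))
      (fun ω => a' * ((Z ω ((j + 1) / k)).1 - (Z ω (j / k)).1) +
        b' * ((Z ω ((j + 1) / k)).2 - (Z ω (j / k)).2)) P =
      if i = j then α / k * (a * a' - (a * b' + b * a') / 2 + b * b') else 0 := by
  have hf := hZ.memLp_fst
  have hs := hZ.memLp_snd
  have hsf : ∀ s t : ℝ, covariance (fun ω => (Z ω s).2) (fun ω => (Z ω t).1) P
      = -(α / 2) * ((|s| + |t| - |s - t|) / 2) := fun s t => by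
    rw [covariance_comm, hZ.cov_fst_snd, abs_sub_comm]; ring
  have hf' : ∀ s t : ℝ, MemLp (fun ω => (Z ω s).1 - (Z ω t).1) 2 P := fun s t => (hf s).sub (hf t)
  have hs' : ∀ s t : ℝ, MemLp (fun ω => (Z ω s).2 - (Z ω t).2) 2 P := fun s t => (hs s).sub (hs t)
  rw [covariance_combination (hf' _ _) (hs' _ _) (hf' _ _) (hs' _ _), covariance_fun_sub_fun_sub (hf _) (hf _) (hf _) (hf _),
    covariance_fun_sub_fun_sub (hf _) (hf _) (hs _) (hs _),
    covariance_fun_sub_fun_sub (hs _) (hs _) (hf _) (hf _),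
    covariance_fun_sub_fun_sub (hs _) (hs _) (hs _) (hs _)]
  simp only [hZ.cov_fst, hZ.cov_snd, hZ.cov_fst_snd, hsf]
  -- A mixed second difference of the absolute value: off the diagonal all arguments have the same
  -- sign and it vanishes.
  have key : |((i : ℝ) + 1) / k - (j + 1) / k| - |((i : ℝ) + 1) / k - j / k|
      - |(i : ℝ) / k - (j + 1) / k| + |(i : ℝ) / k - j / k| = if i = j then -2 / k else 0 := by
    simp only [← sub_div, abs_div, abs_of_pos hk]
    split_ifs with h
    · subst h
      simp; ring
    · rw [← add_div]
      refine div_eq_zero_iff.2 (Or.inl ?_)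
      rcases lt_or_gt_of_ne h with h | h
      · have h' : (i : ℝ) + 1 ≤ j := by exact_mod_cast h
        rw [abs_of_nonpos, abs_of_nonpos, abs_of_nonpos, abs_of_nonpos] <;> linarith
      · have h' : (j : ℝ) + 1 ≤ i := by exact_mod_cast h
        rw [abs_of_nonneg, abs_of_nonneg, abs_of_nonneg, abs_of_nonneg] <;> linarith
  split_ifs at key ⊢
  · have h4 : |((i : ℝ) + 1) / k - (j + 1) / k| = |((i : ℝ) + 1) / k - j / k|
      + |(i : ℝ) / k - (j + 1) / k| - |(i : ℝ) / k - j / k| - 2 / k := by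
      rw [neg_div] at key; linarith
    rw [h4]
    ring
  · have h4 : |((i : ℝ) + 1) / k - (j + 1) / k| = |((i : ℝ) + 1) / k - j / k|
      + |(i : ℝ) / k - (j + 1) / k| - |(i : ℝ) / k - j / k| := by linarith
    rw [h4]
    ring

end IsCorrelatedBrownian

/-- A family of vectors in the plane as one vector. -/
noncomputable def flatten {N : ℕ} (D : Fin N → ℝ × ℝ) : EuclideanSpace ℝ (Fin N × Fin 2) :=
  WithLp.toLp 2 fun p => ![(D p.1).1, (D p.1).2] p.2

theorem continuous_flatten {N : ℕ} : Continuous (flatten (N := N)) := by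
  refine (PiLp.continuous_toLp 2 _).comp (continuous_pi fun p => ?_)
  obtain ⟨i, a⟩ := p
  fin_cases a
  · exact (continuous_apply i).fst
  · exact (continuous_apply i).snd

theorem inner_flatten {N : ℕ} (D : Fin N → ℝ × ℝ) (t : EuclideanSpace ℝ (Fin N × Fin 2)) :
    ⟪flatten D, t⟫ = ∑ i, (t (i, 0) * (D i).1 + t (i, 1) * (D i).2) := by
  rw [PiLp.inner_apply, Fintype.sum_prod_type]
  simp [flatten, Fin.sum_univ_two]

namespace IsCorrelatedBrownian

variable {Ω : Type*} [MeasurableSpace Ω] {P : Measure Ω} [IsProbabilityMeasure P] {α : ℝ}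
  {Z : Ω → C(ℝ, ℝ × ℝ)} (hZ : IsCorrelatedBrownian α Z P)
include hZ

omit [IsProbabilityMeasure P] in
theorem hasGaussianLaw_combination {k : ℝ} {N : ℕ} (K : ℤ) (t : EuclideanSpace ℝ (Fin N × Fin 2)) :
    HasGaussianLaw (fun ω => ∑ i : Fin N,
      (t (i, 0) * ((Z ω ((((i : ℤ) - K : ℤ) + 1) / k)).1 - (Z ω (((i : ℤ) - K : ℤ) / k)).1) +
      t (i, 1) * ((Z ω ((((i : ℤ) - K : ℤ) + 1) / k)).2 - (Z ω (((i : ℤ) - K : ℤ) / k)).2))) P := by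
  classical
  set I : Finset ℝ := (Finset.univ.image fun i : Fin N => (((i : ℤ) - K : ℤ) : ℝ) / k) ∪
    Finset.univ.image fun i : Fin N => ((((i : ℤ) - K : ℤ) : ℝ) + 1) / k with hI
  have m1 : ∀ i : Fin N, (((i : ℤ) - K : ℤ) : ℝ) / k ∈ I := fun i =>
    Finset.mem_union_left _ (Finset.mem_image_of_mem _ (Finset.mem_univ i))
  have m2 : ∀ i : Fin N, ((((i : ℤ) - K : ℤ) : ℝ) + 1) / k ∈ I := fun i =>
    Finset.mem_union_right _ (Finset.mem_image_of_mem
      (fun i : Fin N => ((((i : ℤ) - K : ℤ) : ℝ) + 1) / k) (Finset.mem_univ i))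
  let pr : I → ((I → ℝ × ℝ) →L[ℝ] ℝ × ℝ) := fun s => ContinuousLinearMap.proj s
  let L : (I → ℝ × ℝ) →L[ℝ] ℝ := ∑ i : Fin N,
    (t (i, 0) • (ContinuousLinearMap.fst ℝ ℝ ℝ).comp (pr ⟨_, m2 i⟩ - pr ⟨_, m1 i⟩) +
      t (i, 1) • (ContinuousLinearMap.snd ℝ ℝ ℝ).comp (pr ⟨_, m2 i⟩ - pr ⟨_, m1 i⟩))
  have h := (hZ.gaussian.hasGaussianLaw I).map_fun L
  refine (congrArg (fun f : Ω → ℝ => HasGaussianLaw f P) (funext fun ω => ?_)).mp h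
  simp [L, pr]

/-- A linear combination of the increments is a centred Gaussian variable. Distinct cells are
uncorrelated, so its variance is a sum over the cells and the characteristic function factorizes. -/
theorem integral_exp_combination {k : ℝ} (hk : 0 < k) {N : ℕ} (K : ℤ)
    (t : EuclideanSpace ℝ (Fin N × Fin 2)) :
    ∫ ω, Complex.exp (((∑ i : Fin N,
      (t (i, 0) * ((Z ω ((((i : ℤ) - K : ℤ) + 1) / k)).1 - (Z ω (((i : ℤ) - K : ℤ) / k)).1) +
      t (i, 1) * ((Z ω ((((i : ℤ) - K : ℤ) + 1) / k)).2 - (Z ω (((i : ℤ) - K : ℤ) / k)).2)) : ℝ) : ℂ)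
        * Complex.I) ∂P =
      ∏ i : Fin N, (Real.exp (-(α / k * (t (i, 0) ^ 2 - t (i, 0) * t (i, 1) + t (i, 1) ^ 2)) / 2)
        : ℂ) := by
  have hG := hZ.hasGaussianLaw_combination (k := k) K t
  set U : Fin N → Ω → ℝ := fun i ω =>
      t (i, 0) * ((Z ω ((((i : ℤ) - K : ℤ) + 1) / k)).1 - (Z ω (((i : ℤ) - K : ℤ) / k)).1) +
      t (i, 1) * ((Z ω ((((i : ℤ) - K : ℤ) + 1) / k)).2 - (Z ω (((i : ℤ) - K : ℤ) / k)).2) with hU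
  have hm : ∀ i, MemLp (U i) 2 P := fun i =>
    (((hZ.memLp_fst _).sub (hZ.memLp_fst _)).const_mul _).add
      (((hZ.memLp_snd _).sub (hZ.memLp_snd _)).const_mul _)
  have hi1 : ∀ t, Integrable (fun ω => (Z ω t).1) P := fun t =>
    (hZ.memLp_fst t).integrable (by norm_num)
  have hi2 : ∀ t, Integrable (fun ω => (Z ω t).2) P := fun t =>
    (hZ.memLp_snd t).integrable (by norm_num)
  have hmean : ∫ ω, ∑ i, U i ω ∂P = 0 := by
    rw [integral_finsetSum _ fun i _ => (hm i).integrable (by norm_num)]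
    refine Finset.sum_eq_zero fun i _ => ?_
    simp only [hU]
    have hi1' : ∀ a s t : ℝ, Integrable (fun ω => a * ((Z ω s).1 - (Z ω t).1)) P := fun a s t =>
      ((hi1 s).sub (hi1 t)).const_mul a
    have hi2' : ∀ a s t : ℝ, Integrable (fun ω => a * ((Z ω s).2 - (Z ω t).2)) P := fun a s t =>
      ((hi2 s).sub (hi2 t)).const_mul a
    rw [integral_add (hi1' _ _ _) (hi2' _ _ _),
      integral_const_mul, integral_const_mul, integral_sub (hi1 _) (hi1 _),
      integral_sub (hi2 _) (hi2 _), hZ.mean_fst, hZ.mean_fst, hZ.mean_snd, hZ.mean_snd]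
    simp
  have hvar : Var[fun ω => ∑ i, U i ω; P] =
      ∑ i, α / k * (t (i, 0) ^ 2 - t (i, 0) * t (i, 1) + t (i, 1) ^ 2) := by
    rw [← covariance_self hG.aemeasurable, covariance_fun_sum_fun_sum hm hm]
    refine Finset.sum_congr rfl fun i _ => ?_
    have : ∀ j, covariance (U i) (U j) P = if i = j then
        α / k * (t (i, 0) ^ 2 - t (i, 0) * t (i, 1) + t (i, 1) ^ 2) else 0 := fun j => by
      simp only [hU]
      rw [hZ.covariance_increments hk]
      by_cases h : i = j
      · subst h
        simp only [if_true]; ring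
      · rw [if_neg, if_neg h]
        intro h'
        exact h (Fin.ext (by omega))
    simp [this]
  have h1 : ∫ ω, Complex.exp (((∑ i, U i ω : ℝ) : ℂ) * Complex.I) ∂P =
      charFun (P.map fun ω => ∑ i, U i ω) 1 := by
    rw [charFun_apply_real, integral_map hG.aemeasurable (by fun_prop)]
    simp only [Complex.ofReal_one, one_mul, hU]
  rw [h1, hG.map_eq_gaussianReal, charFun_gaussianReal, hmean,
    Real.coe_toNNReal _ (variance_nonneg _ _), hvar]
  rw [← Complex.ofReal_prod, ← Real.exp_sum, Complex.ofReal_exp]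
  congr 1
  push_cast
  simp only [neg_div]
  rw [Finset.sum_neg_distrib, ← Finset.sum_div]
  simp

end IsCorrelatedBrownian

/-! ## Increments of the walk -/

theorem norm_pow_sub_pow_le {w z : ℂ} (hw : ‖w‖ ≤ 1) (hz : ‖z‖ ≤ 1) (n : ℕ) :
    ‖w ^ n - z ^ n‖ ≤ n * ‖w - z‖ := by
  induction n with
  | zero => simp
  | succ n ih =>
    have : w ^ (n + 1) - z ^ (n + 1) = w * (w ^ n - z ^ n) + (w - z) * z ^ n := by ring
    rw [this]
    refine (norm_add_le _ _).trans ?_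
    rw [norm_mul, norm_mul, norm_pow]
    have h1 : ‖w‖ * ‖w ^ n - z ^ n‖ ≤ 1 * (n * ‖w - z‖) := by gcongr
    have h2 : ‖w - z‖ * ‖z‖ ^ n ≤ ‖w - z‖ * 1 := by
      gcongr
      exact pow_le_one₀ (norm_nonneg _) hz
    push_cast
    linarith

/-- The characteristic function of one step. -/
noncomputable def stepChar (g : Fin 3 → ℝ) (c : ℝ) : ℂ :=
  3⁻¹ * ∑ a, Complex.exp ((c * g a : ℝ) * Complex.I)

theorem norm_stepChar_le (g : Fin 3 → ℝ) (c : ℝ) : ‖stepChar g c‖ ≤ 1 := by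
  rw [stepChar, norm_mul]
  have : ‖∑ a, Complex.exp ((c * g a : ℝ) * Complex.I)‖ ≤ 3 := by
    refine (norm_sum_le _ _).trans ?_
    simp only [Complex.norm_exp_ofReal_mul_I]
    simp
  have h3 : ‖(3⁻¹ : ℂ)‖ = 3⁻¹ := by simp
  rw [h3]
  linarith

theorem norm_exp_sub_taylor_le {θ : ℝ} (hθ : |θ| ≤ 1) :
    ‖Complex.exp (θ * Complex.I) - (1 + θ * Complex.I - θ ^ 2 / 2)‖ ≤ |θ| ^ 3 := by
  have hn : ‖(θ : ℂ) * Complex.I‖ = |θ| := by simp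
  have h := Complex.exp_bound (x := θ * Complex.I) (by rw [hn]; exact hθ) (n := 3) (by norm_num)
  rw [hn] at h
  have e : ∑ m ∈ Finset.range 3, ((θ : ℂ) * Complex.I) ^ m / (m.factorial : ℂ) =
      1 + θ * Complex.I - θ ^ 2 / 2 := by
    simp [Finset.sum_range_succ, Nat.factorial, mul_pow]
    ring
  rw [e] at h
  refine h.trans ?_
  have h3 : (((3 : ℕ).succ : ℝ) * (((Nat.factorial 3 : ℕ) : ℝ) * (3 : ℕ))⁻¹) ≤ 1 := by
    norm_num [Nat.factorial]
  exact mul_le_of_le_one_right (by positivity) h3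

/-- Both quantities are within `(|c| * G) ^ 3` of `1 - c ^ 2 * v / 2`, where `v` is the variance of
a step: on one side by Taylor expansion to second order, the linear terms cancelling, on the other
side since `exp (-x)` is within `x ^ 2` of `1 - x`. -/
theorem norm_stepChar_sub_le {g : Fin 3 → ℝ} (hg : ∑ a, g a = 0) {G c : ℝ} (hG : ∀ a, |g a| ≤ G)
    (hc : |c| * G ≤ 1) :
    ‖stepChar g c - Real.exp (-(c ^ 2 * (3⁻¹ * ∑ a, g a ^ 2) / 2))‖ ≤ 2 * (|c| * G) ^ 3 := by
  set v : ℝ := 3⁻¹ * ∑ a, g a ^ 2 with hv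
  have hG0 : 0 ≤ G := (abs_nonneg _).trans (hG 0)
  have hcg : ∀ a, |c * g a| ≤ |c| * G := fun a => by
    rw [abs_mul]; gcongr; exact hG a
  have h1 : ‖stepChar g c - (1 - c ^ 2 * v / 2 : ℝ)‖ ≤ (|c| * G) ^ 3 := by
    have e : stepChar g c - (1 - c ^ 2 * v / 2 : ℝ) = 3⁻¹ * ∑ a, (Complex.exp ((c * g a : ℝ) *
        Complex.I) - (1 + (c * g a : ℝ) * Complex.I - (c * g a : ℝ) ^ 2 / 2)) := by
      have hg' : (g 0 : ℂ) + g 1 + g 2 = 0 := by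
        rw [Fin.sum_univ_three] at hg
        exact_mod_cast hg
      rw [stepChar, hv]
      simp only [Fin.sum_univ_three]
      push_cast
      have : (g 2 : ℂ) = -(g 0 + g 1) := by linear_combination hg'
      rw [this]
      ring
    rw [e, norm_mul]
    have h3 : ‖(3⁻¹ : ℂ)‖ = 3⁻¹ := by simp
    have h4 : ‖∑ a, (Complex.exp ((c * g a : ℝ) * Complex.I) -
        (1 + (c * g a : ℝ) * Complex.I - (c * g a : ℝ) ^ 2 / 2))‖ ≤ ∑ _a : Fin 3, (|c| * G) ^ 3 := by
      refine (norm_sum_le _ _).trans (Finset.sum_le_sum fun a _ => ?_)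
      refine (norm_exp_sub_taylor_le ((hcg a).trans hc)).trans ?_
      gcongr
      exact hcg a
    rw [h3]
    simp only [Finset.sum_const, Finset.card_univ, Fintype.card_fin, nsmul_eq_mul] at h4
    rw [Nat.cast_ofNat] at h4
    linarith
  have hv0 : 0 ≤ v := by positivity
  have hvG : v ≤ G ^ 2 := by
    have h2 : ∀ a, g a ^ 2 ≤ G ^ 2 := fun a => by
      rw [← sq_abs]; gcongr; exact hG a
    rw [hv, Fin.sum_univ_three]
    linarith [h2 0, h2 1, h2 2]
  have hcG : 0 ≤ |c| * G := by positivity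
  have hx : c ^ 2 * v / 2 ≤ (|c| * G) ^ 2 / 2 := by
    rw [mul_pow, sq_abs]; gcongr
  have hx1 : (|c| * G) ^ 2 ≤ 1 := pow_le_one₀ hcG hc
  have hx0 : 0 ≤ c ^ 2 * v / 2 := by positivity
  have h2 : ‖((1 - c ^ 2 * v / 2 : ℝ) : ℂ) - Real.exp (-(c ^ 2 * v / 2))‖ ≤ (|c| * G) ^ 3 := by
    rw [← Complex.ofReal_sub, Complex.norm_real, Real.norm_eq_abs, abs_sub_comm]
    have h3 := Real.abs_exp_sub_one_sub_id_le (x := -(c ^ 2 * v / 2))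
      (by rw [abs_neg, abs_of_nonneg hx0]; linarith)
    calc |Real.exp (-(c ^ 2 * v / 2)) - (1 - c ^ 2 * v / 2)|
        = |Real.exp (-(c ^ 2 * v / 2)) - 1 - -(c ^ 2 * v / 2)| := by congr 1; ring
      _ ≤ (-(c ^ 2 * v / 2)) ^ 2 := h3
      _ = (c ^ 2 * v / 2) ^ 2 := by ring
      _ ≤ ((|c| * G) ^ 2 / 2) ^ 2 := by gcongr
      _ ≤ (|c| * G) ^ 3 := by
        have : 0 ≤ (|c| * G) ^ 3 := by positivity
        nlinarith
  calc _ ≤ ‖stepChar g c - (1 - c ^ 2 * v / 2 : ℝ)‖ +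
        ‖((1 - c ^ 2 * v / 2 : ℝ) : ℂ) - Real.exp (-(c ^ 2 * v / 2))‖ := norm_sub_le_norm_sub_add_norm_sub _ _ _
    _ ≤ _ := by linarith

/-- The `n`-th powers of two numbers in the unit disc differ by at most `n` times their distance.
This is of order `n * |c| ^ 3`, which is `n * c ^ 2`, a convergent quantity, times `|c|`. -/
theorem tendsto_stepChar_pow {g : Fin 3 → ℝ} (hg : ∑ a, g a = 0) {c : ℕ → ℝ} {n : ℕ → ℕ} {s : ℝ}
    (hc : Tendsto c atTop (𝓝 0)) (hn : Tendsto (fun m => n m * c m ^ 2) atTop (𝓝 s)) :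
    Tendsto (fun m => stepChar g (c m) ^ n m) atTop
      (𝓝 (Real.exp (-(s * (3⁻¹ * ∑ a, g a ^ 2) / 2)) : ℂ)) := by
  set v : ℝ := 3⁻¹ * ∑ a, g a ^ 2 with hv
  have hv0 : 0 ≤ v := by positivity
  set G : ℝ := ∑ a, |g a| with hGdef
  have hG : ∀ a, |g a| ≤ G := fun a =>
    Finset.single_le_sum (f := fun a => |g a|) (fun _ _ => abs_nonneg _) (Finset.mem_univ a)
  have hz : Tendsto (fun m => (Real.exp (-(c m ^ 2 * v / 2)) : ℂ) ^ n m) atTop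
      (𝓝 (Real.exp (-(s * v / 2)) : ℂ)) := by
    have e : ∀ m, (Real.exp (-(c m ^ 2 * v / 2)) : ℂ) ^ n m =
        (Real.exp (-(n m * c m ^ 2 * v / 2)) : ℂ) := fun m => by
      rw [← Complex.ofReal_pow, ← Real.exp_nat_mul]
      congr 2; ring
    simp only [e]
    refine (Complex.continuous_ofReal.tendsto _).comp ((Real.continuous_exp.tendsto _).comp ?_)
    exact ((hn.mul_const v).div_const 2).neg
  refine hz.congr_dist ?_
  have hlim : Tendsto (fun m => 2 * G ^ 3 * (n m * c m ^ 2) * |c m|) atTop (𝓝 0) := by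
    have := (hn.const_mul (2 * G ^ 3)).mul hc.abs
    simpa using this
  refine squeeze_zero' (Eventually.of_forall fun _ => dist_nonneg) ?_ hlim
  have hsmall : ∀ᶠ m in atTop, |c m| * G ≤ 1 := by
    have : Tendsto (fun m => |c m| * G) atTop (𝓝 0) := by simpa using hc.abs.mul_const G
    exact this.eventually_le_const one_pos
  filter_upwards [hsmall] with m hm
  rw [dist_comm, dist_eq_norm]
  refine (norm_pow_sub_pow_le (norm_stepChar_le g _) ?_ _).trans ?_
  · rw [Complex.norm_real, Real.norm_eq_abs, Real.abs_exp]
    exact Real.exp_le_one_iff.2 (neg_nonpos.2 (by positivity))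
  · calc (n m : ℝ) * ‖stepChar g (c m) - Real.exp (-(c m ^ 2 * v / 2))‖
        ≤ n m * (2 * (|c m| * G) ^ 3) := by
          gcongr
          exact norm_stepChar_sub_le hg hG hm
      _ = 2 * G ^ 3 * (n m * c m ^ 2) * |c m| := by
          rw [← sq_abs (c m)]; ring

theorem integral_prod_letters {ι : Type*} [Fintype ι] (f : ι → Fin 3 → ℂ) :
    ∫ y, ∏ i, f i (y i) ∂letterLaw ι = ∏ i, (3⁻¹ * ∑ a, f i a) := by
  rw [letterLaw, Measure.infinitePi_eq_pi, integral_fintype_prod_eq_prod]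
  refine Finset.prod_congr rfl fun i _ => ?_
  rw [integral_fintype .of_finite, Finset.mul_sum]
  refine Finset.sum_congr rfl fun a _ => ?_
  simp [measureReal_def, uniformOn_univ_singleton]


/-- The increments of a sequence over the `2 k ^ 2` cells around the origin. -/
def gridIncr (k : ℕ) (p : ℤ → ℝ × ℝ) (i : Fin (2 * k ^ 2)) : ℝ × ℝ :=
  p ((i : ℤ) - (k ^ 2 : ℕ) + 1) - p ((i : ℤ) - (k ^ 2 : ℕ))

/-- The rescaled walk at the points of a grid. -/
noncomputable def walkGrid (α : ℝ) (k m : ℕ) (x : ℤ → ℤ × ℤ) (j : ℤ) : ℝ × ℝ :=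
  (Real.sqrt (3 * α / 2) * (Real.sqrt m)⁻¹) • planePoint x (j * (m / k : ℕ))

theorem tendsto_natDiv_div (k : ℕ) :
    Tendsto (fun m : ℕ => ((m / k : ℕ) : ℝ) / m) atTop (𝓝 (k : ℝ)⁻¹) := by
  have h := (tendsto_nat_floor_mul_div_atTop (R := ℝ) (a := (k : ℝ)⁻¹) (by positivity)).comp
    tendsto_natCast_atTop_atTop
  refine h.congr fun m => ?_
  simp only [Function.comp]
  rw [inv_mul_eq_div, Nat.floor_div_eq_div]

theorem tendsto_natDiv_mul_sq {α : ℝ} (hα : 0 < α) (k : ℕ) :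
    Tendsto (fun m : ℕ => ((m / k : ℕ) : ℝ) * (Real.sqrt (3 * α / 2) * (Real.sqrt m)⁻¹) ^ 2) atTop
      (𝓝 (3 * α / 2 / k)) := by
  have h := (tendsto_natDiv_div k).const_mul (3 * α / 2)
  rw [← div_eq_mul_inv] at h
  refine h.congr fun m => ?_
  rw [mul_pow, Real.sq_sqrt (by positivity), inv_pow, Real.sq_sqrt (by positivity)]
  ring

theorem tendsto_scale (α : ℝ) :
    Tendsto (fun m : ℕ => Real.sqrt (3 * α / 2) * (Real.sqrt m)⁻¹) atTop (𝓝 0) := by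
  have h : Tendsto (fun m : ℕ => (Real.sqrt m)⁻¹) atTop (𝓝 0) :=
    tendsto_inv_atTop_zero.comp (Real.tendsto_sqrt_atTop.comp tendsto_natCast_atTop_atTop)
  simpa using h.const_mul (Real.sqrt (3 * α / 2))

/-- The letters of a cell contribute these values to a linear combination of the increments. -/
noncomputable def stepValue {N : ℕ} (t : EuclideanSpace ℝ (Fin N × Fin 2)) (i : Fin N) (a : Fin 3) :
    ℝ := t (i, 0) * ((westStep a).1 : ℝ) + t (i, 1) * ((westStep a).2 : ℝ)

/-- Pairs of a cell and a position in it are enumerated consecutively, starting with the first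
letter after the left end `-(k ^ 2) * (m / k)` of the grid. All these letters are distinct and hence
independent. -/
theorem inner_flatten_walkGrid (α : ℝ) (k m : ℕ) (y : ℤ → Fin 3)
    (t : EuclideanSpace ℝ (Fin (2 * k ^ 2) × Fin 2)) :
    ⟪flatten (gridIncr k (walkGrid α k m (westWalk y))), t⟫ =
      ∑ p : Fin (2 * k ^ 2) × Fin (m / k), Real.sqrt (3 * α / 2) * (Real.sqrt m)⁻¹ *
        stepValue t p.1 (y (finProdFinEquiv p + (1 - (k ^ 2 : ℕ) * (m / k : ℕ)))) := by
  rw [inner_flatten, Fintype.sum_prod_type]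
  refine Finset.sum_congr rfl fun i _ => ?_
  set c : ℝ := Real.sqrt (3 * α / 2) * (Real.sqrt m)⁻¹
  set q : ℕ := m / k
  set b : ℤ := ((i : ℤ) - (k ^ 2 : ℕ)) * q with hb
  have h := sum_westStep y b q
  have e1 : (i - (k ^ 2 : ℕ) + 1 : ℤ) * (q : ℤ) = b + q := by rw [hb]; ring
  have hc : ∀ j : Fin q, ((finProdFinEquiv (i, j) : ℕ) : ℤ) + (1 - (k ^ 2 : ℕ) * (q : ℤ)) =
      b + 1 + (j : ℕ) := fun j => by
    simp only [finProdFinEquiv_apply_val, hb]; push_cast; ring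
  simp only [hc]
  have h1 : (∑ j : Fin q, ((westStep (y (b + 1 + (j : ℕ)))).1 : ℝ)) =
      (westWalk y (b + q)).1 - (westWalk y b).1 := by
    have := congrArg Prod.fst h
    rw [Prod.fst_sum, Finset.sum_range] at this
    rw [← Int.cast_sum, ← this]; simp
  have h2 : (∑ j : Fin q, ((westStep (y (b + 1 + (j : ℕ)))).2 : ℝ)) =
      (westWalk y (b + q)).2 - (westWalk y b).2 := by
    have := congrArg Prod.snd h
    rw [Prod.snd_sum, Finset.sum_range] at this
    rw [← Int.cast_sum, ← this]; simp
  simp only [stepValue, mul_add, Finset.sum_add_distrib, ← mul_assoc, ← Finset.mul_sum]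
  rw [h1, h2]
  simp only [gridIncr, walkGrid, Prod.fst_sub, Prod.snd_sub, Prod.smul_fst, Prod.smul_snd,
    planePoint, smul_eq_mul]
  rw [e1]
  ring

theorem integral_exp_walkGrid (α : ℝ) (k m : ℕ) (t : EuclideanSpace ℝ (Fin (2 * k ^ 2) × Fin 2)) :
    ∫ y, Complex.exp ((⟪flatten (gridIncr k (walkGrid α k m (westWalk y))), t⟫ : ℝ) * Complex.I)
        ∂letterLaw ℤ =
      ∏ i, stepChar (stepValue t i) (Real.sqrt (3 * α / 2) * (Real.sqrt m)⁻¹) ^ (m / k) := by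
  set c : ℝ := Real.sqrt (3 * α / 2) * (Real.sqrt m)⁻¹ with hc
  have hφ : Function.Injective fun p : Fin (2 * k ^ 2) × Fin (m / k) =>
      ((finProdFinEquiv p : ℕ) : ℤ) + (1 - (k ^ 2 : ℕ) * (m / k : ℕ)) := fun p p' h => by
    have h' : ((finProdFinEquiv p : ℕ) : ℤ) = (finProdFinEquiv p' : ℕ) := add_right_cancel h
    exact finProdFinEquiv.injective (Fin.ext (by exact_mod_cast h'))
  set f : Fin (2 * k ^ 2) × Fin (m / k) → Fin 3 → ℂ := fun p a =>
    Complex.exp ((c * stepValue t p.1 a : ℝ) * Complex.I) with hf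
  have h := integral_prod_letters f
  rw [← map_letterLaw hφ (Equiv.refl _), integral_map] at h
  · have e : ∀ y : ℤ → Fin 3, Complex.exp ((⟪flatten (gridIncr k (walkGrid α k m (westWalk y))), t⟫ :
        ℝ) * Complex.I) = ∏ p : Fin (2 * k ^ 2) × Fin (m / k), f p (Equiv.refl _
          (y (((finProdFinEquiv p : ℕ) : ℤ) + (1 - (k ^ 2 : ℕ) * (m / k : ℕ))))) := fun y => by
      rw [inner_flatten_walkGrid, Complex.ofReal_sum, Finset.sum_mul, Complex.exp_sum]
      rfl
    simp only [e]
    rw [h, Fintype.prod_prod_type]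
    refine Finset.prod_congr rfl fun i _ => ?_
    simp [hf, stepChar]
  · exact (measurable_pi_lambda _ fun p =>
      (measurable_of_countable _).comp (measurable_pi_apply _)).aemeasurable
  · refine Measurable.aestronglyMeasurable ?_
    exact Finset.measurable_prod _ fun p _ =>
      (measurable_of_countable (f p)).comp (measurable_pi_apply p)

theorem measurable_westWalk (n : ℤ) : Measurable fun y : ℤ → Fin 3 => westWalk y n := by
  have h : ∀ i : ℤ, Measurable fun y : ℤ → Fin 3 => westStep (y i) := fun i =>
    (measurable_of_countable westStep).comp (measurable_pi_apply i)
  rcases n with n | n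
  · exact Finset.measurable_sum (Finset.range n) fun i _ => h (i + 1)
  · exact (Finset.measurable_sum (Finset.range (n + 1)) fun i _ => h (-i)).neg

theorem measurable_planePoint (n : ℤ) : Measurable fun y : ℤ → Fin 3 => planePoint (westWalk y) n :=
  (measurable_of_countable (fun p : ℤ × ℤ => (((p.1 : ℝ), (p.2 : ℝ)) : ℝ × ℝ))).comp
    (measurable_westWalk n)

section

variable {Ω' : Type*} [MeasurableSpace Ω'] {P' : Measure Ω'} [IsProbabilityMeasure P'] {α : ℝ}
  {Z : Ω' → C(ℝ, ℝ × ℝ)}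

/-- The increments of the rescaled walk over a grid converge in distribution. -/
theorem tendstoInDistribution_walkGrid (hα : 0 < α) (hZ : IsCorrelatedBrownian α Z P') {k : ℕ}
    (hk : 0 < k) :
    TendstoInDistribution (fun m y => flatten (gridIncr k (walkGrid α k m (westWalk y)))) atTop
      (fun ω => flatten (gridIncr k fun j => Z ω (j / k))) (fun _ => letterLaw ℤ) P' := by
  have hm : ∀ m, AEMeasurable (fun y => flatten (gridIncr k (walkGrid α k m (westWalk y))))
      (letterLaw ℤ) := fun m => by
    refine (continuous_flatten.measurable.comp (measurable_pi_lambda _ fun i => ?_)).aemeasurable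
    have h : ∀ j, Measurable fun y => walkGrid α k m (westWalk y) j := fun j =>
      (measurable_planePoint _).const_smul (Real.sqrt (3 * α / 2) * (Real.sqrt m)⁻¹)
    exact (h _).sub (h _)
  have hm' : AEMeasurable (fun ω => flatten (gridIncr k fun j => Z ω (j / k))) P' := by
    refine continuous_flatten.measurable.comp_aemeasurable (aemeasurable_pi_lambda _ fun i => ?_)
    exact (hZ.gaussian.aemeasurable _).sub (hZ.gaussian.aemeasurable _)
  refine ⟨hm, hm', ?_⟩
  refine ProbabilityMeasure.tendsto_of_tendsto_charFun fun t => ?_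
  simp only [ProbabilityMeasure.coe_mk, charFun_apply]
  rw [integral_map hm' (by fun_prop)]
  have hk' : (0 : ℝ) < k := by exact_mod_cast hk
  have h2 := hZ.integral_exp_combination hk' (k ^ 2 : ℕ) t
  have e2 : ∀ ω, ⟪flatten (gridIncr k fun j => Z ω (j / k)), t⟫ = ∑ i : Fin (2 * k ^ 2),
      (t (i, 0) * ((Z ω ((((i : ℤ) - (k ^ 2 : ℕ) : ℤ) + 1) / k)).1
        - (Z ω (((i : ℤ) - (k ^ 2 : ℕ) : ℤ) / k)).1) +
      t (i, 1) * ((Z ω ((((i : ℤ) - (k ^ 2 : ℕ) : ℤ) + 1) / k)).2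
        - (Z ω (((i : ℤ) - (k ^ 2 : ℕ) : ℤ) / k)).2)) := fun ω => by
    rw [inner_flatten]
    refine Finset.sum_congr rfl fun i _ => ?_
    simp only [gridIncr, Prod.fst_sub, Prod.snd_sub]
    rw [Int.cast_add, Int.cast_one]
  simp only [e2]
  rw [h2]
  have h3 : Tendsto (fun m : ℕ => ∏ i, stepChar (stepValue t i)
      (Real.sqrt (3 * α / 2) * (Real.sqrt m)⁻¹) ^ (m / k)) atTop
      (𝓝 (∏ i, (Real.exp (-(α / k * (t (i, 0) ^ 2 - t (i, 0) * t (i, 1) + t (i, 1) ^ 2)) / 2) : ℂ)))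
      := by
    refine tendsto_finsetProd _ fun i _ => ?_
    have hg : ∑ a, stepValue t i a = 0 := by
      simp [stepValue, Fin.sum_univ_three, westStep]
    -- With coefficients `a`, `b` the values are `a - b`, `b`, `-a`, of variance `(2 / 3) * (a ^ 2 -
    -- a * b + b ^ 2)`; the factor `3 * α / (2 * k)` turns this into the variance of the Brownian
    -- increment.
    have h4 := tendsto_stepChar_pow hg (tendsto_scale α) (tendsto_natDiv_mul_sq hα k)
    convert h4 using 4
    simp [stepValue, Fin.sum_univ_three, westStep]
    ring
  refine h3.congr fun m => ?_
  rw [integral_map (hm m) (by fun_prop)]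
  exact (integral_exp_walkGrid α k m t).symm

end


/-! ## Polygonal paths -/

/-- Truncation to the unit interval. -/
noncomputable def clamp (x : ℝ) : ℝ := max 0 (min 1 x)

theorem continuous_clamp : Continuous clamp := by unfold clamp; fun_prop

theorem clamp_of_one_le {x : ℝ} (h : 1 ≤ x) : clamp x = 1 := by simp [clamp, h]

theorem clamp_of_nonpos {x : ℝ} (h : x ≤ 0) : clamp x = 0 := by
  rw [clamp, max_eq_left ((min_le_right _ _).trans h)]

theorem clamp_of_mem {x : ℝ} (h0 : 0 ≤ x) (h1 : x ≤ 1) : clamp x = x := by simp [clamp, h0, h1]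

/-- Cells before `n` count fully and cells after `n` not at all, so the sum telescopes up to the
fraction of cell `n`. -/
theorem sum_clamp_smul {V : Type*} [AddCommGroup V] [Module ℝ V] (q : ℕ → V) {n N : ℕ} {y : ℝ}
    (hn : n < N) (h1 : (n : ℝ) ≤ y) (h2 : y ≤ n + 1) :
    ∑ i ∈ Finset.range N, clamp (y - i) • (q (i + 1) - q i) =
      q n + (y - n) • (q (n + 1) - q n) - q 0 := by
  induction N, hn using Nat.le_induction with
  | base =>
    rw [Nat.succ_eq_add_one, Finset.sum_range_succ, clamp_of_mem (by linarith) (by linarith)]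
    have : ∀ i ∈ Finset.range n, clamp (y - i) • (q (i + 1) - q i) = q (i + 1) - q i := by
      intro i hi
      have : (i : ℝ) + 1 ≤ n := by exact_mod_cast Finset.mem_range.1 hi
      rw [clamp_of_one_le (by linarith), one_smul]
    rw [Finset.sum_congr rfl this, Finset.sum_range_sub]
    abel
  | succ N hN ih =>
    have : (n : ℝ) + 1 ≤ N := by exact_mod_cast hN
    rw [Finset.sum_range_succ, ih, clamp_of_nonpos (by linarith), zero_smul, add_zero]

/-- The contribution of the increment over a cell to the value of a polygonal path. -/
noncomputable def ramp (k : ℕ) (i : ℕ) : C(ℝ, ℝ) where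
  toFun t := clamp (k * t + (k ^ 2 : ℕ) - i) - clamp ((k ^ 2 : ℕ) - i)
  continuous_toFun := by
    have := continuous_clamp
    fun_prop

/-- The polygonal path through the origin at time `0` with given increments over a grid. -/
noncomputable def polygon (k : ℕ) (u : EuclideanSpace ℝ (Fin (2 * k ^ 2) × Fin 2)) :
    C(ℝ, ℝ × ℝ) :=
  ∑ i : Fin (2 * k ^ 2), (u (i, 0) • (ramp k i).prodMk 0 + u (i, 1) • (0 : C(ℝ, ℝ)).prodMk (ramp k i))

theorem continuous_polygon (k : ℕ) : Continuous (polygon k) := by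
  unfold polygon
  fun_prop

theorem polygon_apply (k : ℕ) (D : Fin (2 * k ^ 2) → ℝ × ℝ) (t : ℝ) :
    polygon k (flatten D) t = ∑ i : Fin (2 * k ^ 2), ramp k i t • D i := by
  rw [polygon, ContinuousMap.sum_apply]
  refine Finset.sum_congr rfl fun i _ => ?_
  ext <;> simp [flatten, mul_comm]

theorem polygon_gridIncr {k : ℕ} (hk : 0 < k) {p : ℤ → ℝ × ℝ} (hp : p 0 = 0) {t : ℝ} {j : ℤ}
    (hj : ⌊k * t⌋ = j) (h1 : -(k ^ 2 : ℕ) ≤ j) (h2 : j < (k ^ 2 : ℕ)) :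
    polygon k (flatten (gridIncr k p)) t = p j + Int.fract (k * t) • (p (j + 1) - p j) := by
  set q : ℕ → ℝ × ℝ := fun i => p ((i : ℤ) - (k ^ 2 : ℕ)) with hq
  have hg : ∀ i : Fin (2 * k ^ 2), gridIncr k p i = q (i + 1) - q i := fun i => by
    simp only [gridIncr, hq]
    congr 2
    push_cast; ring
  rw [polygon_apply]
  simp only [ramp, ContinuousMap.coe_mk, sub_smul, Finset.sum_sub_distrib, hg]
  rw [Fin.sum_univ_eq_sum_range fun i => clamp (k * t + (k ^ 2 : ℕ) - i) • (q (i + 1) - q i),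
    Fin.sum_univ_eq_sum_range fun i => clamp ((k ^ 2 : ℕ) - i) • (q (i + 1) - q i)]
  have hk2 : 0 < k ^ 2 := by positivity
  -- The terms subtracted in `ramp` add up to the value at time 0, which is the left end of the cell
  -- with index `k ^ 2`.
  rw [sum_clamp_smul q (n := k ^ 2) (by omega) le_rfl (by linarith)]
  obtain ⟨n, hn⟩ : ∃ n : ℕ, (n : ℤ) = j + (k ^ 2 : ℕ) := ⟨(j + (k ^ 2 : ℕ)).toNat, by omega⟩
  have hnr : (n : ℝ) = j + (k ^ 2 : ℕ) := by exact_mod_cast hn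
  have hf := Int.floor_le (k * t)
  have hf' := Int.lt_floor_add_one (k * t)
  rw [hj] at hf hf'
  rw [sum_clamp_smul q (n := n) (by omega) (by linarith) (by linarith)]
  have e1 : q n = p j := by simp only [hq]; congr 1; omega
  have e2 : q (n + 1) = p (j + 1) := by simp only [hq]; congr 1; rw [Nat.cast_add, Nat.cast_one]; omega
  have e3 : q (k ^ 2) = 0 := by simp only [hq]; rw [sub_self, hp]
  have e4 : k * t + (k ^ 2 : ℕ) - n = Int.fract (k * t) := by rw [Int.fract, hj, hnr]; ring
  rw [e1, e2, e3, e4, sub_self, zero_smul]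
  abel

theorem polygon_mem {k : ℕ} (hk : 0 < k) {p : ℤ → ℝ × ℝ} (hp : p 0 = 0) {t : ℝ} {j : ℤ}
    (hj : ⌊k * t⌋ = j) (h1 : -(k ^ 2 : ℕ) ≤ j) (h2 : j < (k ^ 2 : ℕ)) {s : Set (ℝ × ℝ)}
    (hs : Convex ℝ s) (hm : p j ∈ s) (hm' : p (j + 1) ∈ s) :
    polygon k (flatten (gridIncr k p)) t ∈ s := by
  rw [polygon_gridIncr hk hp hj h1 h2]
  exact hs.add_smul_sub_mem hm hm' ⟨Int.fract_nonneg _, (Int.fract_lt_one _).le⟩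

theorem floor_mul_bounds {k T : ℕ} (hk : T < k) {t : ℝ} (ht : |t| ≤ T) :
    |⌊k * t⌋| ≤ k * T + 1 ∧ -(k ^ 2 : ℕ) ≤ ⌊k * t⌋ ∧ ⌊k * t⌋ < (k ^ 2 : ℕ) := by
  obtain ⟨h1, h2⟩ := abs_le.1 ht
  have hk0 : (0 : ℝ) ≤ k := by positivity
  have h3 : -(k * T : ℝ) ≤ k * t := by nlinarith
  have h4 : (k * t : ℝ) ≤ k * T := by nlinarith
  have h5 : -(k * T : ℤ) ≤ ⌊k * t⌋ := Int.le_floor.2 (by push_cast; exact h3)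
  have h6 : ⌊k * t⌋ ≤ (k * T : ℤ) := by
    have := (Int.floor_le (k * t)).trans h4
    exact_mod_cast this
  have h7 : (k * T : ℤ) < (k ^ 2 : ℕ) := by
    rw [pow_two]; push_cast
    have : (T : ℤ) < k := by exact_mod_cast hk
    have : (0 : ℤ) < k := by omega
    gcongr
  refine ⟨abs_le.2 ⟨by linarith, by linarith⟩, by linarith, by linarith⟩

/-- Polygonal approximations of a path converge to the path. -/
theorem tendsto_polygon {f : C(ℝ, ℝ × ℝ)} (hf : f 0 = 0) :
    Tendsto (fun k : ℕ => polygon (k + 1) (flatten (gridIncr (k + 1) fun j => f (j / (k + 1 : ℕ)))))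
      atTop (𝓝 f) := by
  refine tendsto_path_of_forall_close fun T η hη => ?_
  have huc : UniformContinuousOn f (Set.Icc (-(T : ℝ) - 1) (T + 1)) :=
    isCompact_Icc.uniformContinuousOn_of_continuous f.continuous.continuousOn
  obtain ⟨δ, hδ, h⟩ := Metric.uniformContinuousOn_iff.1 huc η hη
  obtain ⟨K, hK⟩ := exists_nat_gt (1 / δ)
  filter_upwards [eventually_ge_atTop (K + T + 1)] with k hk t ht
  set κ := k + 1 with hκ
  have hκ0 : (0 : ℝ) < κ := by positivity
  have hκ1 : (1 : ℝ) ≤ κ := by rw [hκ]; push_cast; linarith [Nat.cast_nonneg (α := ℝ) k]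
  have hκd : 1 / (κ : ℝ) < δ := by
    have : (K : ℝ) ≤ κ := by exact_mod_cast (by omega : K ≤ κ)
    rw [div_lt_comm₀ hκ0 hδ]; linarith
  have hκ2 : 1 / (κ : ℝ) ≤ 1 := by rw [div_le_one hκ0]; exact hκ1
  obtain ⟨-, b1, b2⟩ := floor_mul_bounds (k := κ) (by omega) ht
  obtain ⟨t1, t2⟩ := abs_le.1 ht
  have f1 := Int.floor_le (κ * t)
  have f2 := Int.lt_floor_add_one (κ * t)
  have close : ∀ j : ℤ, |(j : ℝ) - κ * t| ≤ 1 → f (j / κ) ∈ Metric.closedBall (f t) η := by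
    intro j hj
    have e : |(j : ℝ) / κ - t| ≤ 1 / κ := by
      have : (j : ℝ) / κ - t = (j - κ * t) / κ := by field_simp
      rw [this, abs_div, abs_of_pos hκ0]
      gcongr
    obtain ⟨e1, e2⟩ := abs_le.1 e
    refine (h _ ⟨by linarith, by linarith⟩ _ ⟨by linarith, by linarith⟩ ?_).le
    rw [Real.dist_eq]
    exact e.trans_lt hκd
  rw [dist_comm]
  refine polygon_mem (by omega) (by simpa using hf) rfl b1 b2 (convex_closedBall (f t) η)
    (close _ ?_) (close _ ?_)
  · rw [abs_le]; constructor <;> linarith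
  · push_cast; rw [abs_le]; constructor <;> linarith


/-! ## The invariance principle -/

/-- If the walk does not move much over each of the cells, its rescaled path is close to the
polygonal path through its values on the grid. -/
theorem dist_rescaled_polygon_le {α : ℝ} {k m T : ℕ} (hk : T < k) (hm : 0 < m) {r : ℤ}
    (hq : k * T + 3 ≤ m / k) {x : ℤ → ℤ × ℤ} (hx : x 0 = 0)
    (h : ∀ j : ℤ, |j| ≤ k * T + 1 → ∀ n : ℕ, n ≤ 3 * (m / k) →
      |(x ((j - 1) * (m / k : ℕ) + n) - x ((j - 1) * (m / k : ℕ))).1| < r ∧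
      |(x ((j - 1) * (m / k : ℕ) + n) - x ((j - 1) * (m / k : ℕ))).2| < r)
    {t : ℝ} (ht : |t| ≤ T) :
    dist (rescaled α m x t) (polygon k (flatten (gridIncr k (walkGrid α k m x))) t) ≤
      2 * (Real.sqrt (3 * α / 2) * (Real.sqrt m)⁻¹ * r) := by
  set c : ℝ := Real.sqrt (3 * α / 2) * (Real.sqrt m)⁻¹ with hc
  have hc0 : 0 ≤ c := by positivity
  set q : ℕ := m / k with hqdef
  set j : ℤ := ⌊k * t⌋ with hj
  obtain ⟨b0, b1, b2⟩ := floor_mul_bounds hk ht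
  have hk0 : 0 < k := by omega
  set y : ℝ × ℝ := c • planePoint x ((j - 1) * q) with hy
  -- At time `t` both paths are convex combinations of rescaled values of the walk at times in the
  -- three cells between `(j - 1) * q` and `(j + 2) * q`, so both lie in one ball around `y`.
  have near : ∀ n : ℤ, (j - 1) * q ≤ n → n ≤ (j + 2) * q →
      c • planePoint x n ∈ Metric.closedBall y (c * r) := by
    intro n h1 h2
    obtain ⟨i, rfl⟩ : ∃ i : ℕ, n = (j - 1) * q + i := ⟨(n - (j - 1) * q).toNat, by omega⟩
    have hi : i ≤ 3 * q := by
      have : (i : ℤ) ≤ 3 * q := by linarith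
      exact_mod_cast this
    obtain ⟨e1, e2⟩ := h j b0 i hi
    have e1' : |((x ((j - 1) * q + i)).1 : ℝ) - (x ((j - 1) * q)).1| ≤ r := by
      exact_mod_cast e1.le
    have e2' : |((x ((j - 1) * q + i)).2 : ℝ) - (x ((j - 1) * q)).2| ≤ r := by
      exact_mod_cast e2.le
    rw [Metric.mem_closedBall, hy, dist_smul₀, Real.norm_eq_abs, abs_of_nonneg hc0]
    gcongr
    exact max_le e1' e2'
  have hr : y ∈ Metric.closedBall y (c * r) := near _ le_rfl (by nlinarith)
  have hconv : Convex ℝ (Metric.closedBall y (c * r)) := convex_closedBall _ _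
  have h1 : polygon k (flatten (gridIncr k (walkGrid α k m x))) t ∈
      Metric.closedBall y (c * r) := by
    refine polygon_mem hk0 ?_ hj.symm b1 b2 hconv (near _ ?_ ?_) (near _ ?_ ?_)
    · simp [walkGrid, planePoint, hx]
    all_goals nlinarith
  have h2 : rescaled α m x t ∈ Metric.closedBall y (c * r) := by
    have hmod := Nat.div_add_mod m k
    have hlt := Nat.mod_lt m hk0
    rw [← hqdef] at hmod
    set s := m % k
    have hkr : (0 : ℝ) < k := by exact_mod_cast hk0
    have hmr : (k : ℝ) * q + s = m := by exact_mod_cast hmod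
    have hs0 : (0 : ℝ) ≤ s := by positivity
    have hsk : (s : ℝ) ≤ k := by exact_mod_cast hlt.le
    have f1 : (j : ℝ) ≤ k * t := Int.floor_le (k * t)
    have f2 : k * t < j + 1 := Int.lt_floor_add_one (k * t)
    have e : t * m = k * t * q + t * s := by rw [← hmr]; ring
    obtain ⟨t1, t2⟩ := abs_le.1 ht
    have hT : |t * s| ≤ k * T := by
      rw [abs_mul, abs_of_nonneg hs0, mul_comm]
      gcongr
    obtain ⟨t3, t4⟩ := abs_le.1 hT
    have hq' : (k : ℝ) * T + 3 ≤ q := by exact_mod_cast hq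
    have hq0 : (0 : ℝ) ≤ q := by positivity
    -- Since `k` need not divide `m`, the times `t * m` and `k * t * q` differ, but by at most `k *
    -- T`, which is less than a cell; hence one spare cell on each side. The slack 3 also
    -- accommodates `⌊t * m⌋ + 1`.
    have l1 : ((j - 1 : ℤ) : ℝ) * q ≤ t * m := by
      rw [e]; push_cast
      nlinarith
    have l2 : t * m ≤ ((j + 2 : ℤ) : ℝ) * q - 3 := by
      rw [e]; push_cast
      nlinarith
    have g1 : (j - 1) * q ≤ ⌊t * m⌋ := Int.le_floor.2 (by push_cast at l1 ⊢; exact l1)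
    have g2 : ⌊t * m⌋ ≤ (j + 2) * q - 3 := by
      have := (Int.floor_le (t * m)).trans l2
      exact_mod_cast this
    have e2 : rescaled α m x t = c • planePoint x ⌊t * m⌋ +
        Int.fract (t * m) • (c • planePoint x (⌊t * m⌋ + 1) - c • planePoint x ⌊t * m⌋) := by
      simp only [rescaled, interp, ContinuousMap.coe_mk, smul_add, ← smul_sub]
      rw [smul_comm]
    rw [e2]
    exact hconv.add_smul_sub_mem (near _ g1 (by linarith)) (near _ (by linarith) (by linarith))
      ⟨Int.fract_nonneg _, (Int.fract_lt_one _).le⟩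
  calc _ ≤ dist (rescaled α m x t) y + dist (polygon k (flatten (gridIncr k (walkGrid α k m x))) t) y
        := dist_triangle_right _ _ _
    _ ≤ c * r + c * r := add_le_add h2 h1
    _ = _ := by ring

/-- A union bound over at most `2 * (k * T + 1) + 1` starting points and two coordinates, with `24 *
q ^ 2 = 2 * (4 / 3) * (3 * q) ^ 2`. -/
theorem letterLaw_westWalk_cells (k T q : ℕ) {r : ℤ} (hr : 0 < r) :
    letterLaw ℤ {y | ¬ ∀ j : ℤ, |j| ≤ k * T + 1 → ∀ n : ℕ, n ≤ 3 * q →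
      |(westWalk y ((j - 1) * q + n) - westWalk y ((j - 1) * q)).1| < r ∧
      |(westWalk y ((j - 1) * q + n) - westWalk y ((j - 1) * q)).2| < r} ≤
      ENNReal.ofReal ((2 * (k * T + 1) + 1) * (24 * q ^ 2 / r ^ 4)) := by
  set J : ℤ := k * T + 1 with hJ
  have hJ0 : 0 ≤ J := by positivity
  set A : ℤ → Set (ℤ → Fin 3) := fun j =>
    {y | ∃ n ≤ 3 * q, r ≤ |(westWalk y ((j - 1) * q + n) - westWalk y ((j - 1) * q)).1|} ∪
    {y | ∃ n ≤ 3 * q, r ≤ |(westWalk y ((j - 1) * q + n) - westWalk y ((j - 1) * q)).2|}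
  have hA : ∀ j, letterLaw ℤ (A j) ≤ ENNReal.ofReal (24 * q ^ 2 / r ^ 4) := fun j => by
    refine (measure_union_le _ _).trans ((add_le_add (letterLaw_westWalk_max_fst _ hr _)
      (letterLaw_westWalk_max_snd _ hr _)).trans ?_)
    rw [← ENNReal.ofReal_add (by positivity) (by positivity)]
    refine ENNReal.ofReal_le_ofReal (le_of_eq ?_)
    push_cast; ring
  calc _ ≤ letterLaw ℤ (⋃ j ∈ Finset.Icc (-J) J, A j) := by
        refine measure_mono fun y hy => ?_
        simp only [Set.mem_ofPred_eq] at hy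
        push Not at hy
        obtain ⟨j, hj, n, hn, h⟩ := hy
        refine Set.mem_biUnion (Finset.mem_coe.2 (Finset.mem_Icc.2 (abs_le.1 hj))) ?_
        by_cases h1 : r ≤ |(westWalk y ((j - 1) * q + n) - westWalk y ((j - 1) * q)).1|
        · exact Or.inl ⟨n, hn, h1⟩
        · exact Or.inr ⟨n, hn, h (not_le.1 h1)⟩
    _ ≤ ∑ j ∈ Finset.Icc (-J) J, letterLaw ℤ (A j) := measure_biUnion_finset_le _ _
    _ ≤ ∑ _j ∈ Finset.Icc (-J) J, ENNReal.ofReal (24 * q ^ 2 / r ^ 4) :=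
        Finset.sum_le_sum fun j _ => hA j
    _ = _ := by
        rw [Finset.sum_const, Int.card_Icc, nsmul_eq_mul, ← ENNReal.ofReal_natCast,
          ← ENNReal.ofReal_mul (by positivity)]
        congr 2
        have : (((J + 1 - -J).toNat : ℕ) : ℤ) = 2 * J + 1 := by omega
        have h2 : (((J + 1 - -J).toNat : ℕ) : ℝ) = 2 * J + 1 := by exact_mod_cast this
        rw [h2, hJ]; push_cast; ring

/-- The polygonal paths through the values on a fine grid are close to the rescaled walk. -/
theorem eventually_polygon_close (α : ℝ) (T : ℕ) {η ε : ℝ} (hη : 0 < η) (hε : 0 < ε) :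
    ∀ᶠ k : ℕ in atTop, ∀ᶠ m : ℕ in atTop, letterLaw ℤ {y | ¬ ∀ t : ℝ, |t| ≤ T →
      dist (rescaled α m (westWalk y) t)
        (polygon (k + 1) (flatten (gridIncr (k + 1) (walkGrid α (k + 1) m (westWalk y)))) t) ≤ η} ≤
      ENNReal.ofReal ε := by
  set C : ℝ := Real.sqrt (3 * α / 2) + 1 with hC
  have hC0 : 0 < C := by positivity
  set B : ℝ := (2 * T + 3) * (24 * (4 * C / η) ^ 4) with hB
  have hB0 : 0 < B := by positivity
  obtain ⟨k₀, hk₀⟩ := exists_nat_ge (B / ε)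
  filter_upwards [eventually_ge_atTop (k₀ + T)] with k hk
  set κ := k + 1 with hκ
  have hκ0 : (0 : ℝ) < κ := by positivity
  have hκ1 : (1 : ℝ) ≤ κ := by rw [hκ]; push_cast; linarith [Nat.cast_nonneg (α := ℝ) k]
  have hsq : Tendsto (fun m : ℕ => Real.sqrt m) atTop atTop :=
    Real.tendsto_sqrt_atTop.comp tendsto_natCast_atTop_atTop
  filter_upwards [hsq.eventually_ge_atTop (4 * C / η), eventually_ge_atTop ((κ * T + 3) * κ)]
    with m h1 h2
  have hκN : 0 < κ := by omega
  have hm : 0 < m := by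
    have : 0 < (κ * T + 3) * κ := by positivity
    omega
  have hq : κ * T + 3 ≤ m / κ := (Nat.le_div_iff_mul_le hκN).2 h2
  have hsm : 0 < Real.sqrt m := Real.sqrt_pos.2 (by exact_mod_cast hm)
  -- Upper bound: `dist_rescaled_polygon_le` has a factor 2, so `C * r / √m` must be at most `η /
  -- 2`. Rounding down costs at most another factor 2 once `√m` is at least `4 * C / η`.
  set r : ℤ := ⌊η * Real.sqrt m / (2 * C)⌋ with hr
  have hr1 : (r : ℝ) ≤ η * Real.sqrt m / (2 * C) := Int.floor_le _
  have hr2 : η * Real.sqrt m / (4 * C) ≤ r := by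
    have h3 := Int.lt_floor_add_one (η * Real.sqrt m / (2 * C))
    have h4 : 1 ≤ η * Real.sqrt m / (4 * C) := by
      rw [one_le_div (by positivity)]
      rw [div_le_iff₀ hη] at h1
      linarith
    have h5 : η * Real.sqrt m / (2 * C) = 2 * (η * Real.sqrt m / (4 * C)) := by field_simp; ring
    rw [← hr] at h3
    linarith
  have hr0 : 0 < r := by
    have : (0 : ℝ) < r := lt_of_lt_of_le (by positivity) hr2
    exact_mod_cast this
  refine le_trans (measure_mono ?_) ((letterLaw_westWalk_cells κ T (m / κ) hr0).trans
    (ENNReal.ofReal_le_ofReal ?_))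
  · intro y hy hgood
    refine hy fun t ht => ?_
    refine (dist_rescaled_polygon_le (by omega) hm hq (intSum_zero _) hgood ht).trans ?_
    calc 2 * (Real.sqrt (3 * α / 2) * (Real.sqrt m)⁻¹ * r)
        ≤ 2 * (C * (Real.sqrt m)⁻¹ * (η * Real.sqrt m / (2 * C))) := by
          have : Real.sqrt (3 * α / 2) ≤ C := by linarith
          gcongr
      _ = η := by field_simp
  · have hqr : ((m / κ : ℕ) : ℝ) ≤ m / κ := Nat.cast_div_le
    have hmr : (0 : ℝ) < m := by exact_mod_cast hm
    -- There are of order `κ` cells, each failing with probability of order `κ ^ (-2)`. The fourth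
    -- moment matters here: a variance bound would only give order `κ ^ (-1)` per cell.
    calc (2 * ((κ : ℝ) * T + 1) + 1) * (24 * ((m / κ : ℕ) : ℝ) ^ 2 / r ^ 4)
        ≤ (κ * (2 * T + 3)) * (24 * (m / κ) ^ 2 / (η * Real.sqrt m / (4 * C)) ^ 4) := by
          gcongr
          nlinarith
      _ = B / κ := by
          have h4 : Real.sqrt m ^ 4 = m ^ 2 := by
            rw [show 4 = 2 * 2 by norm_num, pow_mul, Real.sq_sqrt (by positivity)]
          rw [hB, div_pow, div_pow, mul_pow, h4]
          field_simp
      _ ≤ ε := by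
          rw [div_le_iff₀ hκ0]
          rw [div_le_iff₀ hε] at hk₀
          have : (k₀ : ℝ) ≤ κ := by exact_mod_cast (by omega : k₀ ≤ κ)
          nlinarith

section

variable {Ω' : Type*} [MeasurableSpace Ω'] {P' : Measure Ω'} [IsProbabilityMeasure P'] {α : ℝ}
  {Z : Ω' → C(ℝ, ℝ × ℝ)}

theorem tendstoInDistribution_westWalk (hα : 0 < α) (hZ : IsCorrelatedBrownian α Z P') :
    TendstoInDistribution (fun (m : ℕ) y => rescaled α m (westWalk y)) atTop Z
      (fun _ => letterLaw ℤ) P' := by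
  have hp := fun k : ℕ => (tendstoInDistribution_walkGrid hα hZ (Nat.succ_pos k)).continuous_comp
    (continuous_polygon (k + 1))
  refine tendstoInDistribution_of_approx
    (X' := fun k m y => polygon (k + 1) (flatten (gridIncr (k + 1)
      (walkGrid α (k + 1) m (westWalk y)))))
    (Z' := fun k ω => polygon (k + 1) (flatten (gridIncr (k + 1) fun j => Z ω (j / (k + 1 : ℕ)))))
    (fun m => (measurable_rescaled measurable_westWalk α m).aemeasurable) (fun k => ?_) ?_ ?_
  · exact hp k
  · refine tendstoInDistribution_of_ae_tendsto (fun k => ?_) hZ.aemeasurable ?_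
    · exact (hp k).aemeasurable_limit
    · filter_upwards [hZ.ae_zero] with ω hω
      exact tendsto_polygon hω
  · intro V hV ε hε
    obtain ⟨T, η, hη, h⟩ := mem_uniformity_of_forall_close hV
    filter_upwards [eventually_polygon_close α T hη hε] with k hk
    filter_upwards [hk] with m hm
    refine (measure_mono fun y hy => ?_).trans hm
    exact fun hc => hy (h _ _ hc)

/-- The walk of the primal north-going and south-going trees satisfies the invariance principle. -/
theorem tendstoInDistribution_primalPath (hα : 0 < α) (hZ : IsCorrelatedBrownian α Z P') :
    TendstoInDistribution (fun (m : ℕ) x => rescaled α m (primalPath x)) atTop Z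
      (fun _ => letterLaw ℤ) P' :=
  tendstoInDistribution_comp_of_map_eq measurable_westLetter.aemeasurable map_westLetter
    (tendstoInDistribution_westWalk hα hZ)

end


/-! ## Measurability of the walks -/

theorem measurable_relHeight {F : (ℤ → Fin 3) → ℤ → ℤ} (hF : ∀ k, Measurable fun x => F x k)
    {a b : (ℤ → Fin 3) → ℤ} (ha : Measurable a) (hb : Measurable b) :
    Measurable fun x => relHeight (F x) (a x) (b x) := by
  have h : ∀ {a b : (ℤ → Fin 3) → ℤ}, Measurable a → Measurable b →
      Measurable fun x => sInf {k : ℕ | ∃ j : ℕ, (F x)^[k] (a x) = (F x)^[j] (b x)} :=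
    fun {a b} ha hb => measurable_natSInf fun k => by
      have e : {x | ∃ j : ℕ, (F x)^[k] (a x) = (F x)^[j] (b x)} =
          ⋃ j : ℕ, {x | (F x)^[k] (a x) = (F x)^[j] (b x)} := by ext x; simp
      rw [e]
      exact MeasurableSet.iUnion fun j => measurableSet_eq_fun
        (measurable_index (measurable_iterate hF k) ha)
        (measurable_index (measurable_iterate hF j) hb)
  have hc : Measurable fun n : ℕ => (n : ℤ) := measurable_of_countable _
  exact (hc.comp (h ha hb)).sub (hc.comp (h hb ha))

theorem measurable_dualPath (n : ℤ) : Measurable fun x => dualPath x n := by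
  have h : ∀ n, Measurable fun x => dualSouthHeight x n := fun n =>
    measurable_relHeight measurable_dualSouthNext (measurable_westPath n) measurable_const
  exact (h n).prodMk ((h (-n)).comp measurable_revSeq)

theorem measurable_primalPath (n : ℤ) : Measurable fun x => primalPath x n :=
  (measurable_westWalk n).comp measurable_westLetter

/-! ## The letters of the walk -/

/-- The letter of a step. -/
def letterOf (v : ℤ × ℤ) : Fin 3 := if v = (1, 0) then 0 else if v = (0, -1) then 1 else 2

/-- The letters of the steps of a walk. -/
def letters (w : ℤ → ℤ × ℤ) (n : ℤ) : Fin 3 := letterOf (w n - w (n - 1))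

theorem stepOf_letterOf {v : ℤ × ℤ} (hv : v ∈ ({(1, 0), (0, -1), (-1, 1)} : Set (ℤ × ℤ))) :
    stepOf (letterOf v) = v := by
  rcases hv with rfl | rfl | rfl <;> decide

theorem letterOf_stepOf (a : Fin 3) : letterOf (stepOf a) = a := by
  fin_cases a <;> decide

theorem map_letterOf :
    (uniformOn ({(1, 0), (0, -1), (-1, 1)} : Set (ℤ × ℤ))).map letterOf =
      uniformOn (Set.univ : Set (Fin 3)) := by
  refine Measure.ext_of_singleton fun a => ?_
  rw [uniformOn_univ_singleton, Measure.map_apply (measurable_of_countable _)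
    (measurableSet_singleton a), uniformOn, cond_apply (by measurability)]
  have h1 : ({(1, 0), (0, -1), (-1, 1)} : Set (ℤ × ℤ)) ∩ letterOf ⁻¹' {a} = {stepOf a} := by
    ext v
    constructor
    · rintro ⟨h, h'⟩
      rw [Set.mem_singleton_iff, ← stepOf_letterOf h]
      exact congrArg stepOf h'
    · rintro rfl
      refine ⟨?_, letterOf_stepOf a⟩
      fin_cases a <;> simp [stepOf]
  have h2 : Measure.count ({(1, 0), (0, -1), (-1, 1)} : Set (ℤ × ℤ)) = 3 := by
    have := Measure.count_apply_finset (α := ℤ × ℤ) {(1, 0), (0, -1), (-1, 1)}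
    simpa using this
  rw [h1, h2, Measure.count_singleton, mul_one]

namespace IsUniformBipolarWalk

variable {Ω : Type*} [MeasurableSpace Ω] {P : Measure Ω}
  {W : Ω → ℤ → ℤ × ℤ} (hW : IsUniformBipolarWalk W P)
include hW

theorem hasLaw_letter (n : ℤ) :
    HasLaw (fun ω => letters (W ω) n) (uniformOn (Set.univ : Set (Fin 3))) P := by
  have h := hW.law (n - 1)
  rw [sub_add_cancel] at h
  have hm : Measurable letterOf := measurable_of_countable _
  refine ⟨hm.comp_aemeasurable h.aemeasurable, ?_⟩
  rw [← map_letterOf, ← h.map_eq, AEMeasurable.map_map_of_aemeasurable hm.aemeasurable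
    h.aemeasurable]
  rfl

theorem aemeasurable_letters : AEMeasurable (fun ω => letters (W ω)) P :=
  aemeasurable_pi_lambda _ fun n => (hW.hasLaw_letter n).aemeasurable

theorem map_letters : P.map (fun ω => letters (W ω)) = letterLaw ℤ := by
  have hm : Measurable letterOf := measurable_of_countable _
  have h1 : iIndepFun (fun (n : ℤ) ω => letters (W ω) n) P := by
    have h2 := (hW.indep.precomp (g := fun n : ℤ => n - 1) sub_left_injective).comp
      (fun _ => letterOf) fun _ => hm
    refine h2.congr fun n => ae_of_all _ fun ω => ?_
    simp [letters]
  rw [h1.map_fun_eq_infinitePi_map₀ hW.aemeasurable_letters, letterLaw]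
  congr 1
  funext n
  exact (hW.hasLaw_letter n).map_eq

theorem ae_step : ∀ᵐ ω ∂P, ∀ n, W ω n - W ω (n - 1) = stepOf (letters (W ω) n) := by
  refine ae_all_iff.2 fun n => ?_
  have h := hW.law (n - 1)
  rw [sub_add_cancel] at h
  have h1 : ∀ᵐ v ∂uniformOn ({(1, 0), (0, -1), (-1, 1)} : Set (ℤ × ℤ)),
      v ∈ ({(1, 0), (0, -1), (-1, 1)} : Set (ℤ × ℤ)) := ae_cond_mem (by measurability)
  rw [← h.map_eq] at h1
  filter_upwards [ae_of_ae_map h.aemeasurable h1] with ω hω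
  exact (stepOf_letterOf hω).symm

theorem ae_walks : ∀ᵐ ω ∂P, (sewnMap (W ω)).dualWalk 0 = dualPath (letters (W ω)) ∧
    (sewnMap (W ω)).primalWestWalk 0 = primalPath (letters (W ω)) := by
  have h := ae_recurrent
  rw [← hW.map_letters] at h
  filter_upwards [hW.ae_step, ae_of_ae_map hW.aemeasurable_letters h] with ω h1 h2
  exact ⟨funext fun n => h2.dualWalk_eq h1 n, h2.primalWestWalk_eq h1⟩

theorem eventually_close (α T : ℝ) {η ε : ℝ} (hη : 0 < η) (hε : 0 < ε) :
    ∀ᶠ m : ℕ in atTop, P {ω | ∃ t : ℝ, |t| ≤ T ∧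
      η < dist (rescaled α m (dualPath (letters (W ω))) t)
        ((3 : ℝ) • rescaled α m (primalPath (letters (W ω))) t)} ≤ ENNReal.ofReal ε := by
  filter_upwards [eventually_dualPath_close α T hη hε] with m hm
  rw [← hW.map_letters] at hm
  -- The event involves uncountably many `t`; this direction of the comparison with the image
  -- measure needs no measurability.
  exact (Measure.le_map_apply hW.aemeasurable_letters _).trans hm

end IsUniformBipolarWalk

/-- For the first claim the invariance principle of the primal walk is composed with `f ↦ (3 f, f)`,
and the first component is replaced by the close dual walk. For the second claim the dual walk is
divided by 3 and replaced by the close primal walk; nothing about the joint law with `W` enters. -/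
theorem mainTheorem2 {Ω : Type*} [MeasurableSpace Ω] (P : Measure Ω) [IsProbabilityMeasure P]
    {Ω₁ : Type*} [MeasurableSpace Ω₁] (P₁ : Measure Ω₁) [IsProbabilityMeasure P₁]
    (α : ℝ) (hα : 0 < α)
    (W : Ω → ℤ → ℤ × ℤ) (hW : IsUniformBipolarWalk W P)
    (Z : Ω₁ → C(ℝ, ℝ × ℝ)) (hZ : IsCorrelatedBrownian α Z P₁) :
    TendstoInDistribution
      (fun (m : ℕ) ω => (rescaled α m ((sewnMap (W ω)).dualWalk 0),
        rescaled α m ((sewnMap (W ω)).primalWestWalk 0)))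
      atTop (fun ω => ((3 : ℝ) • Z ω, Z ω)) (fun _ => P) P₁ ∧
    ∀ (Ω₂ : Type*) [MeasurableSpace Ω₂] (P₂ : Measure Ω₂) [IsProbabilityMeasure P₂]
      (Y Y' : Ω₂ → C(ℝ, ℝ × ℝ)),
      TendstoInDistribution
        (fun (m : ℕ) ω => (rescaled α m (W ω), rescaled α m ((sewnMap (W ω)).dualWalk 0)))
        atTop (fun ω => (Y ω, (3 : ℝ) • Y' ω)) (fun _ => P) P₂ →
      TendstoInDistribution
        (fun (m : ℕ) ω => (rescaled α m (W ω), rescaled α m ((sewnMap (W ω)).primalWestWalk 0)))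
        atTop (fun ω => (Y ω, Y' ω)) (fun _ => P) P₂ := by
  have hd : ∀ m, AEMeasurable (fun ω => rescaled α m (dualPath (letters (W ω)))) P := fun m =>
    (measurable_rescaled measurable_dualPath α m).comp_aemeasurable hW.aemeasurable_letters
  have hp : ∀ m, AEMeasurable (fun ω => rescaled α m (primalPath (letters (W ω)))) P := fun m =>
    (measurable_rescaled measurable_primalPath α m).comp_aemeasurable hW.aemeasurable_letters
  refine ⟨?_, fun Ω₂ _ P₂ _ Y Y' h => ?_⟩
  · have h1 : TendstoInDistribution (fun (m : ℕ) ω => rescaled α m (primalPath (letters (W ω))))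
        atTop Z (fun _ => P) P₁ :=
      tendstoInDistribution_comp_of_map_eq hW.aemeasurable_letters hW.map_letters
        (tendstoInDistribution_primalPath hα hZ)
    have hg : Continuous fun f : C(ℝ, ℝ × ℝ) => ((3 : ℝ) • f, f) := by fun_prop
    have h2 := h1.continuous_comp hg
    have h3 : TendstoInDistribution
        (fun (m : ℕ) ω => (rescaled α m (dualPath (letters (W ω))),
          rescaled α m (primalPath (letters (W ω)))))
        atTop (fun ω => ((3 : ℝ) • Z ω, Z ω)) (fun _ => P) P₁ := by
      refine tendstoInDistribution_of_close (fun m => (hd m).prodMk (hp m)) h2 fun V hV ε hε => ?_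
      obtain ⟨U, hU, U', hU', hV⟩ := entourageProd_subset hV
      obtain ⟨T, η, hη, hc⟩ := mem_uniformity_of_forall_close hU
      filter_upwards [hW.eventually_close α T hη hε] with m hm
      refine (measure_mono fun ω hω => ?_).trans hm
      by_contra hcon
      refine hω (hV ⟨hc _ _ fun t ht => ?_, refl_mem_uniformity hU'⟩)
      by_contra hlt
      exact hcon ⟨t, ht, not_le.1 hlt⟩
    refine h3.congr (fun m => ?_) (ae_eq_refl _)
    filter_upwards [hW.ae_walks] with ω hω
    rw [hω.1, hω.2]
  · have hg : Continuous fun p : C(ℝ, ℝ × ℝ) × C(ℝ, ℝ × ℝ) => (p.1, (3 : ℝ)⁻¹ • p.2) := by fun_prop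
    have h2 := h.continuous_comp hg
    have h3 : TendstoInDistribution
        (fun (m : ℕ) ω => (rescaled α m (W ω), (3 : ℝ)⁻¹ • rescaled α m (dualPath (letters (W ω)))))
        atTop (fun ω => (Y ω, Y' ω)) (fun _ => P) P₂ := by
      refine h2.congr (fun m => ?_) (ae_of_all _ fun ω => ?_)
      · filter_upwards [hW.ae_walks] with ω hω
        simp [hω.1]
      · simp
    have h4 : TendstoInDistribution
        (fun (m : ℕ) ω => (rescaled α m (W ω), rescaled α m (primalPath (letters (W ω)))))
        atTop (fun ω => (Y ω, Y' ω)) (fun _ => P) P₂ := by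
      refine tendstoInDistribution_of_close
        (fun m => (h.forall_aemeasurable m).fst.prodMk (hp m)) h3 fun V hV ε hε => ?_
      obtain ⟨U, hU, U', hU', hV⟩ := entourageProd_subset hV
      obtain ⟨T, η, hη, hc⟩ := mem_uniformity_of_forall_close hU'
      -- Dividing by 3 divides distances by 3, so the comparison with the dual walk is needed only
      -- at precision `3 * η`.
      filter_upwards [hW.eventually_close α T (by positivity : 0 < 3 * η) hε] with m hm
      refine (measure_mono fun ω hω => ?_).trans hm
      by_contra hcon
      refine hω (hV ⟨refl_mem_uniformity hU, hc _ _ fun t ht => ?_⟩)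
      by_contra hlt
      refine hcon ⟨t, ht, ?_⟩
      rw [not_le] at hlt
      set a := rescaled α m (primalPath (letters (W ω))) t
      set b := rescaled α m (dualPath (letters (W ω))) t
      have e : dist b ((3 : ℝ) • a) = 3 * dist a ((3 : ℝ)⁻¹ • b) := by
        have : b = (3 : ℝ) • (3 : ℝ)⁻¹ • b := by simp [smul_smul]
        conv_lhs => rw [this, dist_smul₀, dist_comm]
        simp
      rw [e]
      exact mul_lt_mul_of_pos_left hlt (by norm_num)
    refine h4.congr (fun m => ?_) (ae_eq_refl _)
    filter_upwards [hW.ae_walks] with ω hω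
    rw [hω.2]
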